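/- **Conventions.** For a C\*-algebra $A$, $\operatorname{Cu}(A)=(A\otimes\mathcal K)_+/{\sim_{\mathrm{Cu}}}$ is the Cuntz semigroup with the order induced by Cuntz subequivalence and addition given by orthogonal sums; $\operatorname{Cu}(\varphi)[a]=[(\varphi\otimes\mathrm{id})(a)]$ (we write $[\varphi(a)]$). In an ordered set, $a\ll b$ means: for every increasing sequence $(b_n)$ whose supremum exists and satisfies $b\le\sup_n b_n$ there is $n$ with $a\le b_n$. A *$\operatorname{Cu}$-semigroup* is a positively ordered abelian monoid $S$ in which (O1) increasing sequences have suprema, (O2) every element is the supremum of a sequence $a_0\ll a_1\ll\cdots$, (O3) $\ll$ is compatible with addition, (O4) suprema of increasing sequences are compatible with addition. A *$\operatorname{Cu}$-morphism* is an additive map (with $0\mapsto 0$) preserving $\le$, $\ll$ and suprema of increasing sequences. A *$\mathrm W$-semigroup* is an abelian monoid with a transitive relation $\prec$, compatible with addition and with $0\prec a$ for all $a$, such that (W1) for every $a$ there are $a_0\prec a_1\prec\cdots$ with $a_k\prec a$ for all $k$ such that $b\prec a$ implies $b\prec a_k$ for some $k$, and (W4) $a\prec b+c$ implies $a\prec b'+c'$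 for some $b'\prec b$, $c'\prec c$. A *$\mathrm W$-morphism* is an additive map $f$ (with $0\mapsto0$) such that $a\prec b$ implies $f(a)\prec f(b)$, and $b\prec f(a)$ implies $b\prec f(a')$ for some $a'\prec a$. A $\operatorname{Cu}$-semigroup is regarded as a $\mathrm W$-semigroup with ${\prec}={\ll}$. A pair $\alpha=(\prec,\le)$ on a $\mathrm W$-semigroup $(S,\prec)$, with $\le$ a preorder, is *normal* if: $a\le b$ whenever every $x$ with $x\mathrel{({\le}\circ{\prec})}a$ satisfies $x\mathrel{({\le}\circ{\prec})}b$; both relations are additively closed; and ${\prec}\circ{\le}\subseteq{\prec}\circ{\le}\circ{\prec}$. Then $S/\alpha$ is the antisymmetrization of $(S,\le)$, with natural map $\pi_\alpha\colon S\to S/\alpha$ and with $[a]\prec_\alpha[b]$ iff $a\le c\prec b$ for some $c\in S$. A *closed ideal* of $S$ is a submonoid $I$ such that $a\prec b\in I$ implies $a\in I$, and $\{x: x\prec a\}\subseteq I$ implies $a\in I$; it has the pair $\alpha_I=(\prec,\le_I)$, where $a\le_I b$ iff for all $x\prec a$ there is $y\in I$ with $x\prec b+y$, and $S/I:=S/\alpha_I$.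 For a pair $\alpha=(\prec,\le)$ put $I_\alpha=\{a: a\le 0\}$. The *kernel pair* of a $\mathrm W$-morphism $f\colon S\to T$ is $\ker(f)=(\prec,\le_f)$, where $a\le_f b$ iff every $x\prec f(a)$ satisfies $x\prec f(b)$. **Theorem.** Let $\varphi\colon A\to B$ be a \*-homomorphism between C\*-algebras whose kernel is $\sigma$-unital, and let $\varphi=\overline\varphi\circ\pi_{\ker\varphi}$ be its factorization through the surjection $\pi_{\ker\varphi}\colon A\to A/\ker\varphi$ and the injection $\overline\varphi\colon A/\ker\varphi\to B$. Let $M=\{[\varphi(a)]\in\operatorname{Cu}(B): a\in(A\otimes\mathcal K)_+\}$, with the addition and order of $\operatorname{Cu}(B)$ and the restriction of the relation $\ll$ of $\operatorname{Cu}(B)$. 1. $\operatorname{Cu}(A)$, $\operatorname{Cu}(B)$ and $\operatorname{Cu}(A/\ker\varphi)$ are $\operatorname{Cu}$-semigroups; $\operatorname{Cu}(\varphi)$, $\operatorname{Cu}(\pi_{\ker\varphi})$ and $\operatorname{Cu}(\overline\varphi)$ are $\operatorname{Cu}$-morphisms; $\operatorname{Cu}(\pi_{\ker\varphi})$ is surjective;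 and $\operatorname{Cu}(\varphi)=\operatorname{Cu}(\overline\varphi)\circ\operatorname{Cu}(\pi_{\ker\varphi})$. 2. The map $\operatorname{Cu}(\ker\varphi)\to\operatorname{Cu}(A)$ induced by the inclusion is an order embedding; its image, again denoted by $\operatorname{Cu}(\ker\varphi)$, is a closed ideal of $\operatorname{Cu}(A)$, and it equals $I_{\ker(\operatorname{Cu}(\varphi))}$. (Hence $\operatorname{Cu}(A)/\operatorname{Cu}(\ker\varphi)=\operatorname{Cu}(A)/I_{\ker(\operatorname{Cu}(\varphi))}$.) 3. The pairs $\alpha_{\operatorname{Cu}(\ker\varphi)}$ and $\ker(\operatorname{Cu}(\varphi))$ are normal. The quotient $\operatorname{Cu}(A)/\operatorname{Cu}(\ker\varphi)$ is a $\operatorname{Cu}$-semigroup whose relation $\prec_\alpha$ is $\ll$, and its natural map $\pi_{\operatorname{Cu}(\ker\varphi)}$ is a surjective $\operatorname{Cu}$-morphism. The quotient $\operatorname{Cu}(A)/\ker(\operatorname{Cu}(\varphi))$ is a $\mathrm W$-semigroup, and its natural map $\pi_{\ker(\operatorname{Cu}(\varphi))}$ is a surjective $\mathrm W$-morphism. Moreover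 $M$ is a $\mathrm W$-semigroup, and the inclusion $M\hookrightarrow\operatorname{Cu}(B)$ is a $\mathrm W$-morphism. 4. There are an isomorphism of ordered monoids $\Psi\colon\operatorname{Cu}(A)/\operatorname{Cu}(\ker\varphi)\to\operatorname{Cu}(A/\ker\varphi)$ (hence an isomorphism of $\operatorname{Cu}$-semigroups), a surjective, order-preserving $\mathrm W$-morphism $\Theta\colon\operatorname{Cu}(A)/\operatorname{Cu}(\ker\varphi)\to\operatorname{Cu}(A)/\ker(\operatorname{Cu}(\varphi))$, and an isomorphism of ordered monoids $\Phi\colon\operatorname{Cu}(A)/\ker(\operatorname{Cu}(\varphi))\to M$ that preserves and reflects $\prec$, such that $$\Psi\circ\pi_{\operatorname{Cu}(\ker\varphi)}=\operatorname{Cu}(\pi_{\ker\varphi}),\qquad \Theta\circ\pi_{\operatorname{Cu}(\ker\varphi)}=\pi_{\ker(\operatorname{Cu}(\varphi))},$$ and, with $j\colon\operatorname{Cu}(A)/\ker(\operatorname{Cu}(\varphi))\to\operatorname{Cu}(B)$ the composition of $\Phi$ with the inclusion $M\hookrightarrow\operatorname{Cu}(B)$, the map $j$ is an injective $\mathrm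 W$-morphism, $$j\circ\pi_{\ker(\operatorname{Cu}(\varphi))}=\operatorname{Cu}(\varphi),\qquad j\circ\Theta=\operatorname{Cu}(\overline\varphi)\circ\Psi .$$ -/

import Mathlib

open Filter Topology

noncomputable section

namespace CuntzSemigroup

section Stabilisation

attribute [local instance] CStarAlgebra.spectralOrder CStarAlgebra.spectralOrderedRing

/-- The infinite matrices with only finitely many nonzero entries. -/
def finMatrices (A : Type*) [NonUnitalCStarAlgebra A] : Submodule ℂ (ℕ → ℕ → A) where
  carrier := {x | ∃ n, ∀ i j, n ≤ i ∨ n ≤ j → x i j = 0}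
  zero_mem' := ⟨0, fun _ _ _ => rfl⟩
  add_mem' := by
    rintro x y ⟨n, hn⟩ ⟨m, hm⟩
    refine ⟨max n m, fun i j h => ?_⟩
    simp only [Pi.add_apply]
    rw [hn i j (by omega), hm i j (by omega), add_zero]
  smul_mem' := by
    rintro c x ⟨n, hn⟩
    exact ⟨n, fun i j h => by simp [hn i j h]⟩

/-- The ⋆-algebra `M_∞(A) = ⋃ₙ Mₙ(A)`. -/
def MInf (A : Type*) [NonUnitalCStarAlgebra A] : Type _ := finMatrices A

variable {A B : Type*} [NonUnitalCStarAlgebra A] [NonUnitalCStarAlgebra B]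

namespace MInf

instance : AddCommGroup (MInf A) := inferInstanceAs (AddCommGroup (finMatrices A))
instance : Module ℂ (MInf A) := inferInstanceAs (Module ℂ (finMatrices A))

/-- The entries of a matrix. -/
def entry (x : MInf A) : ℕ → ℕ → A := Subtype.val (p := (· ∈ finMatrices A)) x

instance : CoeFun (MInf A) (fun _ => ℕ → ℕ → A) := ⟨entry⟩

theorem bounded (x : MInf A) : ∃ n, ∀ i j, n ≤ i ∨ n ≤ j → x i j = 0 :=
  Subtype.prop (p := (· ∈ finMatrices A)) x

/-- A matrix with finitely many nonzero entries from its entries. -/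
def ofFun (f : ℕ → ℕ → A) (h : ∃ n, ∀ i j, n ≤ i ∨ n ≤ j → f i j = 0) : MInf A :=
  (⟨f, h⟩ : finMatrices A)

@[simp] theorem ofFun_apply (f : ℕ → ℕ → A) (h) (i j : ℕ) : ofFun f h i j = f i j := rfl

/-- All nonzero entries of `x` lie in the upper left `n × n` corner. -/
def Bd (x : MInf A) (n : ℕ) : Prop := ∀ i j, n ≤ i ∨ n ≤ j → x i j = 0

theorem eventually_bd (x : MInf A) : ∀ᶠ n in atTop, Bd x n := by
  obtain ⟨n, hn⟩ := x.bounded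
  filter_upwards [eventually_ge_atTop n] with m hm i j h
  exact hn i j (by omega)

theorem ext {x y : MInf A} (h : ∀ i j, x i j = y i j) : x = y :=
  Subtype.ext (funext fun i => funext fun j => h i j)

@[simp] theorem add_apply (x y : MInf A) (i j : ℕ) : (x + y) i j = x i j + y i j := rfl
@[simp] theorem neg_apply (x : MInf A) (i j : ℕ) : (-x) i j = -x i j := rfl
@[simp] theorem zero_apply (i j : ℕ) : (0 : MInf A) i j = 0 := rfl
@[simp] theorem smul_apply (c : ℂ) (x : MInf A) (i j : ℕ) : (c • x) i j = c • x i j := rfl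

/-- Matrix multiplication. -/
instance : Mul (MInf A) where
  mul x y := ofFun (fun i j => ∑ᶠ k, x i k * y k j) (by
    obtain ⟨n, hn⟩ := x.bounded
    obtain ⟨m, hm⟩ := y.bounded
    refine ⟨max n m, fun i j h => ?_⟩
    rw [finsum_eq_zero_of_forall_eq_zero]
    intro k
    rcases h with h | h
    · rw [hn i k (by omega), zero_mul]
    · rw [hm k j (by omega), mul_zero])

theorem mul_apply (x y : MInf A) (i j : ℕ) : (x * y) i j = ∑ᶠ k, x i k * y k j := rfl

theorem mul_apply_of_bd {x : MInf A} {n : ℕ} (hx : Bd x n) (y : MInf A) (i j : ℕ) :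
    (x * y) i j = ∑ k : Fin n, x i k * y k j := by
  rw [mul_apply, finsum_eq_sum_of_support_subset (s := Finset.range n), Finset.sum_range]
  intro k hk
  simp only [Finset.coe_range, Set.mem_Iio]
  by_contra h
  exact hk (by simp [hx i k (by omega)])

/-- Conjugate transpose. -/
instance : Star (MInf A) where
  star x := ofFun (fun i j => star (x j i)) (by
    obtain ⟨n, hn⟩ := x.bounded
    exact ⟨n, fun i j h => by rw [hn j i (by omega), star_zero]⟩)

theorem star_apply (x : MInf A) (i j : ℕ) : (star x) i j = star (x j i) := rfl

/-- The upper left `n × n` corner, an element of the C⋆-algebra `Mₙ(A)`. -/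
def corner (n : ℕ) : MInf A →ₗ[ℂ] CStarMatrix (Fin n) (Fin n) A where
  toFun x := CStarMatrix.ofMatrix fun i j => x i j
  map_add' _ _ := rfl
  map_smul' _ _ := rfl

theorem corner_apply (n : ℕ) (x : MInf A) (i j : Fin n) : corner n x i j = x i j := rfl

theorem corner_mul_of_bd {n : ℕ} {x : MInf A} (hx : Bd x n) (y : MInf A) :
    corner n (x * y) = corner n x * corner n y := by
  ext i j
  rw [corner_apply, mul_apply_of_bd hx, CStarMatrix.mul_apply]
  rfl

theorem corner_mul (x y : MInf A) :
    ∀ᶠ n in atTop, corner n (x * y) = corner n x * corner n y := by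
  filter_upwards [eventually_bd x] with n hn using corner_mul_of_bd hn y

theorem corner_star (n : ℕ) (x : MInf A) : corner n (star x) = star (corner n x) := rfl

theorem ext_corner {x y : MInf A} (h : ∀ᶠ n in atTop, corner n x = corner n y) : x = y := by
  refine ext fun i j => ?_
  obtain ⟨n, hn, hi, hj⟩ := (h.and ((eventually_gt_atTop i).and (eventually_gt_atTop j))).exists
  exact congrFun (congrFun hn ⟨i, hi⟩) ⟨j, hj⟩

instance : NonUnitalRing (MInf A) where
  mul := (· * ·)
  left_distrib x y z := ext_corner (by
    filter_upwards [corner_mul x (y + z), corner_mul x y, corner_mul x z] with n h1 h2 h3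
    rw [h1, map_add, map_add, h2, h3, mul_add])
  right_distrib x y z := ext_corner (by
    filter_upwards [corner_mul (x + y) z, corner_mul x z, corner_mul y z] with n h1 h2 h3
    rw [h1, map_add, map_add, h2, h3, add_mul])
  zero_mul x := ext_corner (by
    filter_upwards [corner_mul 0 x] with n h1
    rw [h1, map_zero, zero_mul])
  mul_zero x := ext_corner (by
    filter_upwards [corner_mul x 0] with n h1
    rw [h1, map_zero, mul_zero])
  mul_assoc x y z := ext_corner (by
    filter_upwards [corner_mul (x * y) z, corner_mul x (y * z), corner_mul x y, corner_mul y z]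
      with n h1 h2 h3 h4
    rw [h1, h2, h3, h4, mul_assoc])

instance : StarRing (MInf A) where
  star_involutive _ := ext fun _ _ => star_star _
  star_add _ _ := ext fun _ _ => star_add _ _
  star_mul x y := ext_corner (by
    filter_upwards [corner_mul x y, corner_mul (star y) (star x)] with n h1 h2
    rw [corner_star, h1, h2, star_mul, corner_star, corner_star])

instance : IsScalarTower ℂ (MInf A) (MInf A) where
  smul_assoc c x y := ext_corner (by
    filter_upwards [corner_mul (c • x) y, corner_mul x y] with n h1 h2
    simp only [smul_eq_mul]
    rw [h1, map_smul, map_smul, h2, smul_mul_assoc])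

instance : SMulCommClass ℂ (MInf A) (MInf A) where
  smul_comm c x y := ext_corner (by
    filter_upwards [corner_mul x (c • y), corner_mul x y] with n h1 h2
    simp only [smul_eq_mul]
    rw [h1, map_smul, map_smul, h2, mul_smul_comm])

instance : StarModule ℂ (MInf A) where
  star_smul _ _ := ext fun _ _ => star_smul _ _

open Classical in
/-- The entries of the zero padding of an `n × n` matrix along an injection of index sets. -/
def padFun {n m : ℕ} (e : Fin n ↪ Fin m) (x : CStarMatrix (Fin n) (Fin n) A) :
    CStarMatrix (Fin m) (Fin m) A :=
  CStarMatrix.ofMatrix fun i j =>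
    if h : (∃ a, e a = i) ∧ (∃ b, e b = j) then x h.1.choose h.2.choose else 0

theorem padFun_apply {n m : ℕ} (e : Fin n ↪ Fin m) (x : CStarMatrix (Fin n) (Fin n) A)
    (i j : Fin n) : padFun e x (e i) (e j) = x i j := by
  have h : (∃ a, e a = e i) ∧ (∃ b, e b = e j) := ⟨⟨i, rfl⟩, ⟨j, rfl⟩⟩
  refine (dif_pos h).trans ?_
  rw [e.injective h.1.choose_spec, e.injective h.2.choose_spec]

theorem padFun_eq_zero {n m : ℕ} (e : Fin n ↪ Fin m) (x : CStarMatrix (Fin n) (Fin n) A)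
    (i j : Fin m) (h : ¬ ((∃ a, e a = i) ∧ (∃ b, e b = j))) : padFun e x i j = 0 :=
  dif_neg h

/-- Zero padding of an `n × n` matrix along an injection of index sets. -/
def pad {n m : ℕ} (e : Fin n ↪ Fin m) :
    CStarMatrix (Fin n) (Fin n) A →⋆ₙₐ[ℂ] CStarMatrix (Fin m) (Fin m) A where
  toFun := padFun e
  map_smul' c x := by
    ext i j
    rw [CStarMatrix.smul_apply]
    by_cases h : (∃ a, e a = i) ∧ (∃ b, e b = j)
    · obtain ⟨⟨a, rfl⟩, ⟨b, rfl⟩⟩ := h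
      rw [padFun_apply, padFun_apply]
      rfl
    · rw [padFun_eq_zero _ _ _ _ h, padFun_eq_zero _ _ _ _ h, smul_zero]
  map_zero' := by
    ext i j
    by_cases h : (∃ a, e a = i) ∧ (∃ b, e b = j)
    · obtain ⟨⟨a, rfl⟩, ⟨b, rfl⟩⟩ := h
      rw [padFun_apply]
      rfl
    · rw [padFun_eq_zero _ _ _ _ h]
      rfl
  map_add' x y := by
    ext i j
    rw [CStarMatrix.add_apply]
    by_cases h : (∃ a, e a = i) ∧ (∃ b, e b = j)
    · obtain ⟨⟨a, rfl⟩, ⟨b, rfl⟩⟩ := h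
      rw [padFun_apply, padFun_apply, padFun_apply]
      rfl
    · rw [padFun_eq_zero _ _ _ _ h, padFun_eq_zero _ _ _ _ h, padFun_eq_zero _ _ _ _ h, add_zero]
  map_mul' x y := by
    ext i j
    rw [CStarMatrix.mul_apply]
    by_cases hi : ∃ a, e a = i
    · by_cases hj : ∃ b, e b = j
      · obtain ⟨a, rfl⟩ := hi
        obtain ⟨b, rfl⟩ := hj
        rw [padFun_apply, CStarMatrix.mul_apply]
        refine Fintype.sum_of_injective e e.injective _ _ (fun k hk => ?_) (fun k => ?_)
        · rw [padFun_eq_zero _ _ _ _ (fun h => hk h.2), zero_mul]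
        · rw [padFun_apply, padFun_apply]
      · rw [padFun_eq_zero _ _ _ _ (fun h => hj h.2)]
        exact (Finset.sum_eq_zero fun k _ => by
          rw [padFun_eq_zero _ y _ _ (fun h => hj h.2), mul_zero]).symm
    · rw [padFun_eq_zero _ _ _ _ (fun h => hi h.1)]
      exact (Finset.sum_eq_zero fun k _ => by
        rw [padFun_eq_zero _ x _ _ (fun h => hi h.1), zero_mul]).symm
  map_star' x := by
    ext i j
    rw [CStarMatrix.star_apply]
    by_cases h : (∃ a, e a = i) ∧ (∃ b, e b = j)
    · obtain ⟨⟨a, rfl⟩, ⟨b, rfl⟩⟩ := h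
      rw [padFun_apply, padFun_apply, CStarMatrix.star_apply]
    · rw [padFun_eq_zero _ _ _ _ h, padFun_eq_zero _ _ _ _ (fun h' => h h'.symm), star_zero]

theorem pad_apply {n m : ℕ} (e : Fin n ↪ Fin m) (x : CStarMatrix (Fin n) (Fin n) A)
    (i j : Fin n) : pad e x (e i) (e j) = x i j :=
  padFun_apply e x i j

theorem pad_apply_eq_zero {n m : ℕ} (e : Fin n ↪ Fin m) (x : CStarMatrix (Fin n) (Fin n) A)
    (i j : Fin m) (h : ¬ ((∃ a, e a = i) ∧ (∃ b, e b = j))) : pad e x i j = 0 :=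
  padFun_eq_zero e x i j h

theorem norm_pad {n m : ℕ} (e : Fin n ↪ Fin m) (x : CStarMatrix (Fin n) (Fin n) A) :
    ‖pad e x‖ = ‖x‖ := by
  refine NonUnitalStarAlgHom.norm_map (pad e) (fun x y h => ?_) x
  ext i j
  rw [← pad_apply e x, ← pad_apply e y, h]

theorem norm_corner_eq {x : MInf A} {n m : ℕ} (hx : Bd x n) (h : n ≤ m) :
    ‖corner m x‖ = ‖corner n x‖ := by
  rw [← norm_pad (Fin.castLEEmb h) (corner n x)]
  congr 1
  ext i j
  by_cases hh : (∃ a, Fin.castLEEmb h a = i) ∧ (∃ b, Fin.castLEEmb h b = j)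
  · obtain ⟨⟨a, rfl⟩, ⟨b, rfl⟩⟩ := hh
    rw [pad_apply]
    rfl
  · rw [pad_apply_eq_zero _ _ _ _ hh, corner_apply]
    apply hx
    by_contra hc
    push Not at hc
    exact hh ⟨⟨⟨i, hc.1⟩, rfl⟩, ⟨⟨j, hc.2⟩, rfl⟩⟩

/-- The C⋆-norm of `M_∞(A)`: the norm in `Mₙ(A)` of any corner containing all nonzero entries
(see `norm_eq`). -/
instance : Norm (MInf A) where
  norm x := ‖corner (eventually_bd x).exists.choose x‖

theorem norm_eq {x : MInf A} {n : ℕ} (hx : Bd x n) : ‖x‖ = ‖corner n x‖ := by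
  change ‖corner (eventually_bd x).exists.choose x‖ = _
  have h := (eventually_bd x).exists.choose_spec
  rcases le_total n (eventually_bd x).exists.choose with h' | h'
  · exact norm_corner_eq hx h'
  · exact (norm_corner_eq h h').symm

theorem eventually_norm (x : MInf A) : ∀ᶠ n in atTop, ‖x‖ = ‖corner n x‖ := by
  filter_upwards [eventually_bd x] with n hn using norm_eq hn

theorem normCore : NormedSpace.Core ℂ (MInf A) where
  norm_nonneg x := norm_nonneg (corner _ x)
  norm_smul c x := by
    obtain ⟨n, h1, h2⟩ := ((eventually_norm x).and (eventually_norm (c • x))).exists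
    rw [h1, h2, map_smul, norm_smul]
  norm_triangle x y := by
    obtain ⟨n, h1, h2, h3⟩ := ((eventually_norm x).and
      ((eventually_norm y).and (eventually_norm (x + y)))).exists
    rw [h1, h2, h3, map_add]
    exact norm_add_le _ _
  norm_eq_zero_iff x := by
    refine ⟨fun h => ext_corner ?_, ?_⟩
    · filter_upwards [eventually_norm x] with n hn
      rw [map_zero, ← norm_eq_zero, ← hn, h]
    · rintro rfl
      obtain ⟨n, h1⟩ := (eventually_norm (0 : MInf A)).exists
      rw [h1, map_zero, norm_zero]

instance : NormedAddCommGroup (MInf A) := NormedAddCommGroup.ofCore normCore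
instance : NormedSpace ℂ (MInf A) := NormedSpace.ofCore normCore

instance : NonUnitalNormedRing (MInf A) where
  __ := (inferInstance : NormedAddCommGroup (MInf A))
  __ := (inferInstance : NonUnitalRing (MInf A))
  norm_mul_le x y := by
    obtain ⟨n, h1, h2, h3, h4⟩ := ((eventually_norm x).and ((eventually_norm y).and
      ((eventually_norm (x * y)).and (corner_mul x y)))).exists
    rw [h1, h2, h3, h4]
    exact norm_mul_le _ _

instance : CStarRing (MInf A) where
  norm_mul_self_le x := by
    obtain ⟨n, h1, h2, h3⟩ := ((eventually_norm x).and
      ((eventually_norm (star x * x)).and (corner_mul (star x) x))).exists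
    rw [h1, h2, h3, corner_star]
    exact CStarRing.norm_star_mul_self.ge

end MInf

namespace MInf

/-- The entries of the endomorphism of `M_∞(A)` induced by an injection of the index set. -/
def shiftEntry (t : ℕ ↪ ℕ) (x : MInf A) (i j : ℕ) : A :=
  open Classical in
  if h : (∃ a, t a = i) ∧ (∃ b, t b = j) then x h.1.choose h.2.choose else 0

theorem shiftEntry_apply (t : ℕ ↪ ℕ) (x : MInf A) (i j : ℕ) :
    shiftEntry t x (t i) (t j) = x i j := by
  have h : (∃ a, t a = t i) ∧ (∃ b, t b = t j) := ⟨⟨i, rfl⟩, ⟨j, rfl⟩⟩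
  refine (dif_pos h).trans ?_
  rw [t.injective h.1.choose_spec, t.injective h.2.choose_spec]

theorem shiftEntry_eq_zero (t : ℕ ↪ ℕ) (x : MInf A) (i j : ℕ)
    (h : ¬ ((∃ a, t a = i) ∧ (∃ b, t b = j))) : shiftEntry t x i j = 0 :=
  dif_neg h

theorem shiftEntry_bd (t : ℕ ↪ ℕ) {x : MInf A} {n m : ℕ} (hx : Bd x n) (hm : ∀ i < n, t i < m)
    (i j : ℕ) (hij : m ≤ i ∨ m ≤ j) : shiftEntry t x i j = 0 := by
  by_cases h : (∃ a, t a = i) ∧ (∃ b, t b = j)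
  · obtain ⟨⟨a, rfl⟩, ⟨b, rfl⟩⟩ := h
    rw [shiftEntry_apply]
    refine hx a b ?_
    by_contra hc
    push Not at hc
    have := hm a hc.1
    have := hm b hc.2
    omega
  · exact shiftEntry_eq_zero t x i j h

theorem eventually_shift_lt (t : ℕ ↪ ℕ) (n : ℕ) : ∀ᶠ m in atTop, ∀ i < n, t i < m := by
  filter_upwards [eventually_gt_atTop (∑ k ∈ Finset.range n, t k)] with m hm i hi
  exact (Finset.single_le_sum (f := fun k => t k) (fun _ _ => Nat.zero_le _)
    (Finset.mem_range.2 hi)).trans_lt hm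

/-- The matrix obtained by moving the entry at `(i, j)` to `(t i, t j)`. -/
def shiftFun (t : ℕ ↪ ℕ) (x : MInf A) : MInf A :=
  ofFun (shiftEntry t x) (by
    obtain ⟨n, hn⟩ := (eventually_bd x).exists
    obtain ⟨m, hm⟩ := (eventually_shift_lt t n).exists
    exact ⟨m, shiftEntry_bd t hn hm⟩)

@[simp] theorem shiftFun_apply (t : ℕ ↪ ℕ) (x : MInf A) (i j : ℕ) :
    shiftFun t x (t i) (t j) = x i j :=
  shiftEntry_apply t x i j

theorem shiftFun_eq_zero (t : ℕ ↪ ℕ) (x : MInf A) (i j : ℕ)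
    (h : ¬ ((∃ a, t a = i) ∧ (∃ b, t b = j))) : shiftFun t x i j = 0 :=
  shiftEntry_eq_zero t x i j h

/-- The restriction of an injection to initial segments. -/
def finEmb (t : ℕ ↪ ℕ) {n m : ℕ} (hm : ∀ i < n, t i < m) : Fin n ↪ Fin m where
  toFun i := ⟨t i, hm i i.2⟩
  inj' i j h := by
    simp only [Fin.mk.injEq] at h
    exact Fin.ext (t.injective h)

theorem corner_shiftFun (t : ℕ ↪ ℕ) {x : MInf A} {n m : ℕ} (hx : Bd x n)
    (hm : ∀ i < n, t i < m) : corner m (shiftFun t x) = pad (finEmb t hm) (corner n x) := by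
  ext i j
  rw [corner_apply]
  by_cases h : (∃ a, finEmb t hm a = i) ∧ (∃ b, finEmb t hm b = j)
  · obtain ⟨⟨a, rfl⟩, ⟨b, rfl⟩⟩ := h
    rw [pad_apply, corner_apply]
    exact shiftFun_apply t x a b
  · rw [pad_apply_eq_zero _ _ _ _ h]
    by_cases h' : (∃ a, t a = i) ∧ (∃ b, t b = j)
    · obtain ⟨⟨a, ha⟩, ⟨b, hb⟩⟩ := h'
      rw [← ha, ← hb, shiftFun_apply]
      refine hx a b ?_
      by_contra hc
      push Not at hc
      exact h ⟨⟨⟨a, hc.1⟩, Fin.ext ha⟩, ⟨⟨b, hc.2⟩, Fin.ext hb⟩⟩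
    · exact shiftFun_eq_zero t x i j h'

theorem norm_shiftFun (t : ℕ ↪ ℕ) (x : MInf A) : ‖shiftFun t x‖ = ‖x‖ := by
  obtain ⟨n, hn⟩ := (eventually_bd x).exists
  obtain ⟨m, hm⟩ := (eventually_shift_lt t n).exists
  rw [norm_eq hn, norm_eq (x := shiftFun t x) (n := m) (shiftEntry_bd t hn hm), corner_shiftFun t hn hm, norm_pad]

/-- The ⋆-endomorphism of `M_∞(A)` that moves the entry at `(i, j)` to `(t i, t j)`. -/
def shift (t : ℕ ↪ ℕ) : MInf A →⋆ₙₐ[ℂ] MInf A where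
  toFun := shiftFun t
  map_smul' c x := ext fun i j => by
    rw [smul_apply]
    by_cases h : (∃ a, t a = i) ∧ (∃ b, t b = j)
    · obtain ⟨⟨a, rfl⟩, ⟨b, rfl⟩⟩ := h
      rw [shiftFun_apply, shiftFun_apply]
      rfl
    · rw [shiftFun_eq_zero _ _ _ _ h, shiftFun_eq_zero _ _ _ _ h, smul_zero]
  map_zero' := ext fun i j => by
    by_cases h : (∃ a, t a = i) ∧ (∃ b, t b = j)
    · obtain ⟨⟨a, rfl⟩, ⟨b, rfl⟩⟩ := h
      rw [shiftFun_apply]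
      rfl
    · rw [shiftFun_eq_zero _ _ _ _ h]
      rfl
  map_add' x y := ext fun i j => by
    rw [add_apply]
    by_cases h : (∃ a, t a = i) ∧ (∃ b, t b = j)
    · obtain ⟨⟨a, rfl⟩, ⟨b, rfl⟩⟩ := h
      rw [shiftFun_apply, shiftFun_apply, shiftFun_apply]
      rfl
    · rw [shiftFun_eq_zero _ _ _ _ h, shiftFun_eq_zero _ _ _ _ h, shiftFun_eq_zero _ _ _ _ h,
        add_zero]
  map_mul' x y := by
    obtain ⟨n, hx, hy, hxy, hc⟩ := ((eventually_bd x).and ((eventually_bd y).and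
      ((eventually_bd (x * y)).and (corner_mul x y)))).exists
    refine ext_corner ?_
    filter_upwards [eventually_shift_lt t n, corner_mul (shiftFun t x) (shiftFun t y)]
      with m hm hm'
    rw [hm', corner_shiftFun t hxy hm, corner_shiftFun t hx hm, corner_shiftFun t hy hm, hc,
      map_mul]
  map_star' x := ext fun i j => by
    rw [star_apply]
    by_cases h : (∃ a, t a = i) ∧ (∃ b, t b = j)
    · obtain ⟨⟨a, rfl⟩, ⟨b, rfl⟩⟩ := h
      rw [shiftFun_apply, shiftFun_apply, star_apply]
    · rw [shiftFun_eq_zero _ _ _ _ h, shiftFun_eq_zero _ _ _ _ (fun h' => h h'.symm), star_zero]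

theorem shift_apply (t : ℕ ↪ ℕ) (x : MInf A) (i j : ℕ) : shift t x (t i) (t j) = x i j :=
  shiftFun_apply t x i j

theorem shift_eq_zero (t : ℕ ↪ ℕ) (x : MInf A) (i j : ℕ)
    (h : ¬ ((∃ a, t a = i) ∧ (∃ b, t b = j))) : shift t x i j = 0 :=
  shiftFun_eq_zero t x i j h

theorem norm_shift (t : ℕ ↪ ℕ) (x : MInf A) : ‖shift t x‖ = ‖x‖ := norm_shiftFun t x

theorem shift_shift (s t : ℕ ↪ ℕ) (x : MInf A) : shift s (shift t x) = shift (t.trans s) x := by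
  refine ext fun i j => ?_
  by_cases h : (∃ a, t.trans s a = i) ∧ (∃ b, t.trans s b = j)
  · obtain ⟨⟨a, rfl⟩, ⟨b, rfl⟩⟩ := h
    rw [shift_apply]
    exact (shift_apply s _ _ _).trans (shift_apply t _ _ _)
  · rw [shift_eq_zero (t.trans s) _ _ _ h]
    by_cases h' : (∃ a, s a = i) ∧ (∃ b, s b = j)
    · obtain ⟨⟨a, rfl⟩, ⟨b, rfl⟩⟩ := h'
      rw [shift_apply]
      refine shift_eq_zero t _ _ _ fun h'' => h ?_
      obtain ⟨⟨a', rfl⟩, ⟨b', rfl⟩⟩ := h''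
      exact ⟨⟨a', rfl⟩, ⟨b', rfl⟩⟩
    · exact shift_eq_zero s _ _ _ h'

theorem shift_mul_shift_eq_zero (s t : ℕ ↪ ℕ) (hst : ∀ i j, s i ≠ t j) (x y : MInf A) :
    shift s x * shift t y = 0 := by
  refine ext fun i j => ?_
  rw [mul_apply, zero_apply, finsum_eq_zero_of_forall_eq_zero]
  intro k
  by_cases hk : ∃ a, s a = k
  · rw [shift_eq_zero t y k j, mul_zero]
    rintro ⟨⟨b, hb⟩, -⟩
    obtain ⟨a, rfl⟩ := hk
    exact hst a b hb.symm
  · rw [shift_eq_zero s x i k (fun h => hk h.2), zero_mul]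

/-- The ⋆-homomorphism `M_∞(A) → M_∞(B)` that applies `φ` to every entry. -/
def map (φ : A →⋆ₙₐ[ℂ] B) : MInf A →⋆ₙₐ[ℂ] MInf B where
  toFun x := ofFun (fun i j => φ (x i j)) (by
    obtain ⟨n, hn⟩ := x.bounded
    exact ⟨n, fun i j h => by rw [hn i j h, map_zero]⟩)
  map_smul' c x := ext fun i j => by simp
  map_zero' := ext fun i j => by simp
  map_add' x y := ext fun i j => by simp
  map_mul' x y := ext fun i j => by
    obtain ⟨n, hn⟩ := (eventually_bd x).exists
    rw [mul_apply_of_bd (n := n), ofFun_apply, mul_apply_of_bd hn, map_sum]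
    · simp
    · intro i j h
      rw [ofFun_apply, hn i j h, map_zero]
  map_star' x := ext fun i j => by simp [star_apply, map_star]

theorem map_apply (φ : A →⋆ₙₐ[ℂ] B) (x : MInf A) (i j : ℕ) : map φ x i j = φ (x i j) := rfl

theorem norm_map_le (φ : A →⋆ₙₐ[ℂ] B) (x : MInf A) : ‖map φ x‖ ≤ ‖x‖ := by
  obtain ⟨n, h1, h2⟩ := ((eventually_norm x).and (eventually_norm (map φ x))).exists
  rw [h1, h2]
  exact NonUnitalStarAlgHom.norm_apply_le (CStarMatrix.mapₙₐ φ) (corner n x)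

theorem map_shift (φ : A →⋆ₙₐ[ℂ] B) (t : ℕ ↪ ℕ) (x : MInf A) :
    map φ (shift t x) = shift t (map φ x) := by
  refine ext fun i j => ?_
  rw [map_apply]
  by_cases h : (∃ a, t a = i) ∧ (∃ b, t b = j)
  · obtain ⟨⟨a, rfl⟩, ⟨b, rfl⟩⟩ := h
    rw [shift_apply, shift_apply, map_apply]
  · rw [shift_eq_zero _ _ _ _ h, shift_eq_zero _ _ _ _ h, map_zero]

end MInf
/-- The stabilisation `A ⊗ 𝒦`, as the completion of `M_∞(A)` in its C⋆-norm. -/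
def Stab (A : Type*) [NonUnitalCStarAlgebra A] : Type _ := UniformSpace.Completion (MInf A)

namespace Stab

instance : NormedAddCommGroup (Stab A) :=
  inferInstanceAs (NormedAddCommGroup (UniformSpace.Completion (MInf A)))
instance : NormedSpace ℂ (Stab A) :=
  inferInstanceAs (NormedSpace ℂ (UniformSpace.Completion (MInf A)))
instance : CompleteSpace (Stab A) :=
  inferInstanceAs (CompleteSpace (UniformSpace.Completion (MInf A)))

/-- The inclusion of `M_∞(A)`. -/
def of : MInf A →ₗᵢ[ℂ] Stab A := UniformSpace.Completion.toComplₗᵢ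

theorem denseRange_of : DenseRange (of : MInf A → Stab A) :=
  UniformSpace.Completion.denseRange_coe

@[elab_as_elim]
theorem induction {p : Stab A → Prop} (a : Stab A) (hp : IsClosed {a | p a})
    (h : ∀ x : MInf A, p (of x)) : p a :=
  UniformSpace.Completion.induction_on a hp h

/-- The continuous linear extension of a contractive linear map on `M_∞(A)`. -/
def extend {E : Type*} [NormedAddCommGroup E] [NormedSpace ℂ E] [CompleteSpace E]
    (f : MInf A →L[ℂ] E) : Stab A →L[ℂ] E :=
  ContinuousLinearMap.fromCompletion f

theorem extend_of {E : Type*} [NormedAddCommGroup E] [NormedSpace ℂ E] [CompleteSpace E]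
    (f : MInf A →L[ℂ] E) (x : MInf A) : extend f (of x) = f x :=
  ContinuousLinearMap.fromCompletion_apply_coe f x

/-- Multiplication as a bilinear map on the dense subalgebra. -/
def mulAux : MInf A →L[ℂ] MInf A →L[ℂ] Stab A :=
  LinearMap.mkContinuous₂
    ((LinearMap.mul ℂ (MInf A)).compr₂ (of : MInf A →ₗᵢ[ℂ] Stab A).toLinearMap) 1
    (fun x y => by
      simp only [LinearMap.compr₂_apply, LinearMap.mul_apply', LinearIsometry.coe_toLinearMap,
        LinearIsometry.norm_map, one_mul]
      exact norm_mul_le x y)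

theorem clm_ext {E : Type*} [NormedAddCommGroup E] [NormedSpace ℂ E] {f g : Stab A →L[ℂ] E}
    (h : ∀ x : MInf A, f (of x) = g (of x)) : f = g :=
  ContinuousLinearMap.ext fun a => induction a (isClosed_eq f.continuous g.continuous) h

theorem mulAux_apply (x y : MInf A) : mulAux x y = of (x * y) := rfl

theorem norm_extend_mulAux_le (x : MInf A) : ‖extend (mulAux x)‖ ≤ 1 * ‖x‖ := by
  refine ContinuousLinearMap.opNorm_le_bound _ (by positivity) fun a => ?_
  refine induction a (isClosed_le (by fun_prop) (by fun_prop)) fun z => ?_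
  rw [extend_of, mulAux_apply, one_mul, LinearIsometry.norm_map, LinearIsometry.norm_map]
  exact norm_mul_le x z

/-- Multiplication by an element of the dense subalgebra. -/
def mulAuxLin : MInf A →ₗ[ℂ] Stab A →L[ℂ] Stab A where
  toFun x := extend (mulAux x)
  map_add' x y := clm_ext fun z => by
    rw [add_apply, extend_of, extend_of, extend_of, mulAux_apply, mulAux_apply, mulAux_apply,
      add_mul, map_add]
  map_smul' c x := clm_ext fun z => by
    rw [RingHom.id_apply, smul_apply, extend_of, extend_of, mulAux_apply, mulAux_apply,
      smul_mul_assoc, map_smul]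

/-- Multiplication by an element of the dense subalgebra, as a bounded map. -/
def mulAux₂ : MInf A →L[ℂ] Stab A →L[ℂ] Stab A :=
  LinearMap.mkContinuous mulAuxLin 1 norm_extend_mulAux_le

/-- Multiplication as a bounded bilinear map. -/
def mulCLM : Stab A →L[ℂ] Stab A →L[ℂ] Stab A := extend mulAux₂

theorem mulCLM_of (x y : MInf A) : mulCLM (of x) (of y) = of (x * y) := by
  rw [mulCLM, extend_of]
  change extend (mulAux x) (of y) = _
  rw [extend_of]
  rfl

instance : Mul (Stab A) where
  mul a b := mulCLM a b

theorem of_mul (x y : MInf A) : of (x * y) = of x * of y := (mulCLM_of x y).symm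

theorem continuous_mul' : Continuous fun p : Stab A × Stab A => p.1 * p.2 := by
  change Continuous fun p : Stab A × Stab A => mulCLM p.1 p.2
  fun_prop

theorem continuous_mul'' {X : Type*} [TopologicalSpace X] {f g : X → Stab A} (hf : Continuous f)
    (hg : Continuous g) : Continuous fun x => f x * g x :=
  continuous_mul'.comp (hf.prodMk hg)

instance : NonUnitalRing (Stab A) where
  mul := (· * ·)
  left_distrib a b c := (mulCLM a).map_add b c
  right_distrib a b c := by
    change mulCLM (a + b) c = mulCLM a c + mulCLM b c
    rw [map_add, add_apply]
  zero_mul a := by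
    change mulCLM 0 a = 0
    rw [map_zero, zero_apply]
  mul_zero a := (mulCLM a).map_zero
  mul_assoc a b c := by
    refine UniformSpace.Completion.induction_on₃ a b c (isClosed_eq ?_ ?_) fun x y z => ?_
    · exact continuous_mul'' (continuous_mul'' continuous_fst (continuous_fst.comp continuous_snd))
        (continuous_snd.comp continuous_snd)
    · exact continuous_mul'' continuous_fst (continuous_mul'' (continuous_fst.comp continuous_snd)
        (continuous_snd.comp continuous_snd))
    · change of x * of y * of z = of x * (of y * of z)
      rw [← of_mul, ← of_mul, ← of_mul, ← of_mul, mul_assoc]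

instance : NonUnitalNormedRing (Stab A) where
  __ := (inferInstance : NormedAddCommGroup (Stab A))
  __ := (inferInstance : NonUnitalRing (Stab A))
  norm_mul_le a b := by
    refine UniformSpace.Completion.induction_on₂ a b (isClosed_le ?_ ?_) fun x y => ?_
    · exact continuous_norm.comp continuous_mul'
    · exact (continuous_norm.comp continuous_fst).mul (continuous_norm.comp continuous_snd)
    · change ‖of x * of y‖ ≤ ‖of x‖ * ‖of y‖
      rw [← of_mul, LinearIsometry.norm_map, LinearIsometry.norm_map, LinearIsometry.norm_map]
      exact norm_mul_le x y

instance : IsScalarTower ℂ (Stab A) (Stab A) where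
  smul_assoc c a b := by
    change mulCLM (c • a) b = c • mulCLM a b
    rw [map_smul, smul_apply]

instance : SMulCommClass ℂ (Stab A) (Stab A) where
  smul_comm c a b := ((mulCLM a).map_smul c b).symm

/-- The involution on the dense subalgebra. -/
def starAux : MInf A →+ Stab A where
  toFun x := of (star x)
  map_zero' := by rw [star_zero, map_zero]
  map_add' x y := by rw [star_add, map_add]

theorem continuous_starAux : Continuous (starAux : MInf A → Stab A) :=
  of.continuous.comp continuous_star

instance : Star (Stab A) where
  star a := AddMonoidHom.extension (starAux (A := A)) continuous_starAux a

theorem of_star (x : MInf A) : of (star x) = star (of x) :=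
  (AddMonoidHom.extension_coe (starAux (A := A)) continuous_starAux x).symm

theorem continuous_star' : Continuous (star : Stab A → Stab A) :=
  AddMonoidHom.continuous_extension (starAux (A := A)) continuous_starAux

instance : StarRing (Stab A) where
  star_involutive a := by
    refine induction a (isClosed_eq (continuous_star'.comp continuous_star') continuous_id)
      fun x => ?_
    rw [← of_star, ← of_star, star_star]
  star_add a b := (AddMonoidHom.extension (starAux (A := A)) continuous_starAux).map_add a b
  star_mul a b := by
    refine UniformSpace.Completion.induction_on₂ a b (isClosed_eq ?_ ?_) fun x y => ?_
    · exact continuous_star'.comp continuous_mul'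
    · exact continuous_mul'' (continuous_star'.comp continuous_snd)
        (continuous_star'.comp continuous_fst)
    · change star (of x * of y) = star (of y) * star (of x)
      rw [← of_mul, ← of_star, ← of_star, ← of_star, ← of_mul, star_mul]

instance : StarModule ℂ (Stab A) where
  star_smul c a := by
    refine induction a (isClosed_eq (continuous_star'.comp (continuous_const_smul c))
      ((continuous_const_smul _).comp continuous_star')) fun x => ?_
    rw [← map_smul, ← of_star, ← of_star, star_smul, map_smul]

instance : CStarRing (Stab A) where
  norm_mul_self_le a := by
    refine induction a (isClosed_le ?_ ?_) fun x => ?_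
    · exact continuous_norm.mul continuous_norm
    · exact continuous_norm.comp (continuous_mul'' continuous_star' continuous_id)
    · rw [← of_star, ← of_mul, LinearIsometry.norm_map, LinearIsometry.norm_map]
      exact CStarRing.norm_star_mul_self.ge

/-- The stabilisation of a C⋆-algebra is a C⋆-algebra. -/
instance : NonUnitalCStarAlgebra (Stab A) where

/-- The continuous extension of a contractive ⋆-homomorphism of matrix algebras. -/
def lift (f : MInf A →⋆ₙₐ[ℂ] MInf B) (hf : ∀ x, ‖f x‖ ≤ ‖x‖) : Stab A →⋆ₙₐ[ℂ] Stab B :=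
  let F : Stab A →L[ℂ] Stab B := extend
    (LinearMap.mkContinuous ((of : MInf B →ₗᵢ[ℂ] Stab B).toLinearMap ∘ₗ
      (f : MInf A →ₗ[ℂ] MInf B)) 1
      (fun x => by
        rw [one_mul]
        exact (LinearIsometry.norm_map of (f x)).trans_le (hf x)))
  have hF : ∀ x, F (of x) = of (f x) := fun x => extend_of _ x
  { toFun := F
    map_smul' := fun c a => F.map_smul c a
    map_zero' := F.map_zero
    map_add' := F.map_add
    map_mul' := fun a b => by
      refine UniformSpace.Completion.induction_on₂ a b (isClosed_eq ?_ ?_) fun x y => ?_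
      · exact F.continuous.comp continuous_mul'
      · exact continuous_mul'' (F.continuous.comp continuous_fst) (F.continuous.comp continuous_snd)
      · change F (of x * of y) = F (of x) * F (of y)
        rw [← of_mul, hF, hF, hF, map_mul, of_mul]
    map_star' := fun a => by
      refine induction a (isClosed_eq (F.continuous.comp continuous_star')
        (continuous_star'.comp F.continuous)) fun x => ?_
      rw [← of_star, hF, hF, map_star, of_star] }

theorem lift_of (f : MInf A →⋆ₙₐ[ℂ] MInf B) (hf : ∀ x, ‖f x‖ ≤ ‖x‖) (x : MInf A) :
    lift f hf (of x) = of (f x) :=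
  extend_of _ x

theorem continuous_starHom {D E : Type*} [NonUnitalCStarAlgebra D] [NonUnitalCStarAlgebra E]
    (f : D →⋆ₙₐ[ℂ] E) : Continuous f :=
  AddMonoidHomClass.continuous_of_bound f 1 fun x => by
    rw [one_mul]
    exact NonUnitalStarAlgHom.norm_apply_le f x

/-- The ⋆-homomorphism `φ ⊗ id : A ⊗ 𝒦 → B ⊗ 𝒦`. -/
def map (φ : A →⋆ₙₐ[ℂ] B) : Stab A →⋆ₙₐ[ℂ] Stab B := lift (MInf.map φ) (MInf.norm_map_le φ)

theorem map_of (φ : A →⋆ₙₐ[ℂ] B) (x : MInf A) : map φ (of x) = of (MInf.map φ x) := lift_of _ _ x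

/-- The ⋆-endomorphism of `A ⊗ 𝒦` that moves the entry at `(i, j)` to `(t i, t j)`, that is,
conjugation by the isometry of `ℓ²(ℕ)` sending the `i`-th to the `t i`-th basis vector. -/
def shift (t : ℕ ↪ ℕ) : Stab A →⋆ₙₐ[ℂ] Stab A := lift (MInf.shift t) fun x => (MInf.norm_shift t x).le

theorem shift_of (t : ℕ ↪ ℕ) (x : MInf A) : shift t (of x) = of (MInf.shift t x) := lift_of _ _ x

theorem map_shift (φ : A →⋆ₙₐ[ℂ] B) (t : ℕ ↪ ℕ) (a : Stab A) :
    map φ (shift t a) = shift t (map φ a) := by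
  refine induction a (isClosed_eq ((continuous_starHom _).comp (continuous_starHom _))
    ((continuous_starHom _).comp (continuous_starHom _))) fun x => ?_
  rw [shift_of, map_of, map_of, shift_of, MInf.map_shift]

theorem shift_shift (s t : ℕ ↪ ℕ) (a : Stab A) : shift s (shift t a) = shift (t.trans s) a := by
  refine induction a (isClosed_eq ((continuous_starHom _).comp (continuous_starHom _))
    (continuous_starHom _)) fun x => ?_
  rw [shift_of, shift_of, shift_of, MInf.shift_shift]

theorem shift_mul_shift_eq_zero (s t : ℕ ↪ ℕ) (hst : ∀ i j, s i ≠ t j) (a b : Stab A) :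
    shift s a * shift t b = 0 := by
  refine UniformSpace.Completion.induction_on₂ a b (isClosed_eq ?_ continuous_const) fun x y => ?_
  · exact continuous_mul'' ((continuous_starHom _).comp continuous_fst)
      ((continuous_starHom _).comp continuous_snd)
  · change shift s (of x) * shift t (of y) = 0
    rw [shift_of, shift_of, ← of_mul, MInf.shift_mul_shift_eq_zero s t hst, map_zero]

end Stab

/-! Cuntz comparison -/

section Cuntz

variable {D E : Type*} [NonUnitalCStarAlgebra D] [NonUnitalCStarAlgebra E]

/-- Positive elements of a C⋆-algebra. -/
def IsPositive (a : D) : Prop := ∃ y : D, a = star y * y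

/-- Cuntz subequivalence: `a` is a norm limit of elements of the form `x b x⋆`. -/
def CuntzLE (a b : D) : Prop := ∀ ε : ℝ, 0 < ε → ∃ x : D, ‖a - x * b * star x‖ < ε

theorem CuntzLE.trans {a b c : D} (hab : CuntzLE a b) (hbc : CuntzLE b c) : CuntzLE a c := by
  intro ε hε
  obtain ⟨x, hx⟩ := hab (ε / 2) (by positivity)
  obtain ⟨y, hy⟩ := hbc (ε / (2 * (‖x‖ * ‖x‖ + 1))) (by positivity)
  refine ⟨x * y, ?_⟩
  have h1 : a - x * y * c * star (x * y)
      = (a - x * b * star x) + x * (b - y * c * star y) * star x := by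
    rw [star_mul]
    noncomm_ring
  have h2 : ‖x * (b - y * c * star y) * star x‖ ≤ ‖x‖ * ‖x‖ * ‖b - y * c * star y‖ := by
    calc _ ≤ ‖x‖ * ‖b - y * c * star y‖ * ‖star x‖ :=
          (norm_mul_le _ _).trans (by gcongr; exact norm_mul_le _ _)
      _ = _ := by rw [norm_star]; ring
  have h3 : ‖x‖ * ‖x‖ * ‖b - y * c * star y‖ ≤ ε / 2 := by
    calc _ ≤ (‖x‖ * ‖x‖ + 1) * (ε / (2 * (‖x‖ * ‖x‖ + 1))) := by gcongr; linarith
      _ = ε / 2 := by field_simp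
  rw [h1]
  exact (norm_add_le _ _).trans_lt (by linarith)

theorem CuntzLE.map (f : D →⋆ₙₐ[ℂ] E) {a b : D} (h : CuntzLE a b) : CuntzLE (f a) (f b) := by
  intro ε hε
  obtain ⟨x, hx⟩ := h ε hε
  refine ⟨f x, ?_⟩
  rw [← map_star, ← map_mul, ← map_mul, ← map_sub]
  exact (NonUnitalStarAlgHom.norm_apply_le f _).trans_lt hx

theorem IsPositive.map (f : D →⋆ₙₐ[ℂ] E) {a : D} (h : IsPositive a) : IsPositive (f a) := by
  obtain ⟨y, rfl⟩ := h
  exact ⟨f y, by rw [map_mul, map_star]⟩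

end Cuntz

namespace MInf

/-- The matrix with entry `e` at `(t j, j)` for `j < n`. -/
def col (t : ℕ ↪ ℕ) (n : ℕ) (e : A) : MInf A :=
  ofFun (fun i j => if j < n ∧ i = t j then e else 0) (by
    obtain ⟨m, hm⟩ := (eventually_shift_lt t n).exists
    refine ⟨max n m, fun i j h => if_neg ?_⟩
    rintro ⟨h1, rfl⟩
    have := hm j h1
    omega)

theorem col_mul_apply (t : ℕ ↪ ℕ) (n : ℕ) (e : A) (x : MInf A) (a j : ℕ) :
    (col t n e * x) (t a) j = (if a < n then e else 0) * x a j := by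
  rw [mul_apply, finsum_eq_single _ a]
  · simp [col]
  · intro k hk
    have : t a ≠ t k := fun h => hk (t.injective h).symm
    simp [col, this]

theorem col_mul_apply_eq_zero (t : ℕ ↪ ℕ) (n : ℕ) (e : A) (x : MInf A) (i j : ℕ)
    (h : ¬ ∃ a, t a = i) : (col t n e * x) i j = 0 := by
  rw [mul_apply, finsum_eq_zero_of_forall_eq_zero]
  intro k
  have : i ≠ t k := fun h' => h ⟨k, h'.symm⟩
  simp [col, this]

theorem star_col_mul_apply (t : ℕ ↪ ℕ) (n : ℕ) (e : A) (x : MInf A) (a j : ℕ) :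
    (star (col t n e) * x) a j = (if a < n then star e else 0) * x (t a) j := by
  rw [mul_apply, finsum_eq_single _ (t a)]
  · rw [star_apply]
    by_cases h : a < n <;> simp [col, h]
  · intro k hk
    rw [star_apply]
    simp [col, hk]

/-- The matrix with entries `e xᵢⱼ e⋆`. -/
def sand (e : A) (x : MInf A) : MInf A :=
  ofFun (fun i j => e * x i j * star e) (by
    obtain ⟨n, hn⟩ := x.bounded
    exact ⟨n, fun i j h => by rw [hn i j h, mul_zero, zero_mul]⟩)

theorem col_conj (t : ℕ ↪ ℕ) {n : ℕ} (e : A) {x : MInf A} (hx : Bd x n) :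
    col t n e * x * star (col t n e) = shift t (sand e x) := by
  have h0 : col t n e * x * star (col t n e) = star (col t n e * star (col t n e * x)) := by
    rw [star_mul, star_star]
  rw [h0]
  refine ext fun i j => ?_
  rw [star_apply]
  by_cases hj : ∃ b, t b = j
  · obtain ⟨b, rfl⟩ := hj
    rw [col_mul_apply, star_apply]
    by_cases hi : ∃ a, t a = i
    · obtain ⟨a, rfl⟩ := hi
      rw [col_mul_apply, shift_apply]
      by_cases ha : a < n
      · by_cases hb : b < n
        · simp [ha, hb, sand]
        · simp [hb, sand, hx a b (by omega)]
      · simp [ha, sand, hx a b (by omega)]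
    · rw [col_mul_apply_eq_zero _ _ _ _ _ _ hi, star_zero, mul_zero, star_zero,
        shift_eq_zero _ _ _ _ (fun h => hi h.1)]
  · rw [col_mul_apply_eq_zero _ _ _ _ _ _ hj, star_zero, shift_eq_zero _ _ _ _ (fun h => hj h.2)]

theorem star_col_conj (t : ℕ ↪ ℕ) {n : ℕ} (e : A) {x : MInf A} (hx : Bd x n) :
    star (col t n e) * shift t x * star (star (col t n e)) = sand (star e) x := by
  have h0 : star (col t n e) * shift t x * star (star (col t n e))
      = star (star (col t n e) * star (star (col t n e) * shift t x)) := by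
    rw [star_mul, star_star, star_star]
  rw [h0]
  refine ext fun a b => ?_
  rw [star_apply, star_col_mul_apply, star_apply, star_col_mul_apply, shift_apply]
  by_cases ha : a < n
  · by_cases hb : b < n
    · simp [ha, hb, sand]
    · simp [hb, sand, hx a b (by omega)]
  · simp [ha, sand, hx a b (by omega)]

/-- Scalar matrices with diagonal entry in `A`. -/
def diagHom (n : ℕ) : A →⋆ₙₐ[ℂ] CStarMatrix (Fin n) (Fin n) A where
  toFun a := CStarMatrix.ofMatrix (Matrix.diagonal fun _ => a)
  map_smul' c a := by
    ext i j
    change Matrix.diagonal (fun _ => c • a) i j = c • Matrix.diagonal (fun _ => a) i j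
    by_cases h : i = j <;> simp [Matrix.diagonal, h]
  map_zero' := by
    ext i j
    change Matrix.diagonal (fun _ => (0 : A)) i j = 0
    simp
  map_add' a b := by
    ext i j
    change Matrix.diagonal (fun _ => a + b) i j
      = Matrix.diagonal (fun _ => a) i j + Matrix.diagonal (fun _ => b) i j
    by_cases h : i = j <;> simp [Matrix.diagonal, h]
  map_mul' a b := (Matrix.diagonal_mul_diagonal _ _).symm
  map_star' a := by
    ext i j
    change Matrix.diagonal (fun _ => star a) i j = star (Matrix.diagonal (fun _ => a) j i)
    by_cases h : i = j
    · simp [Matrix.diagonal, h]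
    · simp [Matrix.diagonal, h, Ne.symm h]

theorem norm_col_le (t : ℕ ↪ ℕ) (n : ℕ) (e : A) : ‖col t n e‖ ≤ ‖e‖ := by
  have hb : Bd (star (col t n e) * col t n e) n := by
    intro a b h
    rw [star_col_mul_apply]
    by_cases ha : a < n
    · have hb : ¬ b < n := by omega
      simp [col, hb]
    · simp [ha]
  have h1 : corner n (star (col t n e) * col t n e) = diagHom n (star e * e) := by
    ext a b
    rw [corner_apply, star_col_mul_apply]
    change _ = Matrix.diagonal (fun _ => star e * e) a b
    by_cases h : a = b
    · subst h
      simp [col]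
    · have : (a : ℕ) ≠ b := fun h' => h (Fin.ext h')
      simp [col, Matrix.diagonal, h, this]
  have h2 : ‖col t n e‖ * ‖col t n e‖ ≤ ‖e‖ * ‖e‖ := by
    rw [← CStarRing.norm_star_mul_self, ← CStarRing.norm_star_mul_self, norm_eq hb, h1]
    exact NonUnitalStarAlgHom.norm_apply_le (diagHom n) _
  exact abs_le_of_sq_le_sq' (by nlinarith) (norm_nonneg _) |>.2

theorem exists_unit (x : MInf A) (ε : ℝ) (hε : 0 < ε) :
    ∃ e : A, star e = e ∧ ‖e‖ ≤ 1 ∧ ‖x - sand e x‖ < ε := by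
  have hl := CStarAlgebra.increasingApproximateUnit A
  obtain ⟨n, hn⟩ := (eventually_bd x).exists
  have key : ∀ y : A, Tendsto (fun e => e * y * star e) (CStarAlgebra.approximateUnit A) (𝓝 y) := by
    intro y
    have h1 := (hl.tendsto_mul_left y).sub_const y |>.norm
    have h2 := (hl.tendsto_mul_right y).sub_const y |>.norm
    rw [tendsto_iff_norm_sub_tendsto_zero]
    refine squeeze_zero' (Eventually.of_forall fun _ => norm_nonneg _)
      (g := fun e => ‖y * e - y‖ + ‖e * y - y‖) ?_ (by simpa using h1.add h2)
    filter_upwards [hl.eventually_norm, hl.eventually_star_eq] with e he hs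
    rw [hs]
    have : e * y * e - y = e * (y * e - y) + (e * y - y) := by noncomm_ring
    rw [this]
    refine (norm_add_le _ _).trans ?_
    gcongr
    refine (norm_mul_le _ _).trans ?_
    exact mul_le_of_le_one_left (norm_nonneg _) he
  have h3 : Tendsto (fun e => corner n (sand e x)) (CStarAlgebra.approximateUnit A)
      (𝓝 (corner n x)) := by
    refine tendsto_pi_nhds.2 fun i => tendsto_pi_nhds.2 fun j => key _
  have h4 := (tendsto_const_nhds (x := corner n x)).sub h3 |>.norm
  rw [sub_self, norm_zero] at h4
  have := hl.neBot
  obtain ⟨e, h5, h6, h7⟩ := ((h4.eventually_lt_const hε).and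
    (hl.eventually_norm.and hl.eventually_star_eq)).exists
  refine ⟨e, h7, h6, ?_⟩
  have hb : Bd (x - sand e x) n := by
    intro i j h
    rw [sub_eq_add_neg]
    simp [sand, hn i j h]
  rw [norm_eq hb, map_sub]
  exact h5

end MInf

namespace Stab

theorem norm_conj_le {D : Type*} [NonUnitalCStarAlgebra D] {v a : D} (hv : ‖v‖ ≤ 1) :
    ‖v * a * star v‖ ≤ ‖a‖ := by
  calc _ ≤ ‖v‖ * ‖a‖ * ‖star v‖ := (norm_mul_le _ _).trans (by gcongr; exact norm_mul_le _ _)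
    _ ≤ 1 * ‖a‖ * 1 := by rw [norm_star]; gcongr
    _ = ‖a‖ := by ring

theorem exists_of_near (a : Stab A) (ε : ℝ) (hε : 0 < ε) : ∃ x : MInf A, ‖a - of x‖ < ε := by
  obtain ⟨x, hx⟩ := denseRange_of.exists_dist_lt a hε
  exact ⟨x, by rwa [← dist_eq_norm]⟩

theorem shift_cuntzLE (t : ℕ ↪ ℕ) (a : Stab A) : CuntzLE (shift t a) a := by
  intro ε hε
  obtain ⟨x, hx⟩ := exists_of_near a (ε / 3) (by positivity)
  obtain ⟨e, -, he, he'⟩ := MInf.exists_unit x (ε / 3) (by positivity)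
  obtain ⟨n, hn⟩ := (MInf.eventually_bd x).exists
  refine ⟨of (MInf.col t n e), ?_⟩
  have h1 : shift t a - of (MInf.col t n e) * a * star (of (MInf.col t n e))
      = shift t (a - of x) + of (MInf.shift t (x - MInf.sand e x))
        - of (MInf.col t n e) * (a - of x) * star (of (MInf.col t n e)) := by
    rw [mul_sub, sub_mul, ← of_star, ← of_mul _ x, ← of_mul, MInf.col_conj t e hn, map_sub, map_sub,
      map_sub, shift_of]
    abel
  rw [h1]
  have h2 := NonUnitalStarAlgHom.norm_apply_le (shift t) (a - of x)
  have h3 : ‖of (MInf.shift t (x - MInf.sand e x))‖ < ε / 3 := by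
    rwa [LinearIsometry.norm_map, MInf.norm_shift]
  have h4 : ‖of (MInf.col t n e) * (a - of x) * star (of (MInf.col t n e))‖ ≤ ‖a - of x‖ :=
    norm_conj_le ((LinearIsometry.norm_map _ _).trans_le ((MInf.norm_col_le t n e).trans he))
  have h5 := norm_sub_le (shift t (a - of x) + of (MInf.shift t (x - MInf.sand e x)))
    (of (MInf.col t n e) * (a - of x) * star (of (MInf.col t n e)))
  have h6 := norm_add_le (shift t (a - of x)) (of (MInf.shift t (x - MInf.sand e x)))
  linarith

theorem cuntzLE_shift (t : ℕ ↪ ℕ) (a : Stab A) : CuntzLE a (shift t a) := by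
  intro ε hε
  obtain ⟨x, hx⟩ := exists_of_near a (ε / 3) (by positivity)
  obtain ⟨e, hs, he, he'⟩ := MInf.exists_unit x (ε / 3) (by positivity)
  obtain ⟨n, hn⟩ := (MInf.eventually_bd x).exists
  refine ⟨star (of (MInf.col t n e)), ?_⟩
  have h1 : a - star (of (MInf.col t n e)) * shift t a * star (star (of (MInf.col t n e)))
      = (a - of x) + of (x - MInf.sand e x)
        - star (of (MInf.col t n e)) * shift t (a - of x) * star (star (of (MInf.col t n e))) := by
    rw [map_sub of, map_sub (shift t), mul_sub, sub_mul, ← of_star, ← of_star, shift_of,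
      ← of_mul _ (MInf.shift t x), ← of_mul, MInf.star_col_conj t e hn, hs]
    abel
  rw [h1]
  have h2 := NonUnitalStarAlgHom.norm_apply_le (shift t) (a - of x)
  have h3 : ‖of (x - MInf.sand e x)‖ < ε / 3 := by
    rwa [LinearIsometry.norm_map]
  have h4 : ‖star (of (MInf.col t n e)) * shift t (a - of x) * star (star (of (MInf.col t n e)))‖
      ≤ ‖shift t (a - of x)‖ :=
    norm_conj_le (by
      rw [norm_star]
      exact (LinearIsometry.norm_map _ _).trans_le ((MInf.norm_col_le t n e).trans he))
  have h5 := norm_sub_le ((a - of x) + of (x - MInf.sand e x))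
    (star (of (MInf.col t n e)) * shift t (a - of x) * star (star (of (MInf.col t n e))))
  have h6 := norm_add_le (a - of x) (of (x - MInf.sand e x))
  linarith

theorem cuntzLE_refl (a : Stab A) : CuntzLE a a :=
  (cuntzLE_shift (Function.Embedding.refl ℕ) a).trans (shift_cuntzLE _ a)

/-- Orthogonal sums respect Cuntz subequivalence. -/
theorem cuntzLE_shift_add {s t : ℕ ↪ ℕ} (hst : ∀ i j, s i ≠ t j) {a a' b b' : Stab A}
    (ha : CuntzLE a a') (hb : CuntzLE b b') :
    CuntzLE (shift s a + shift t b) (shift s a' + shift t b') := by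
  intro ε hε
  obtain ⟨x, hx⟩ := ha (ε / 2) (by positivity)
  obtain ⟨y, hy⟩ := hb (ε / 2) (by positivity)
  refine ⟨shift s x + shift t y, ?_⟩
  have h1 := shift_mul_shift_eq_zero (A := A) s t hst
  have h2 := shift_mul_shift_eq_zero (A := A) t s fun i j h => hst j i h.symm
  have h3 : shift s a + shift t b - (shift s x + shift t y) * (shift s a' + shift t b') *
      star (shift s x + shift t y)
      = shift s (a - x * a' * star x) + shift t (b - y * b' * star y) := by
    rw [star_add, ← map_star, ← map_star]
    simp only [add_mul, mul_add, h1, h2, add_zero, zero_add, mul_assoc]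
    simp only [← mul_assoc, mul_zero, add_zero, zero_add, map_sub, map_mul]
    abel
  rw [h3]
  have h4 := NonUnitalStarAlgHom.norm_apply_le (shift s) (a - x * a' * star x)
  have h5 := NonUnitalStarAlgHom.norm_apply_le (shift t) (b - y * b' * star y)
  exact (norm_add_le _ _).trans_lt (by linarith)

theorem isPositive_shift_add {s t : ℕ ↪ ℕ} (hst : ∀ i j, s i ≠ t j) {a b : Stab A}
    (ha : IsPositive a) (hb : IsPositive b) : IsPositive (shift s a + shift t b) := by
  obtain ⟨x, rfl⟩ := ha
  obtain ⟨y, rfl⟩ := hb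
  have h1 := shift_mul_shift_eq_zero (A := A) s t hst
  have h2 := shift_mul_shift_eq_zero (A := A) t s fun i j h => hst j i h.symm
  refine ⟨shift s x + shift t y, ?_⟩
  rw [star_add, ← map_star, ← map_star]
  simp only [add_mul, mul_add, h1, h2, add_zero, zero_add, map_mul]

end Stab


/-- The embedding `k ↦ 2k`. -/
def evenEmb : ℕ ↪ ℕ := ⟨fun k => 2 * k, fun i j h => by simp only at h; omega⟩

/-- The embedding `k ↦ 2k + 1`. -/
def oddEmb : ℕ ↪ ℕ := ⟨fun k => 2 * k + 1, fun i j h => by simp only at h; omega⟩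

theorem evenEmb_ne_oddEmb (i j : ℕ) : evenEmb i ≠ oddEmb j := by
  change 2 * i ≠ 2 * j + 1
  omega

namespace Stab

/-- The orthogonal sum `a ⊕ b` in `A ⊗ 𝒦`, formed with the isomorphism `M₂(𝒦) ≅ 𝒦` that comes from
the partition of the index set into even and odd numbers. -/
def oplus (a b : Stab A) : Stab A := shift evenEmb a + shift oddEmb b

theorem isPositive_oplus {a b : Stab A} (ha : IsPositive a) (hb : IsPositive b) :
    IsPositive (oplus a b) :=
  isPositive_shift_add evenEmb_ne_oddEmb ha hb

theorem cuntzLE_oplus {a a' b b' : Stab A} (ha : CuntzLE a a') (hb : CuntzLE b b') :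
    CuntzLE (oplus a b) (oplus a' b') :=
  cuntzLE_shift_add evenEmb_ne_oddEmb ha hb

theorem shift_congr {s t : ℕ ↪ ℕ} (h : ∀ k, s k = t k) (a : Stab A) : shift s a = shift t a := by
  rw [Function.Embedding.ext h]

theorem shift_oplus (t : ℕ ↪ ℕ) (a b : Stab A) :
    shift t (oplus a b) = shift (evenEmb.trans t) a + shift (oddEmb.trans t) b := by
  rw [oplus, map_add, shift_shift, shift_shift]

theorem map_oplus (φ : A →⋆ₙₐ[ℂ] B) (a b : Stab A) :
    map φ (oplus a b) = oplus (map φ a) (map φ b) := by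
  rw [oplus, oplus, map_add, map_shift, map_shift]

/-- The permutation of the index set that interchanges `2k` and `2k + 1`. -/
def swapEmb : ℕ ↪ ℕ := ⟨fun k => if k % 2 = 0 then k + 1 else k - 1, fun i j h => by
  simp only at h
  split_ifs at h <;> omega⟩

theorem shift_swapEmb_oplus (a b : Stab A) : shift swapEmb (oplus a b) = oplus b a := by
  rw [shift_oplus, oplus, add_comm]
  congr 1
  · refine shift_congr (fun k => ?_) b
    change (if (2 * k + 1) % 2 = 0 then 2 * k + 1 + 1 else 2 * k + 1 - 1) = 2 * k
    split_ifs <;> omega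
  · refine shift_congr (fun k => ?_) a
    change (if (2 * k) % 2 = 0 then 2 * k + 1 else 2 * k - 1) = 2 * k + 1
    split_ifs <;> omega

/-- The permutation `4k ↦ 2k`, `4k + 2 ↦ 4k + 1`, `2k + 1 ↦ 4k + 3` of the index set. -/
def assocEmb : ℕ ↪ ℕ :=
  ⟨fun k => if k % 4 = 0 then k / 2 else if k % 4 = 2 then k - 1 else 2 * k + 1, fun i j h => by
    simp only at h
    split_ifs at h <;> omega⟩

theorem shift_assocEmb_oplus (a b c : Stab A) :
    shift assocEmb (oplus (oplus a b) c) = oplus a (oplus b c) := by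
  rw [shift_oplus, shift_oplus, oplus, shift_oplus, add_assoc]
  congr 1
  · refine shift_congr (fun k => ?_) a
    change (if (2 * (2 * k)) % 4 = 0 then (2 * (2 * k)) / 2 else if (2 * (2 * k)) % 4 = 2
      then 2 * (2 * k) - 1 else 2 * (2 * (2 * k)) + 1) = 2 * k
    split_ifs <;> omega
  · congr 1
    · refine shift_congr (fun k => ?_) b
      change (if (2 * (2 * k + 1)) % 4 = 0 then (2 * (2 * k + 1)) / 2
        else if (2 * (2 * k + 1)) % 4 = 2 then 2 * (2 * k + 1) - 1
        else 2 * (2 * (2 * k + 1)) + 1) = 2 * (2 * k) + 1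
      split_ifs <;> omega
    · refine shift_congr (fun k => ?_) c
      change (if (2 * k + 1) % 4 = 0 then (2 * k + 1) / 2 else if (2 * k + 1) % 4 = 2
        then 2 * k + 1 - 1 else 2 * (2 * k + 1) + 1) = 2 * (2 * k + 1) + 1
      split_ifs <;> omega

end Stab

/-! The Cuntz semigroup -/

/-- The positive elements of `A ⊗ 𝒦`. -/
def PosStab (A : Type*) [NonUnitalCStarAlgebra A] : Type _ := {a : Stab A // IsPositive a}

namespace PosStab

instance : Preorder (PosStab A) where
  le a b := CuntzLE a.1 b.1
  le_refl a := Stab.cuntzLE_refl a.1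
  le_trans _ _ _ h h' := h.trans h'

theorem le_def (a b : PosStab A) : a ≤ b ↔ CuntzLE a.1 b.1 := Iff.rfl

/-- The orthogonal sum of positive elements of `A ⊗ 𝒦`. -/
def oplus (a b : PosStab A) : PosStab A := ⟨Stab.oplus a.1 b.1, Stab.isPositive_oplus a.2 b.2⟩

/-- The zero element. -/
def zero : PosStab A := ⟨0, 0, by rw [mul_zero]⟩

/-- The map `(A ⊗ 𝒦)₊ → (B ⊗ 𝒦)₊` induced by a ⋆-homomorphism. -/
def map (φ : A →⋆ₙₐ[ℂ] B) (a : PosStab A) : PosStab B := ⟨Stab.map φ a.1, a.2.map _⟩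

theorem monotone_map (φ : A →⋆ₙₐ[ℂ] B) : Monotone (map φ) := fun _ _ h => CuntzLE.map _ h

end PosStab

/-- The Cuntz semigroup `Cu(A)`: Cuntz equivalence classes of positive elements of `A ⊗ 𝒦`, ordered
by Cuntz subequivalence. -/
def Cu (A : Type*) [NonUnitalCStarAlgebra A] : Type _ := Antisymmetrization (PosStab A) (· ≤ ·)

namespace Cu

instance : PartialOrder (Cu A) :=
  inferInstanceAs (PartialOrder (Antisymmetrization (PosStab A) (· ≤ ·)))

/-- The class `[a]` of a positive element of `A ⊗ 𝒦`. -/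
def mk (a : PosStab A) : Cu A := toAntisymmetrization (· ≤ ·) a

theorem mk_le_mk {a b : PosStab A} : mk a ≤ mk b ↔ CuntzLE a.1 b.1 := Iff.rfl

theorem mk_eq_mk {a b : PosStab A} : mk a = mk b ↔ CuntzLE a.1 b.1 ∧ CuntzLE b.1 a.1 := by
  rw [le_antisymm_iff, mk_le_mk, mk_le_mk]

@[elab_as_elim]
theorem ind {p : Cu A → Prop} (s : Cu A) (h : ∀ a, p (mk a)) : p s :=
  Antisymmetrization.ind (· ≤ ·) h s

instance : Zero (Cu A) := ⟨mk PosStab.zero⟩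

/-- Addition is induced by the orthogonal sum. -/
instance : Add (Cu A) :=
  ⟨Quotient.map₂ PosStab.oplus fun _ _ h _ _ h' =>
    ⟨Stab.cuntzLE_oplus h.1 h'.1, Stab.cuntzLE_oplus h.2 h'.2⟩⟩

theorem zero_def : (0 : Cu A) = mk PosStab.zero := rfl

theorem mk_add_mk (a b : PosStab A) : mk a + mk b = mk (a.oplus b) := rfl

theorem add_comm' (s t : Cu A) : s + t = t + s := by
  refine ind s fun a => ind t fun b => ?_
  rw [mk_add_mk, mk_add_mk, mk_eq_mk]
  change CuntzLE (Stab.oplus a.1 b.1) (Stab.oplus b.1 a.1) ∧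
    CuntzLE (Stab.oplus b.1 a.1) (Stab.oplus a.1 b.1)
  rw [← Stab.shift_swapEmb_oplus a.1 b.1]
  exact ⟨Stab.cuntzLE_shift _ _, Stab.shift_cuntzLE _ _⟩

theorem add_zero' (s : Cu A) : s + 0 = s := by
  refine ind s fun a => ?_
  rw [zero_def, mk_add_mk, mk_eq_mk]
  change CuntzLE (Stab.shift evenEmb a.1 + Stab.shift oddEmb 0) a.1 ∧
    CuntzLE a.1 (Stab.shift evenEmb a.1 + Stab.shift oddEmb 0)
  rw [map_zero, add_zero]
  exact ⟨Stab.shift_cuntzLE _ _, Stab.cuntzLE_shift _ _⟩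

instance : AddCommMonoid (Cu A) where
  add_assoc s t u := by
    refine ind s fun a => ind t fun b => ind u fun c => ?_
    simp only [mk_add_mk, mk_eq_mk]
    change CuntzLE (Stab.oplus (Stab.oplus a.1 b.1) c.1) (Stab.oplus a.1 (Stab.oplus b.1 c.1)) ∧
      CuntzLE (Stab.oplus a.1 (Stab.oplus b.1 c.1)) (Stab.oplus (Stab.oplus a.1 b.1) c.1)
    rw [← Stab.shift_assocEmb_oplus]
    exact ⟨Stab.cuntzLE_shift _ _, Stab.shift_cuntzLE _ _⟩
  zero_add s := by rw [add_comm', add_zero']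
  add_zero := add_zero'
  add_comm := add_comm'
  nsmul := nsmulRec

/-- The map `Cu(φ) : Cu(A) → Cu(B)`, `[a] ↦ [(φ ⊗ id)(a)]`. -/
def map (φ : A →⋆ₙₐ[ℂ] B) : Cu A →+ Cu B where
  toFun := Quotient.map (PosStab.map φ) fun _ _ h =>
    ⟨PosStab.monotone_map φ h.1, PosStab.monotone_map φ h.2⟩
  map_zero' := by
    refine mk_eq_mk.2 ?_
    change CuntzLE (Stab.map φ 0) 0 ∧ CuntzLE 0 (Stab.map φ 0)
    rw [map_zero]
    exact ⟨Stab.cuntzLE_refl _, Stab.cuntzLE_refl _⟩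
  map_add' s t := by
    refine ind s fun a => ind t fun b => mk_eq_mk.2 ?_
    change CuntzLE (Stab.map φ (Stab.oplus a.1 b.1)) (Stab.oplus (Stab.map φ a.1) (Stab.map φ b.1)) ∧
      CuntzLE (Stab.oplus (Stab.map φ a.1) (Stab.map φ b.1)) (Stab.map φ (Stab.oplus a.1 b.1))
    rw [Stab.map_oplus]
    exact ⟨Stab.cuntzLE_refl _, Stab.cuntzLE_refl _⟩

theorem map_mk (φ : A →⋆ₙₐ[ℂ] B) (a : PosStab A) : map φ (mk a) = mk (a.map φ) := rfl

end Cu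

/-! Kernels and quotients of C⋆-algebras -/

/-- The kernel of a ⋆-homomorphism. -/
def kernel (φ : A →⋆ₙₐ[ℂ] B) : NonUnitalStarSubalgebra ℂ A where
  carrier := {a | φ a = 0}
  add_mem' := fun {a b} (ha : φ a = 0) (hb : φ b = 0) => by
    change φ (a + b) = 0
    rw [map_add, ha, hb, add_zero]
  zero_mem' := map_zero φ
  mul_mem' := fun {a b} (ha : φ a = 0) _ => by
    change φ (a * b) = 0
    rw [map_mul, ha, zero_mul]
  smul_mem' := fun c a (ha : φ a = 0) => by
    change φ (c • a) = 0
    rw [map_smul, ha, smul_zero]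
  star_mem' := fun {a} (ha : φ a = 0) => by
    change φ (star a) = 0
    rw [map_star, ha, star_zero]

theorem mem_kernel {φ : A →⋆ₙₐ[ℂ] B} {a : A} : a ∈ kernel φ ↔ φ a = 0 := Iff.rfl

theorem isClosed_kernel (φ : A →⋆ₙₐ[ℂ] B) : IsClosed (kernel φ : Set A) :=
  isClosed_eq (Stab.continuous_starHom φ) continuous_const

instance (φ : A →⋆ₙₐ[ℂ] B) : NonUnitalCStarAlgebra (kernel φ) :=
  NonUnitalStarSubalgebra.nonUnitalCStarAlgebra _ (h_closed := isClosed_kernel φ)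

/-- The inclusion `ker φ → A`. -/
def kernelIncl (φ : A →⋆ₙₐ[ℂ] B) : kernel φ →⋆ₙₐ[ℂ] A := NonUnitalStarSubalgebraClass.subtype _

/-- A C⋆-algebra is `σ`-unital if it has a countable approximate unit; that is, there are positive
contractions `e₀ ≤ e₁ ≤ ⋯` with `eₙ x → x` and `x eₙ → x` for all `x`. -/
def IsSigmaUnital (D : Type*) [NonUnitalCStarAlgebra D] : Prop :=
  ∃ e : ℕ → D, (∀ n, IsPositive (e n)) ∧ (∀ n, ‖e n‖ ≤ 1) ∧ (∀ n, IsPositive (e (n + 1) - e n)) ∧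
    ∀ x, Tendsto (fun n => e n * x) atTop (𝓝 x) ∧ Tendsto (fun n => x * e n) atTop (𝓝 x)

theorem star_sub_mul_cfc (a : A) (h : ℝ → ℝ) (hcont : Continuous h) (h0 : h 0 = 0) :
    star (a - a * cfcₙ h (star a * a)) * (a - a * cfcₙ h (star a * a))
      = cfcₙ (fun t => t - h t * t - (t * h t - h t * t * h t)) (star a * a) := by
  have hks : star (cfcₙ h (star a * a)) = cfcₙ h (star a * a) :=
    (cfcₙ_predicate h (star a * a) : IsSelfAdjoint _)
  have e0 : cfcₙ (fun t : ℝ => t) (star a * a) = star a * a := cfcₙ_id' ℝ _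
  have c0 : ContinuousOn (fun t : ℝ => t) (quasispectrum ℝ (star a * a)) := continuousOn_id
  have c1 : ContinuousOn h (quasispectrum ℝ (star a * a)) := hcont.continuousOn
  have c2 := c1.mul c0
  have c3 := c0.mul c1
  have c4 := c2.mul c1
  have z2 : h 0 * 0 = 0 := mul_zero _
  have z3 : 0 * h 0 = 0 := zero_mul _
  have z4 : h 0 * 0 * h 0 = 0 := by rw [mul_zero, zero_mul]
  rw [cfcₙ_sub (fun t => t - h t * t) (fun t => t * h t - h t * t * h t) (star a * a) (c0.sub c2)
      (by rw [z2, sub_zero]) (c3.sub c4) (by rw [z3, z4, sub_zero]),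
    cfcₙ_sub (fun t => t) (fun t => h t * t) (star a * a) c0 rfl c2 z2,
    cfcₙ_sub (fun t => t * h t) (fun t => h t * t * h t) (star a * a) c3 z3 c4 z4,
    cfcₙ_mul (fun t => h t * t) h (star a * a) c2 z2 c1 h0,
    cfcₙ_mul (fun t => t) h (star a * a) c0 rfl c1 h0,
    cfcₙ_mul h (fun t => t) (star a * a) c1 h0 c0 rfl, e0, star_sub, star_mul, hks]
  noncomm_ring

/-- A ⋆-homomorphism admits norm-decreasing lifts. -/
theorem exists_norm_le_of_starHom (φ : A →⋆ₙₐ[ℂ] B) (a : A) :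
    ∃ a' : A, φ a' = φ a ∧ ‖a'‖ ≤ ‖φ a‖ := by
  rcases eq_or_ne (φ a) 0 with h0 | h0
  · exact ⟨0, by rw [map_zero, h0], by rw [h0, norm_zero, norm_zero]⟩
  have hc : 0 < ‖φ a‖ := norm_pos_iff.2 h0
  set c := ‖φ a‖ with hcdef
  set h : ℝ → ℝ := fun t => 1 - c / max c (√t) with hh
  have hm : ∀ t, 0 < max c (√t) := fun t => lt_max_of_lt_left hc
  have hcont : Continuous h := by
    refine continuous_const.sub (continuous_const.div (by fun_prop) fun t => (hm t).ne')
  have h00 : h 0 = 0 := by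
    simp only [hh, Real.sqrt_zero, max_eq_left hc.le, div_self hc.ne', sub_self]
  have hb : IsSelfAdjoint (star a * a) := IsSelfAdjoint.star_mul_self a
  have hφb : φ (star a * a) = star (φ a) * φ a := by rw [map_mul, map_star]
  have hb' : IsSelfAdjoint (φ (star a * a)) := by
    rw [hφb]
    exact IsSelfAdjoint.star_mul_self _
  have hnn : ∀ t ∈ quasispectrum ℝ (star a * a), 0 ≤ t :=
    fun t ht => quasispectrum_nonneg_of_nonneg _ (star_mul_self_nonneg a) t ht
  set k := cfcₙ h (star a * a) with hk
  have hks : star k = k := (cfcₙ_predicate h (star a * a) : IsSelfAdjoint _)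
  refine ⟨a - a * k, ?_, ?_⟩
  · have h1 : φ k = 0 := by
      rw [hk, NonUnitalStarAlgHom.map_cfcₙ (R := ℝ) (S := ℂ) φ h (star a * a)
        hcont.continuousOn h00 (Stab.continuous_starHom φ) hb hb', ← cfcₙ_zero ℝ (φ (star a * a))]
      refine cfcₙ_congr fun t ht => ?_
      have h2 : |t| ≤ ‖φ (star a * a)‖ := by
        have := norm_apply_le_norm_cfcₙ (id : ℝ → ℝ) (φ (star a * a)) ht
        rwa [cfcₙ_id ℝ (φ (star a * a))] at this
      have h3 : √t ≤ c := by
        rw [hφb, CStarRing.norm_star_mul_self] at h2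
        rw [← Real.sqrt_mul_self hc.le]
        exact Real.sqrt_le_sqrt ((le_abs_self t).trans h2)
      simp only [hh, max_eq_left h3, div_self hc.ne', sub_self, Pi.zero_apply]
    rw [map_sub, map_mul, h1, mul_zero, sub_zero]
  · have h1 := star_sub_mul_cfc a h hcont h00
    rw [← hk] at h1
    have h2 : ‖a - a * k‖ * ‖a - a * k‖ ≤ c * c := by
      rw [← CStarRing.norm_star_mul_self, h1]
      refine norm_cfcₙ_le fun t ht => ?_
      have ht' := hnn t ht
      have h3 : t - h t * t - (t * h t - h t * t * h t) = (√t / max c (√t) * c) ^ 2 := by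
        calc _ = t * (c / max c (√t)) ^ 2 := by
              simp only [hh]
              ring
          _ = √t * √t * (c / max c (√t)) ^ 2 := by rw [Real.mul_self_sqrt ht']
          _ = _ := by ring
      have h4 : √t / max c (√t) ≤ 1 := (div_le_one (hm t)).2 (le_max_right _ _)
      have h5 : 0 ≤ √t / max c (√t) := div_nonneg (Real.sqrt_nonneg _) (hm t).le
      rw [h3, Real.norm_eq_abs, abs_of_nonneg (sq_nonneg _)]
      have : √t / max c (√t) * c ≤ c := mul_le_of_le_one_left hc.le h4
      nlinarith [mul_nonneg h5 hc.le]
    exact abs_le_of_sq_le_sq' (by nlinarith) hc.le |>.2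

/-- The kernel of a ⋆-homomorphism as a closed linear subspace. -/
def kernelSubmodule (φ : A →⋆ₙₐ[ℂ] B) : Submodule ℂ A := (kernel φ).toSubmodule

theorem mem_kernelSubmodule {φ : A →⋆ₙₐ[ℂ] B} {a : A} : a ∈ kernelSubmodule φ ↔ φ a = 0 := Iff.rfl

instance (φ : A →⋆ₙₐ[ℂ] B) : IsClosed (kernelSubmodule φ : Set A) := isClosed_kernel φ

/-- The quotient C⋆-algebra `A / ker φ`, with the quotient norm. -/
def QuotKer (φ : A →⋆ₙₐ[ℂ] B) : Type _ := A ⧸ kernelSubmodule φ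

namespace QuotKer

variable (φ : A →⋆ₙₐ[ℂ] B)

instance : NormedAddCommGroup (QuotKer φ) :=
  inferInstanceAs (NormedAddCommGroup (A ⧸ kernelSubmodule φ))
instance : NormedSpace ℂ (QuotKer φ) :=
  inferInstanceAs (NormedSpace ℂ (A ⧸ kernelSubmodule φ))
instance : CompleteSpace (QuotKer φ) :=
  inferInstanceAs (CompleteSpace (A ⧸ kernelSubmodule φ))

/-- The class of an element. -/
def mk (a : A) : QuotKer φ := (kernelSubmodule φ).mkQ a

variable {φ}

@[elab_as_elim]
theorem ind {p : QuotKer φ → Prop} (x : QuotKer φ) (h : ∀ a, p (mk φ a)) : p x :=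
  Submodule.Quotient.induction_on _ x h

theorem mk_eq_mk {a b : A} : mk φ a = mk φ b ↔ φ a = φ b := by
  refine (Submodule.Quotient.eq (kernelSubmodule φ)).trans ?_
  rw [mem_kernelSubmodule, map_sub, sub_eq_zero]

theorem mk_add (a b : A) : mk φ (a + b) = mk φ a + mk φ b := rfl
theorem mk_smul (c : ℂ) (a : A) : mk φ (c • a) = c • mk φ a := rfl
theorem mk_zero : mk φ 0 = 0 := rfl

theorem norm_mk (a : A) : ‖mk φ a‖ = ‖φ a‖ := by
  apply le_antisymm
  · obtain ⟨a', h, h'⟩ := exists_norm_le_of_starHom φ a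
    rw [← mk_eq_mk.2 h]
    exact (Submodule.Quotient.norm_mk_le (kernelSubmodule φ) a').trans h'
  · refine le_of_forall_pos_lt_add fun ε hε => ?_
    obtain ⟨m, hm, hm'⟩ := Submodule.Quotient.norm_mk_lt (S := kernelSubmodule φ) (mk φ a) hε
    rw [← mk_eq_mk.1 hm]
    exact (NonUnitalStarAlgHom.norm_apply_le φ m).trans_lt hm'

/-- Multiplication of classes. -/
instance : Mul (QuotKer φ) :=
  ⟨Quotient.map₂ (· * ·) fun a a' h b b' h' => by
    refine Quotient.exact (mk_eq_mk.2 ?_ : mk φ (a * b) = mk φ (a' * b'))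
    have h1 : φ a = φ a' := mk_eq_mk.1 (Quotient.sound h : mk φ a = mk φ a')
    have h2 : φ b = φ b' := mk_eq_mk.1 (Quotient.sound h' : mk φ b = mk φ b')
    rw [map_mul, map_mul, h1, h2]⟩

/-- The involution on classes. -/
instance : Star (QuotKer φ) :=
  ⟨Quotient.map star fun a a' h => by
    refine Quotient.exact (mk_eq_mk.2 ?_ : mk φ (star a) = mk φ (star a'))
    have h1 : φ a = φ a' := mk_eq_mk.1 (Quotient.sound h : mk φ a = mk φ a')
    rw [map_star, map_star, h1]⟩

theorem mk_mul (a b : A) : mk φ (a * b) = mk φ a * mk φ b := rfl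
theorem mk_star (a : A) : mk φ (star a) = star (mk φ a) := rfl

instance : NonUnitalNormedRing (QuotKer φ) where
  __ := (inferInstance : NormedAddCommGroup (QuotKer φ))
  mul := (· * ·)
  left_distrib x y z := by
    refine ind x fun a => ind y fun b => ind z fun c => ?_
    rw [← mk_add, ← mk_mul, ← mk_mul, ← mk_mul, ← mk_add, mul_add]
  right_distrib x y z := by
    refine ind x fun a => ind y fun b => ind z fun c => ?_
    rw [← mk_add, ← mk_mul, ← mk_mul, ← mk_mul, ← mk_add, add_mul]
  zero_mul x := by
    refine ind x fun a => ?_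
    rw [← mk_zero, ← mk_mul, zero_mul]
  mul_zero x := by
    refine ind x fun a => ?_
    rw [← mk_zero, ← mk_mul, mul_zero]
  mul_assoc x y z := by
    refine ind x fun a => ind y fun b => ind z fun c => ?_
    rw [← mk_mul, ← mk_mul, ← mk_mul, ← mk_mul, mul_assoc]
  norm_mul_le x y := by
    refine ind x fun a => ind y fun b => ?_
    rw [← mk_mul, norm_mk, norm_mk, norm_mk, map_mul]
    exact norm_mul_le _ _

/-- The quotient `A / ker φ` is a C⋆-algebra. -/
instance : NonUnitalCStarAlgebra (QuotKer φ) where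
  star_involutive x := by
    refine ind x fun a => ?_
    rw [← mk_star, ← mk_star, star_star]
  star_mul x y := by
    refine ind x fun a => ind y fun b => ?_
    rw [← mk_mul, ← mk_star, ← mk_star, ← mk_star, ← mk_mul, star_mul]
  star_add x y := by
    refine ind x fun a => ind y fun b => ?_
    rw [← mk_add, ← mk_star, ← mk_star, ← mk_star, ← mk_add, star_add]
  norm_mul_self_le x := by
    refine ind x fun a => ?_
    rw [← mk_star, ← mk_mul, norm_mk, norm_mk, map_mul, map_star, CStarRing.norm_star_mul_self]
  smul_assoc c x y := by
    refine ind x fun a => ind y fun b => ?_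
    simp only [smul_eq_mul]
    rw [← mk_smul, ← mk_mul, ← mk_mul, ← mk_smul, smul_mul_assoc]
  smul_comm c x y := by
    refine ind x fun a => ind y fun b => ?_
    simp only [smul_eq_mul]
    rw [← mk_smul, ← mk_mul, ← mk_mul, ← mk_smul, mul_smul_comm]
  star_smul c x := by
    refine ind x fun a => ?_
    rw [← mk_smul, ← mk_star, ← mk_star, ← mk_smul, star_smul]

variable (φ)

/-- The quotient map `A → A / ker φ`. -/
def proj : A →⋆ₙₐ[ℂ] QuotKer φ where
  toFun := mk φ
  map_smul' _ _ := rfl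
  map_zero' := rfl
  map_add' _ _ := rfl
  map_mul' _ _ := rfl
  map_star' _ := rfl

/-- The ⋆-homomorphism `A / ker φ → B` induced by `φ`. -/
def lift : QuotKer φ →⋆ₙₐ[ℂ] B where
  toFun := (kernelSubmodule φ).liftQ (φ : A →ₗ[ℂ] B) fun _ h => h
  map_smul' c x := ind x fun a => map_smul φ c a
  map_zero' := map_zero φ
  map_add' x y := ind x fun a => ind y fun b => map_add φ a b
  map_mul' x y := ind x fun a => ind y fun b => map_mul φ a b
  map_star' x := ind x fun a => map_star φ a

theorem lift_proj (a : A) : lift φ (proj φ a) = φ a := rfl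

end QuotKer

end Stabilisation

/-! Ordered monoids, `W`-semigroups and `Cu`-semigroups -/

section Semigroups

variable {S T : Type*} [AddCommMonoid S] [AddCommMonoid T]

/-- Compact containment `a ≪ b` (with respect to increasing sequences). -/
def WayBelow {X : Type*} [PartialOrder X] (a b : X) : Prop :=
  ∀ (u : ℕ → X) (s : X), Monotone u → IsLUB (Set.range u) s → b ≤ s → ∃ n, a ≤ u n

/-- Abstract Cuntz semigroups: positively ordered monoids that satisfy the axioms (O1)–(O4). -/
structure IsCuSemigroup (S : Type*) [AddCommMonoid S] [PartialOrder S] : Prop where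
  zero_le : ∀ a : S, 0 ≤ a
  add_le_add : ∀ a a' b b' : S, a ≤ a' → b ≤ b' → a + b ≤ a' + b'
  exists_sup : ∀ u : ℕ → S, Monotone u → ∃ s, IsLUB (Set.range u) s
  exists_wayBelow_seq : ∀ a : S, ∃ u : ℕ → S, (∀ n, WayBelow (u n) (u (n + 1))) ∧
    IsLUB (Set.range u) a
  add_wayBelow_add : ∀ a a' b b' : S, WayBelow a' a → WayBelow b' b → WayBelow (a' + b') (a + b)
  sup_add_sup : ∀ (u v : ℕ → S) (s t : S), Monotone u → Monotone v → IsLUB (Set.range u) s →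
    IsLUB (Set.range v) t → IsLUB (Set.range fun n => u n + v n) (s + t)

/-- `Cu`-morphisms: additive maps that preserve the order, compact containment and suprema of
increasing sequences. -/
structure IsCuMorphism [PartialOrder S] [PartialOrder T] (f : S →+ T) : Prop where
  monotone : Monotone f
  map_wayBelow : ∀ a b : S, WayBelow a b → WayBelow (f a) (f b)
  map_sup : ∀ (u : ℕ → S) (s : S), Monotone u → IsLUB (Set.range u) s →
    IsLUB (Set.range fun n => f (u n)) (f s)

/-- `W`-semigroups: abelian monoids with a transitive, additive relation `≺` that satisfies the
axioms (W1) and (W4). -/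
structure IsWSemigroup (S : Type*) [AddCommMonoid S] (prec : S → S → Prop) : Prop where
  trans : ∀ a b c : S, prec a b → prec b c → prec a c
  zero_prec : ∀ a : S, prec 0 a
  add_prec_add : ∀ a a' b b' : S, prec a' a → prec b' b → prec (a' + b') (a + b)
  exists_seq : ∀ a : S, ∃ u : ℕ → S, (∀ k, prec (u k) a) ∧ (∀ k, prec (u k) (u (k + 1))) ∧
    ∀ b, prec b a → ∃ k, prec b (u k)
  exists_of_prec_add : ∀ a b c : S, prec a (b + c) →
    ∃ b' c', prec b' b ∧ prec c' c ∧ prec a (b' + c')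

/-- `W`-morphisms: additive maps that are monotone and continuous for the relations `≺`. -/
structure IsWMorphism (precS : S → S → Prop) (precT : T → T → Prop) (f : S →+ T) : Prop where
  map_prec : ∀ a b : S, precS a b → precT (f a) (f b)
  continuous : ∀ (a : S) (b : T), precT b (f a) → ∃ a', precS a' a ∧ precT b (f a')

/-- A pair `α = (≺, ≤)` of relations. -/
structure RelPair (S : Type*) where
  prec : S → S → Prop
  le : S → S → Prop

namespace RelPair

/-- The relation `≤ ∘ ≺` of a pair. -/
def comp {X : Type*} (α : RelPair X) (a b : X) : Prop := ∃ c, α.le a c ∧ α.prec c b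

/-- Normality of a pair `(≺, ≤)`: the relation `≤` is a preorder, the pair is admissible and
additively closed, and `≤` is left `≺`-continuous, that is, `≺ ∘ ≤` is contained in `≺ ∘ ≤ ∘ ≺`. -/
structure IsNormal (α : RelPair S) : Prop where
  refl : ∀ a, α.le a a
  trans : ∀ a b c, α.le a b → α.le b c → α.le a c
  admissible : ∀ a b, (∀ x, α.comp x a → α.comp x b) → α.le a b
  prec_add : ∀ a a' b b', α.prec a a' → α.prec b b' → α.prec (a + b) (a' + b')
  le_add : ∀ a a' b b', α.le a a' → α.le b b' → α.le (a + b) (a' + b')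
  continuous : ∀ a b c, α.prec a b → α.le b c → ∃ d, α.prec a d ∧ α.comp d c

/-- The congruence associated with the preorder of a normal pair. -/
def con (α : RelPair S) (h : α.IsNormal) : AddCon S where
  r a b := α.le a b ∧ α.le b a
  iseqv := ⟨fun a => ⟨h.refl a, h.refl a⟩, fun h' => ⟨h'.2, h'.1⟩,
    fun h₁ h₂ => ⟨h.trans _ _ _ h₁.1 h₂.1, h.trans _ _ _ h₂.2 h₁.2⟩⟩
  add' h₁ h₂ := ⟨h.le_add _ _ _ _ h₁.1 h₂.1, h.le_add _ _ _ _ h₁.2 h₂.2⟩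

/-- The quotient `S/α` by a normal pair: the antisymmetrisation of the preorder `≤`. -/
def Quo (α : RelPair S) (h : α.IsNormal) : Type _ := (α.con h).Quotient

namespace Quo

variable (α : RelPair S) (h : α.IsNormal)

instance : AddCommMonoid (α.Quo h) := inferInstanceAs (AddCommMonoid (α.con h).Quotient)

/-- The natural map `π_α : S → S/α`. -/
def mk : S →+ α.Quo h := (α.con h).mk'

variable {α h}

theorem mk_surjective : Function.Surjective (mk α h) := AddCon.mk'_surjective

theorem mk_eq_mk {a b : S} : mk α h a = mk α h b ↔ α.le a b ∧ α.le b a := AddCon.eq (α.con h)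

/-- The order `[a] ≤ [b]`. -/
instance : LE (α.Quo h) := ⟨fun x y => ∃ a b, mk α h a = x ∧ mk α h b = y ∧ α.le a b⟩

theorem mk_le_mk {a b : S} : mk α h a ≤ mk α h b ↔ α.le a b := by
  refine ⟨?_, fun hab => ⟨a, b, rfl, rfl, hab⟩⟩
  rintro ⟨a', b', ha, hb, hab⟩
  exact h.trans _ _ _ (mk_eq_mk.1 ha).2 (h.trans _ _ _ hab (mk_eq_mk.1 hb).1)

instance : PartialOrder (α.Quo h) where
  le_refl x := by
    obtain ⟨a, rfl⟩ := mk_surjective x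
    exact mk_le_mk.2 (h.refl a)
  le_trans x y z hxy hyz := by
    obtain ⟨a, rfl⟩ := mk_surjective x
    obtain ⟨b, rfl⟩ := mk_surjective y
    obtain ⟨c, rfl⟩ := mk_surjective z
    exact mk_le_mk.2 (h.trans _ _ _ (mk_le_mk.1 hxy) (mk_le_mk.1 hyz))
  le_antisymm x y hxy hyx := by
    obtain ⟨a, rfl⟩ := mk_surjective x
    obtain ⟨b, rfl⟩ := mk_surjective y
    exact mk_eq_mk.2 ⟨mk_le_mk.1 hxy, mk_le_mk.1 hyx⟩

/-- The relation `≺_α` on the quotient: `[a] ≺_α [b]` if `a ≤ c ≺ b` for some `c`. -/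
def prec (x y : α.Quo h) : Prop := ∃ a b, mk α h a = x ∧ mk α h b = y ∧ α.comp a b

end Quo

end RelPair

/-- The kernel pair `ker(f) = (≺, ≤_f)` of a map, with `a ≤_f b` if every `x ≺ f(a)` satisfies
`x ≺ f(b)`. -/
def kernelPair (precS : S → S → Prop) (precT : T → T → Prop) (f : S →+ T) : RelPair S where
  prec := precS
  le a b := ∀ x, precT x (f a) → precT x (f b)

/-- The pair `α_I = (≺, ≤_I)` of an ideal, with `a ≤_I b` if for every `x ≺ a` there is `y ∈ I` with
`x ≺ b + y`. -/
def idealPair (prec : S → S → Prop) (I : Set S) : RelPair S where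
  prec := prec
  le a b := ∀ x, prec x a → ∃ y ∈ I, prec x (b + y)

/-- The ideal `I_α = {a | a ≤ 0}` of a pair `α = (≺, ≤)`. -/
def RelPair.ideal (α : RelPair S) : Set S := {a | α.le a 0}

/-- Closed ideals: submonoids `I` such that `a ≺ b ∈ I` implies `a ∈ I`, and such that `a ∈ I` if all
`x ≺ a` are in `I`. -/
structure IsClosedIdeal (prec : S → S → Prop) (I : Set S) : Prop where
  zero_mem : (0 : S) ∈ I
  add_mem : ∀ a b, a ∈ I → b ∈ I → a + b ∈ I
  mem_of_prec : ∀ a b, prec a b → b ∈ I → a ∈ I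
  mem_of_forall_prec : ∀ a, (∀ x, prec x a → x ∈ I) → a ∈ I

end Semigroups

section Main

variable {A B : Type*} [NonUnitalCStarAlgebra A] [NonUnitalCStarAlgebra B]

/-- The ideal `Cu(ker φ)` of `Cu(A)`, as the range of the map induced by the inclusion
`ker φ → A`. -/
def kerIdeal (φ : A →⋆ₙₐ[ℂ] B) : Set (Cu A) := Set.range (Cu.map (kernelIncl φ))

/-- The pair on `Cu(A)` associated with the ideal `Cu(ker φ)`. -/
def cuIdealPair (φ : A →⋆ₙₐ[ℂ] B) : RelPair (Cu A) := idealPair WayBelow (kerIdeal φ)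

/-- The kernel pair `ker(Cu(φ))` on `Cu(A)`. -/
def cuKernelPair (φ : A →⋆ₙₐ[ℂ] B) : RelPair (Cu A) := kernelPair WayBelow WayBelow (Cu.map φ)

/-- The submonoid `{[φ(a)] | a ∈ (A ⊗ 𝒦)₊}` of `Cu(B)`, with the order of `Cu(B)`. -/
def cuImage (φ : A →⋆ₙₐ[ℂ] B) : AddSubmonoid (Cu B) where
  carrier := {t | ∃ a : PosStab A, t = Cu.mk (a.map φ)}
  zero_mem' := ⟨PosStab.zero, ((Cu.map φ).map_zero).symm⟩
  add_mem' := by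
    rintro _ _ ⟨a, rfl⟩ ⟨b, rfl⟩
    exact ⟨a.oplus b, ((Cu.map φ).map_add (Cu.mk a) (Cu.mk b)).symm⟩

/-- The restriction to `{[φ(a)] | a ∈ (A ⊗ 𝒦)₊}` of compact containment in `Cu(B)`. -/
def imagePrec (φ : A →⋆ₙₐ[ℂ] B) (x y : cuImage φ) : Prop := WayBelow (x : Cu B) (y : Cu B)

end Main

end CuntzSemigroup

end

open CuntzSemigroup

noncomputable section

namespace CuntzSemigroup

/-! ### Cuntz comparison in a C⋆-algebra and cut-downs -/

section Comparison

attribute [local instance] CStarAlgebra.spectralOrder CStarAlgebra.spectralOrderedRing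

variable {D E : Type*} [NonUnitalCStarAlgebra D] [NonUnitalCStarAlgebra E]

theorem isPositive_iff_nonneg {a : D} : IsPositive a ↔ 0 ≤ a := by
  refine ⟨?_, fun h => ⟨CFC.sqrt a, ?_⟩⟩
  · rintro ⟨y, rfl⟩
    exact star_mul_self_nonneg y
  · rw [(CFC.sqrt_nonneg a).star_eq, CFC.sqrt_mul_sqrt_self a h]

theorem isClosed_isPositive : IsClosed {a : D | IsPositive a} := by
  simpa only [isPositive_iff_nonneg] using CStarAlgebra.isClosed_nonneg (A := D)

theorem IsPositive.add {a b : D} (ha : IsPositive a) (hb : IsPositive b) : IsPositive (a + b) := by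
  rw [isPositive_iff_nonneg] at *
  exact add_nonneg ha hb

theorem IsPositive.conj {a : D} (ha : IsPositive a) (x : D) : IsPositive (x * a * star x) := by
  obtain ⟨y, rfl⟩ := ha
  exact ⟨y * star x, by rw [star_mul, star_star]; simp only [mul_assoc]⟩

theorem isPositive_mul_star_self (x : D) : IsPositive (x * star x) := ⟨star x, by rw [star_star]⟩

theorem norm_conj_le' (x a : D) : ‖x * a * star x‖ ≤ ‖x‖ ^ 2 * ‖a‖ := by
  calc _ ≤ ‖x‖ * ‖a‖ * ‖star x‖ := (norm_mul_le _ _).trans (by gcongr; exact norm_mul_le _ _)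
    _ = _ := by rw [norm_star]; ring

theorem tendsto_approximateUnit_conj (a : D) :
    Tendsto (fun e => e * a * star e) (CStarAlgebra.approximateUnit D) (𝓝 a) := by
  have hl := CStarAlgebra.increasingApproximateUnit D
  have h1 := (hl.tendsto_mul_left a).sub_const a |>.norm
  have h2 := (hl.tendsto_mul_right a).sub_const a |>.norm
  rw [tendsto_iff_norm_sub_tendsto_zero]
  refine squeeze_zero' (Eventually.of_forall fun _ => norm_nonneg _)
    (g := fun e => ‖a * e - a‖ + ‖e * a - a‖) ?_ (by simpa using h1.add h2)
  filter_upwards [hl.eventually_norm, hl.eventually_star_eq] with e he hs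
  rw [hs]
  have : e * a * e - a = e * (a * e - a) + (e * a - a) := by noncomm_ring
  rw [this]
  refine (norm_add_le _ _).trans ?_
  gcongr
  refine (norm_mul_le _ _).trans ?_
  exact mul_le_of_le_one_left (norm_nonneg _) he

theorem exists_conj_near (a b : D) {ε : ℝ} (hε : 0 < ε) : ∃ e : D, star e = e ∧ ‖e‖ ≤ 1 ∧
    ‖a - e * a * star e‖ < ε ∧ ‖b - e * b * star e‖ < ε := by
  have hl := CStarAlgebra.increasingApproximateUnit D
  have h (c : D) := (tendsto_const_nhds (x := c)).sub (tendsto_approximateUnit_conj c) |>.norm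
  simp only [sub_self, norm_zero] at h
  have := hl.neBot
  obtain ⟨e, h1, h2, h3, h4⟩ := (((h a).eventually_lt_const hε).and
    (((h b).eventually_lt_const hε).and (hl.eventually_norm.and hl.eventually_star_eq))).exists
  exact ⟨e, h4, h3, h1, h2⟩

theorem CuntzLE.refl (a : D) : CuntzLE a a := fun ε hε => by
  obtain ⟨e, -, -, h, -⟩ := exists_conj_near a a hε
  exact ⟨e, h⟩

theorem cuntzLE_conj (x a : D) : CuntzLE (x * a * star x) a := fun ε hε =>
  ⟨x, by rwa [sub_self, norm_zero]⟩

theorem zero_cuntzLE (a : D) : CuntzLE 0 a := by simpa using cuntzLE_conj 0 a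

theorem cuntzLE_zero_iff {a : D} : CuntzLE a 0 ↔ a = 0 := by
  refine ⟨fun h => norm_le_zero_iff.1 (le_of_forall_pos_lt_add fun ε hε => ?_), ?_⟩
  · obtain ⟨x, hx⟩ := h ε hε
    simpa using hx
  · rintro rfl
    exact zero_cuntzLE 0

/-- Cuntz subequivalence is closed in the first variable. -/
theorem cuntzLE_of_forall_near {a b : D}
    (h : ∀ ε : ℝ, 0 < ε → ∃ c, ‖a - c‖ < ε ∧ CuntzLE c b) : CuntzLE a b := by
  intro ε hε
  obtain ⟨c, hc, hcb⟩ := h (ε / 2) (by positivity)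
  obtain ⟨x, hx⟩ := hcb (ε / 2) (by positivity)
  exact ⟨x, by linarith [norm_sub_le_norm_sub_add_norm_sub a c (x * b * star x)]⟩

/-- Formally `a^{1/2} b^{-1/2}` conjugates `b` to `a`. The inverse is regularised by `δ`, and `a ≤
b` bounds the resulting error on `a^{1/2}` by the one on `b^{1/2}`. -/
theorem cuntzLE_of_le {a b : D} (ha : 0 ≤ a) (hab : a ≤ b) : CuntzLE a b := by
  refine cuntzLE_of_forall_near fun ε hε => ?_
  have hb : 0 ≤ b := ha.trans hab
  set y := CFC.sqrt a with hy
  have hys : star y = y := (CFC.sqrt_nonneg a).star_eq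
  have hya : y * y = a := CFC.sqrt_mul_sqrt_self a ha
  set v := CFC.sqrt b with hv
  have hvs : star v = v := (CFC.sqrt_nonneg b).star_eq
  have hvb : star v * v = b := by rw [hvs]; exact CFC.sqrt_mul_sqrt_self b hb
  have hnn : ∀ t ∈ quasispectrum ℝ b, 0 ≤ t := fun t ht => quasispectrum_nonneg_of_nonneg _ hb t ht
  obtain ⟨δ, hδ, hδε⟩ : ∃ δ : ℝ, 0 < δ ∧ 2 * ‖y‖ * √δ < ε := by
    have h1 : Tendsto (fun δ : ℝ => 2 * ‖y‖ * √δ) (𝓝[>] 0) (𝓝 (2 * ‖y‖ * √0)) :=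
      (Continuous.tendsto (by fun_prop) 0).mono_left nhdsWithin_le_nhds
    rw [Real.sqrt_zero, mul_zero] at h1
    obtain ⟨δ, h2, h3⟩ := ((h1.eventually_lt_const hε).and self_mem_nhdsWithin).exists
    exact ⟨δ, h3, h2⟩
  have hpos : ∀ t : ℝ, |t| + δ ≠ 0 := fun t => by positivity
  -- On `t ≥ 0` one has `k(t)² t = h(t)²`, and `h(b)` is nearly a unit for `b^{1/2}`. The absolute
  -- values only make both functions continuous on all of `ℝ`.
  set k : ℝ → ℝ := fun t => √|t| / (|t| + δ) with hk
  have hkc : Continuous k := by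
    refine Continuous.div (by fun_prop) (by fun_prop) hpos
  set h : ℝ → ℝ := fun t => |t| / (|t| + δ) with hh
  have hhc : Continuous h := Continuous.div (by fun_prop) (by fun_prop) hpos
  have h0 : h 0 = 0 := by simp [hh]
  have k0 : k 0 = 0 := by simp [hk]
  set H := cfcₙ h b with hH
  have hHs : star H = H := (cfcₙ_predicate h b : IsSelfAdjoint _)
  set K := cfcₙ k b with hK
  have hKs : star K = K := (cfcₙ_predicate k b : IsSelfAdjoint _)
  have hHK : K * b * K = H * H := by
    have e0 : cfcₙ (fun t : ℝ => t) b = b := cfcₙ_id' ℝ _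
    have c1 : ContinuousOn k (quasispectrum ℝ b) := hkc.continuousOn
    have c2 : ContinuousOn h (quasispectrum ℝ b) := hhc.continuousOn
    calc K * b * K = cfcₙ k b * cfcₙ (fun t : ℝ => t) b * cfcₙ k b := by rw [e0]
      _ = cfcₙ (fun t => k t * t * k t) b := by
        rw [← cfcₙ_mul k (fun t => t) b c1 k0 continuousOn_id rfl,
          ← cfcₙ_mul (fun t => k t * t) k b (c1.mul continuousOn_id) (mul_zero _) c1 k0]
      _ = cfcₙ (fun t => h t * h t) b := by
        refine cfcₙ_congr fun t ht => ?_
        have := hnn t ht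
        simp only [hk, hh, abs_of_nonneg this]
        have h2 : t + δ ≠ 0 := by positivity
        field_simp
        rw [Real.sq_sqrt this]
        ring
      _ = _ := cfcₙ_mul h h b c2 h0 c2 h0
  have hn1 : ‖y - y * H‖ ^ 2 ≤ δ := by
    -- With `b - a = z⋆ z`, the difference of the two squares is `(1 - H)(b - a)(1 - H)`, written
    -- without a unit.
    obtain ⟨z, hz⟩ := isPositive_iff_nonneg.2 (sub_nonneg.2 hab)
    have h1 : star (y - y * H) * (y - y * H) ≤ star (v - v * H) * (v - v * H) := by
      rw [← sub_nonneg]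
      have : star (v - v * H) * (v - v * H) - star (y - y * H) * (y - y * H)
          = star (z - z * H) * (z - z * H) := by
        have e (c : D) : star (c - c * H) * (c - c * H)
            = star c * c - H * (star c * c) - (star c * c) * H + H * (star c * c) * H := by
          rw [star_sub, star_mul, hHs]
          noncomm_ring
        rw [e, e, e, hvb, hys, hya, ← hz]
        noncomm_ring
      rw [this]
      exact star_mul_self_nonneg _
    have h2 := CStarAlgebra.norm_le_norm_of_nonneg_of_le (star_mul_self_nonneg _) h1
    rw [CStarRing.norm_star_mul_self, ← sq] at h2
    refine h2.trans ?_
    have h3 := star_sub_mul_cfc v h hhc h0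
    rw [hvb] at h3
    rw [h3]
    refine norm_cfcₙ_le fun t ht => ?_
    have ht' := hnn t ht
    have hp : 0 < t + δ := by positivity
    -- This is `t (1 - h(t))²`, which is at most `δ` for `t ≥ 0`.
    have h4 : t - h t * t - (t * h t - h t * t * h t) = t * δ * δ / (t + δ) ^ 2 := by
      simp only [hh, abs_of_nonneg ht']
      field_simp
      ring
    rw [h4, Real.norm_of_nonneg (by positivity), div_le_iff₀ (by positivity)]
    nlinarith [mul_nonneg (mul_nonneg ht' ht') hδ.le, mul_nonneg (mul_nonneg ht' hδ.le) hδ.le, pow_pos hδ 3]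
  have hHn : ‖H‖ ≤ 1 := norm_cfcₙ_le fun t _ => by
    rw [Real.norm_of_nonneg (by positivity), div_le_one (by positivity)]
    linarith
  refine ⟨y * K * b * star (y * K), ?_, cuntzLE_conj _ _⟩
  have h1 : a - y * K * b * star (y * K) = (y - y * H) * y + y * H * star (y - y * H) := by
    rw [star_mul, hKs, hys, star_sub, star_mul, hHs, hys, ← hya]
    have : y * K * b * (K * y) = y * (K * b * K) * y := by noncomm_ring
    rw [this, hHK]
    noncomm_ring
  have h2 : ‖y - y * H‖ ≤ √δ := Real.le_sqrt_of_sq_le hn1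
  rw [h1]
  calc _ ≤ ‖y - y * H‖ * ‖y‖ + ‖y‖ * ‖H‖ * ‖star (y - y * H)‖ :=
        (norm_add_le _ _).trans (add_le_add (norm_mul_le _ _)
          ((norm_mul_le _ _).trans (by gcongr; exact norm_mul_le _ _)))
    _ ≤ √δ * ‖y‖ + ‖y‖ * 1 * √δ := by rw [norm_star]; gcongr
    _ = 2 * ‖y‖ * √δ := by ring
    _ < ε := hδε

/-- `d` is a *`δ`-cut-down* of `a` if `0 ≤ d ≤ w (a - δ) w⋆` for some `w`. -/
def IsCutDown (δ : ℝ) (d a : D) : Prop :=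
  IsPositive d ∧ ∃ w : D, IsPositive (w * a * star w - (δ : ℂ) • (w * star w) - d)

/-- The definition uses only ⋆-algebra operations and positivity, which is why cut-downs can be
transported without functional calculus in the target. -/
theorem IsCutDown.map (f : D →⋆ₙₐ[ℂ] E) {δ : ℝ} {d a : D} (h : IsCutDown δ d a) :
    IsCutDown δ (f d) (f a) := by
  obtain ⟨hd, w, hw⟩ := h
  refine ⟨hd.map f, f w, ?_⟩
  simpa only [map_sub, map_mul, map_star, map_smul] using hw.map f

/-- The cut-down is `(a - 2δ)₊`. The gap between `δ` and `2δ` allows division by `t - δ` where `t ≥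
2δ`. -/
theorem exists_isCutDown {a : D} (ha : IsPositive a) {δ : ℝ} (hδ : 0 < δ) :
    ∃ d, IsCutDown δ d a ∧ ‖a - d‖ ≤ 2 * δ := by
  rw [isPositive_iff_nonneg] at ha
  have hnn : ∀ t ∈ quasispectrum ℝ a, 0 ≤ t := fun t ht => quasispectrum_nonneg_of_nonneg _ ha t ht
  set f : ℝ → ℝ := fun t => max (t - 2 * δ) 0 with hf
  -- Chosen so that `g(t)² (t - δ) = (t - 2δ)₊`: the denominator equals `t - δ` for `t ≥ 2δ`, the
  -- numerator vanishes for `t ≤ 2δ`, and `max` keeps the denominator away from zero.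
  set g : ℝ → ℝ := fun t => √(max (t - 2 * δ) 0 / max (t - δ) δ) with hg
  have hm : ∀ t : ℝ, 0 < max (t - δ) δ := fun t => lt_max_of_lt_right hδ
  have hfc : Continuous f := by fun_prop
  have hgc : Continuous g :=
    (Continuous.div (by fun_prop) (by fun_prop) fun t => (hm t).ne').sqrt
  have f0 : f 0 = 0 := by simp [hf, hδ.le]
  have g0 : g 0 = 0 := by simp [hg, hδ.le]
  have e0 : cfcₙ (fun t : ℝ => t) a = a := cfcₙ_id' ℝ _
  have c0 : ContinuousOn (fun t : ℝ => t) (quasispectrum ℝ a) := continuousOn_id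
  have c1 : ContinuousOn g (quasispectrum ℝ a) := hgc.continuousOn
  have hws : star (cfcₙ g a) = cfcₙ g a := (cfcₙ_predicate g a : IsSelfAdjoint _)
  refine ⟨cfcₙ f a, ⟨?_, cfcₙ g a, ?_⟩, ?_⟩
  · exact isPositive_iff_nonneg.2 (cfcₙ_nonneg fun t _ => le_max_right _ _)
  · have h1 : cfcₙ g a * a * cfcₙ g a = cfcₙ (fun t => g t * t * g t) a := by
      rw [cfcₙ_mul (fun t => g t * t) g a (c1.mul c0) (mul_zero _) c1 g0,
        cfcₙ_mul g (fun t => t) a c1 g0 c0 rfl, e0]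
    have h2 : (δ : ℂ) • (cfcₙ g a * cfcₙ g a) = cfcₙ (fun t => δ * (g t * g t)) a := by
      rw [cfcₙ_const_mul δ (fun t => g t * g t) a (c1.mul c1) (by simp [g0]),
        cfcₙ_mul g g a c1 g0 c1 g0]
      exact Complex.coe_smul _ _
    have h3 : cfcₙ g a * a * cfcₙ g a - (δ : ℂ) • (cfcₙ g a * cfcₙ g a) = cfcₙ f a := by
      rw [h1, h2, ← cfcₙ_sub (fun t => g t * t * g t) (fun t => δ * (g t * g t)) a ((c1.mul c0).mul c1) (by simp [g0])
        (continuousOn_const.mul (c1.mul c1)) (by simp [g0])]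
      refine cfcₙ_congr fun t ht => ?_
      have h4 : g t * g t = max (t - 2 * δ) 0 / max (t - δ) δ :=
        Real.mul_self_sqrt (by have := hm t; positivity)
      have h5 : g t * t * g t - δ * (g t * g t) = (g t * g t) * (t - δ) := by ring
      rw [h5, h4]
      simp only [hf]
      rcases le_total t (2 * δ) with h | h
      · rw [max_eq_right (by linarith)]
        simp
      · have : max (t - δ) δ = t - δ := max_eq_left (by linarith)
        rw [this, div_mul_cancel₀]
        linarith
    rw [hws, h3, sub_self]
    exact ⟨0, by simp⟩
  · have h1 : a - cfcₙ f a = cfcₙ (fun t => t - f t) a := by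
      rw [cfcₙ_sub _ _ a c0 rfl hfc.continuousOn f0, e0]
    rw [h1]
    refine norm_cfcₙ_le fun t ht => ?_
    have := hnn t ht
    simp only [hf, Real.norm_eq_abs, abs_le]
    rcases le_total t (2 * δ) with h | h
    · rw [max_eq_right (by linarith)]
      constructor <;> linarith
    · rw [max_eq_left (by linarith)]
      constructor <;> linarith

/-- From `a ≤ z + r` and `r ≤ δ` follows `w (a - δ) w⋆ ≤ w z w⋆`. This is the only way in which
cut-downs are compared with other elements; a general `r` is needed for errors lifted from a
quotient. -/
theorem IsCutDown.cuntzLE {δ : ℝ} {d a z r : D} (h : IsCutDown δ d a) (hr : IsSelfAdjoint r)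
    (hrδ : ‖r‖ ≤ δ) (hz : IsPositive (z + r - a)) : CuntzLE d z := by
  obtain ⟨hd, w, hw⟩ := h
  rw [isPositive_iff_nonneg] at hd
  have hw := isPositive_iff_nonneg.1 hw
  have hz := isPositive_iff_nonneg.1 (hz.conj w)
  refine (cuntzLE_of_le hd ?_).trans (cuntzLE_conj w z)
  have h1 : w * r * star w ≤ ‖r‖ • (w * star w) :=
    CStarAlgebra.star_right_conjugate_le_norm_smul
  have h2 : ‖r‖ • (w * star w) ≤ δ • (w * star w) :=
    smul_le_smul_of_nonneg_right hrδ (mul_star_self_nonneg w)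
  have h3 : (δ : ℂ) • (w * star w) = δ • (w * star w) := Complex.coe_smul _ _
  have h4 := sub_nonneg.2 (h1.trans h2)
  rw [← sub_nonneg]
  have := add_nonneg (add_nonneg hw hz) h4
  rw [h3] at this
  refine this.trans_eq ?_
  rw [mul_sub, sub_mul, mul_add, add_mul]
  abel

/-- The special case `r = a - z`, a form of Rørdam's lemma. -/
theorem IsCutDown.cuntzLE_of_near {δ : ℝ} {d a z : D} (h : IsCutDown δ d a) (ha : IsPositive a)
    (hz : IsPositive z) (haz : ‖a - z‖ ≤ δ) : CuntzLE d z := by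
  rw [isPositive_iff_nonneg] at ha hz
  refine h.cuntzLE (r := a - z) ((IsSelfAdjoint.of_nonneg ha).sub (IsSelfAdjoint.of_nonneg hz)) haz ?_
  exact ⟨0, by simp⟩

theorem IsCutDown.mono {δ δ' : ℝ} {d a : D} (h : IsCutDown δ d a) (hδ : δ' ≤ δ) :
    IsCutDown δ' d a := by
  obtain ⟨hd, w, hw⟩ := h
  refine ⟨hd, w, ?_⟩
  have h1 : IsPositive ((δ : ℂ) • (w * star w) - (δ' : ℂ) • (w * star w)) := by
    rw [isPositive_iff_nonneg, sub_nonneg, Complex.coe_smul, Complex.coe_smul]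
    exact smul_le_smul_of_nonneg_right hδ (mul_star_self_nonneg w)
  convert hw.add h1 using 1
  abel

end Comparison

/-! ### Left multiplication by isometries on `A ⊗ 𝒦` -/

section LeftShift

variable {A : Type*} [NonUnitalCStarAlgebra A]

namespace MInf

/-- The entries of the matrix obtained by moving the row `i` to the row `t i`. -/
def rowShiftEntry (t : ℕ ↪ ℕ) (x : MInf A) (i j : ℕ) : A :=
  open Classical in if h : ∃ a, t a = i then x h.choose j else 0

theorem rowShiftEntry_apply (t : ℕ ↪ ℕ) (x : MInf A) (i j : ℕ) :
    rowShiftEntry t x (t i) j = x i j := by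
  have h : ∃ a, t a = t i := ⟨i, rfl⟩
  refine (dif_pos h).trans ?_
  rw [t.injective h.choose_spec]

theorem rowShiftEntry_eq_zero (t : ℕ ↪ ℕ) (x : MInf A) (i j : ℕ) (h : ¬ ∃ a, t a = i) :
    rowShiftEntry t x i j = 0 :=
  dif_neg h

theorem rowShiftEntry_bounded (t : ℕ ↪ ℕ) (x : MInf A) :
    ∃ n, ∀ i j, n ≤ i ∨ n ≤ j → rowShiftEntry t x i j = 0 := by
  obtain ⟨n, hn⟩ := x.bounded
  obtain ⟨m, hm⟩ := (eventually_shift_lt t n).exists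
  refine ⟨max n m, fun i j h => ?_⟩
  by_cases h' : ∃ a, t a = i
  · obtain ⟨a, rfl⟩ := h'
    rw [rowShiftEntry_apply]
    refine hn a j ?_
    by_contra hc
    push Not at hc
    have := hm a hc.1
    omega
  · exact rowShiftEntry_eq_zero t x i j h'

/-- The map that moves the row `i` to the row `t i`, that is, left multiplication by the isometry
of `ℓ²(ℕ)` sending the `i`-th to the `t i`-th basis vector. -/
def rowShift (t : ℕ ↪ ℕ) : MInf A →ₗ[ℂ] MInf A where
  toFun x := ofFun (rowShiftEntry t x) (rowShiftEntry_bounded t x)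
  map_add' x y := ext fun i j => by
    by_cases h : ∃ a, t a = i
    · obtain ⟨a, rfl⟩ := h
      simp [rowShiftEntry_apply]
    · simp [rowShiftEntry_eq_zero _ _ _ _ h]
  map_smul' c x := ext fun i j => by
    by_cases h : ∃ a, t a = i
    · obtain ⟨a, rfl⟩ := h
      simp [rowShiftEntry_apply]
    · simp [rowShiftEntry_eq_zero _ _ _ _ h]

theorem rowShift_apply (t : ℕ ↪ ℕ) (x : MInf A) (i j : ℕ) : rowShift t x (t i) j = x i j :=
  rowShiftEntry_apply t x i j

theorem rowShift_eq_zero (t : ℕ ↪ ℕ) (x : MInf A) (i j : ℕ) (h : ¬ ∃ a, t a = i) :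
    rowShift t x i j = 0 :=
  rowShiftEntry_eq_zero t x i j h

theorem rowShift_mul (t : ℕ ↪ ℕ) (x y : MInf A) : rowShift t (x * y) = rowShift t x * y := by
  refine ext fun i j => ?_
  rw [mul_apply]
  by_cases h : ∃ a, t a = i
  · obtain ⟨a, rfl⟩ := h
    simp only [rowShift_apply, mul_apply]
  · simp only [rowShift_eq_zero _ _ _ _ h, zero_mul, finsum_zero]

/-- This is `S⋆ S = 1` for the isometry `S` that `t` defines. As `S` is only a multiplier, its
relations are stated after application to elements. -/
theorem star_rowShift_mul_rowShift (t : ℕ ↪ ℕ) (x y : MInf A) :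
    star (rowShift t x) * rowShift t y = star x * y := by
  refine ext fun i j => ?_
  rw [mul_apply, mul_apply]
  obtain ⟨n, hn⟩ := x.bounded
  rw [finsum_eq_sum_of_support_subset (s := (Finset.range n).map t),
    finsum_eq_sum_of_support_subset (s := Finset.range n), Finset.sum_map]
  · simp only [star_apply, rowShift_apply]
  · intro k hk
    simp only [Finset.coe_range, Set.mem_Iio]
    by_contra h
    exact hk (by simp [star_apply, hn k i (by omega)])
  · intro k hk
    by_cases h : ∃ a, t a = k
    · obtain ⟨a, rfl⟩ := h
      simp only [Finset.coe_map, Finset.coe_range]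
      refine ⟨a, ?_, rfl⟩
      simp only [Set.mem_Iio]
      by_contra h
      exact hk (by simp [star_apply, rowShift_apply, hn a i (by omega)])
    · exact absurd (by simp [rowShift_eq_zero _ _ _ _ h]) hk

theorem star_rowShift_mul_rowShift_of_ne {s t : ℕ ↪ ℕ} (hst : ∀ i j, s i ≠ t j) (x y : MInf A) :
    star (rowShift s x) * rowShift t y = 0 := by
  refine ext fun i j => ?_
  rw [mul_apply, zero_apply, finsum_eq_zero_of_forall_eq_zero]
  intro k
  by_cases hk : ∃ a, s a = k
  · rw [rowShift_eq_zero t y k j, mul_zero]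
    rintro ⟨b, hb⟩
    obtain ⟨a, rfl⟩ := hk
    exact hst a b hb.symm
  · rw [star_apply, rowShift_eq_zero s x k i hk, star_zero, zero_mul]

/-- Relates the two constructions: `shift t` is conjugation by the isometry whose left
multiplication is `rowShift t`. -/
theorem shift_mul_star (t : ℕ ↪ ℕ) (x y : MInf A) :
    shift t (x * star y) = rowShift t x * star (rowShift t y) := by
  refine ext fun i j => ?_
  rw [mul_apply]
  simp only [star_apply]
  by_cases hi : ∃ a, t a = i
  · by_cases hj : ∃ b, t b = j
    · obtain ⟨a, rfl⟩ := hi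
      obtain ⟨b, rfl⟩ := hj
      simp only [shift_apply, mul_apply, rowShift_apply, star_apply]
    · simp only [rowShift_eq_zero _ _ _ _ hj, star_zero, mul_zero, finsum_zero]
      exact shift_eq_zero t _ _ _ fun h => hj h.2
  · simp only [rowShift_eq_zero _ _ _ _ hi, zero_mul, finsum_zero]
    exact shift_eq_zero t _ _ _ fun h => hi h.1

theorem norm_rowShift (t : ℕ ↪ ℕ) (x : MInf A) : ‖rowShift t x‖ = ‖x‖ := by
  have h : ‖rowShift t x‖ * ‖rowShift t x‖ = ‖x‖ * ‖x‖ := by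
    rw [← CStarRing.norm_star_mul_self, ← CStarRing.norm_star_mul_self,
      star_rowShift_mul_rowShift]
  exact (mul_self_inj (norm_nonneg _) (norm_nonneg _)).1 h

end MInf

namespace Stab

/-- The map on `A ⊗ 𝒦` that moves the row `i` to the row `t i`. -/
def rowShift (t : ℕ ↪ ℕ) : Stab A →L[ℂ] Stab A :=
  extend (LinearMap.mkContinuous ((of : MInf A →ₗᵢ[ℂ] Stab A).toLinearMap ∘ₗ MInf.rowShift t) 1
    (fun x => by
      rw [one_mul]
      exact ((LinearIsometry.norm_map of _).trans (MInf.norm_rowShift t x)).le))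

theorem rowShift_of (t : ℕ ↪ ℕ) (x : MInf A) : rowShift t (of x) = of (MInf.rowShift t x) :=
  extend_of _ x

theorem rowShift_mul (t : ℕ ↪ ℕ) (a b : Stab A) : rowShift t (a * b) = rowShift t a * b := by
  refine UniformSpace.Completion.induction_on₂ a b (isClosed_eq ?_ ?_) fun x y => ?_
  · exact (rowShift t).continuous.comp continuous_mul'
  · exact continuous_mul'' ((rowShift t).continuous.comp continuous_fst) continuous_snd
  · change rowShift t (of x * of y) = rowShift t (of x) * of y
    rw [← of_mul, rowShift_of, rowShift_of, MInf.rowShift_mul, of_mul]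

theorem star_rowShift_mul_rowShift (t : ℕ ↪ ℕ) (a b : Stab A) :
    star (rowShift t a) * rowShift t b = star a * b := by
  refine UniformSpace.Completion.induction_on₂ a b (isClosed_eq ?_ ?_) fun x y => ?_
  · exact continuous_mul'' (continuous_star'.comp ((rowShift t).continuous.comp continuous_fst))
      ((rowShift t).continuous.comp continuous_snd)
  · exact continuous_mul'' (continuous_star'.comp continuous_fst) continuous_snd
  · change star (rowShift t (of x)) * rowShift t (of y) = star (of x) * of y
    rw [rowShift_of, rowShift_of, ← of_star, ← of_star, ← of_mul, ← of_mul,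
      MInf.star_rowShift_mul_rowShift]

theorem star_rowShift_mul_rowShift_of_ne {s t : ℕ ↪ ℕ} (hst : ∀ i j, s i ≠ t j) (a b : Stab A) :
    star (rowShift s a) * rowShift t b = 0 := by
  refine UniformSpace.Completion.induction_on₂ a b (isClosed_eq ?_ continuous_const) fun x y => ?_
  · exact continuous_mul'' (continuous_star'.comp ((rowShift s).continuous.comp continuous_fst))
      ((rowShift t).continuous.comp continuous_snd)
  · change star (rowShift s (of x)) * rowShift t (of y) = 0
    rw [rowShift_of, rowShift_of, ← of_star, ← of_mul,
      MInf.star_rowShift_mul_rowShift_of_ne hst, map_zero]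

theorem shift_mul_star (t : ℕ ↪ ℕ) (a b : Stab A) :
    shift t (a * star b) = rowShift t a * star (rowShift t b) := by
  refine UniformSpace.Completion.induction_on₂ a b (isClosed_eq ?_ ?_) fun x y => ?_
  · exact (continuous_starHom _).comp (continuous_mul'' continuous_fst
      (continuous_star'.comp continuous_snd))
  · exact continuous_mul'' ((rowShift t).continuous.comp continuous_fst)
      (continuous_star'.comp ((rowShift t).continuous.comp continuous_snd))
  · change shift t (of x * star (of y)) = rowShift t (of x) * star (rowShift t (of y))
    rw [rowShift_of, rowShift_of, ← of_star, ← of_star, ← of_mul, ← of_mul, shift_of,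
      MInf.shift_mul_star]

/-- A sum of positive elements is Cuntz below their orthogonal sum. -/
theorem add_cuntzLE_oplus {a b : Stab A} (ha : IsPositive a) (hb : IsPositive b) :
    CuntzLE (a + b) (oplus a b) := by
  obtain ⟨u, rfl⟩ := ha
  obtain ⟨v, rfl⟩ := hb
  refine cuntzLE_of_forall_near fun ε hε => ?_
  obtain ⟨e, he, -, h1, h2⟩ := exists_conj_near (star u * u) (star v * v) (half_pos hε)
  have hne := evenEmb_ne_oddEmb
  have hne' : ∀ i j, oddEmb i ≠ evenEmb j := fun i j h => hne j i h.symm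
  have key (t : ℕ ↪ ℕ) (w : Stab A) : shift t (star w * w)
      = rowShift t (star w) * star (rowShift t (star w)) := by
    rw [← shift_mul_star, star_star]
  refine ⟨e * (star u * u) * star e + e * (star v * v) * star e, ?_, ?_⟩
  · calc _ = ‖(star u * u - e * (star u * u) * star e) + (star v * v - e * (star v * v) * star e)‖ := by
          congr 1
          abel
      _ < ε := (norm_add_le _ _).trans_lt (by linarith)
  · set y := star (rowShift evenEmb e + rowShift oddEmb e) with hy
    have hu : y * rowShift evenEmb (star u) = e * star u := by
      rw [hy, star_add, add_mul, star_rowShift_mul_rowShift,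
        star_rowShift_mul_rowShift_of_ne hne', add_zero, he]
    have hv : y * rowShift oddEmb (star v) = e * star v := by
      rw [hy, star_add, add_mul, star_rowShift_mul_rowShift,
        star_rowShift_mul_rowShift_of_ne hne, zero_add, he]
    have h3 : e * (star u * u) * star e + e * (star v * v) * star e
        = y * oplus (star u * u) (star v * v) * star y := by
      have f (p q : Stab A) : y * (p * star p + q * star q) * star y
          = (y * p) * star (y * p) + (y * q) * star (y * q) := by
        rw [star_mul, star_mul]
        noncomm_ring
      rw [oplus, key, key, f, hu, hv]
      simp only [star_mul, star_star, mul_assoc]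
    rw [h3]
    exact cuntzLE_conj _ _

end Stab

end LeftShift

/-! ### Left multipliers as bounded module maps -/

section ModuleMap

variable {D : Type*} [NonUnitalCStarAlgebra D]

attribute [local instance] CStarAlgebra.spectralOrder CStarAlgebra.spectralOrderedRing

/-- A module map is a left multiplier, and its values `T e` on an approximate unit replace it by
actual elements of the algebra. -/
theorem tendsto_moduleMap_mul {T : D →L[ℂ] D} (hT : ∀ a b, T (a * b) = T a * b) (u : D) :
    Tendsto (fun e => T e * u) (CStarAlgebra.approximateUnit D) (𝓝 (T u)) := by
  have hl := CStarAlgebra.increasingApproximateUnit D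
  refine ((T.continuous.tendsto u).comp (hl.tendsto_mul_right u)).congr fun e => ?_
  exact hT e u

theorem tendsto_moduleMap_conj {T : D →L[ℂ] D} (hT : ∀ a b, T (a * b) = T a * b) (u : D) :
    Tendsto (fun e => T e * (u * star u) * star (T e)) (CStarAlgebra.approximateUnit D)
      (𝓝 (T u * star (T u))) := by
  have h := tendsto_moduleMap_mul hT u
  refine (h.mul h.star).congr fun e => ?_
  rw [star_mul]
  noncomm_ring

theorem moduleMap_mul_star_cuntzLE {T : D →L[ℂ] D} (hT : ∀ a b, T (a * b) = T a * b) (u : D) :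
    CuntzLE (T u * star (T u)) (u * star u) := by
  have hl := CStarAlgebra.increasingApproximateUnit D
  have := hl.neBot
  intro ε hε
  have h := (tendsto_const_nhds (x := T u * star (T u))).sub (tendsto_moduleMap_conj hT u) |>.norm
  rw [sub_self, norm_zero] at h
  obtain ⟨e, he⟩ := (h.eventually_lt_const hε).exists
  exact ⟨T e, he⟩

/-- The left side is formally `T (u u⋆ - v v⋆) T⋆`. The bound depends on `u u⋆ - v v⋆` only; `u` and
`v` may be far apart. -/
theorem norm_moduleMap_sub_le {T : D →L[ℂ] D} (hT : ∀ a b, T (a * b) = T a * b) (u v : D) :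
    ‖T u * star (T u) - T v * star (T v)‖ ≤ ‖T‖ ^ 2 * ‖u * star u - v * star v‖ := by
  have hl := CStarAlgebra.increasingApproximateUnit D
  have := hl.neBot
  refine le_of_tendsto ((tendsto_moduleMap_conj hT u).sub (tendsto_moduleMap_conj hT v)).norm ?_
  filter_upwards [hl.eventually_norm] with e he
  rw [← sub_mul, ← mul_sub]
  refine (norm_conj_le' _ _).trans ?_
  have : ‖T e‖ ≤ ‖T‖ := (T.le_opNorm e).trans (mul_le_of_le_one_right (norm_nonneg _) he)
  gcongr

end ModuleMap

/-! ### Upper bounds of increasing sequences -/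

section Suprema

variable {D : Type*} [NonUnitalCStarAlgebra D]

/-- Partial products of the numbers `min (δ i) (1 / 2)` decrease, lie below their last factor and
decay geometrically. -/
theorem exists_antitone_pos_le (δ : ℕ → ℝ) (hδ : ∀ n, 0 < δ n) :
    ∃ κ : ℕ → ℝ, Antitone κ ∧ (∀ n, 0 < κ n) ∧ ∀ n, κ n ≤ δ n ∧ κ n ≤ (1 / 2) ^ (n + 1) := by
  have h0 (i : ℕ) : 0 < min (δ i) (1 / 2) := lt_min (hδ i) (by norm_num)
  have h1 (n : ℕ) : 0 < ∏ i ∈ Finset.range n, min (δ i) (1 / 2) := Finset.prod_pos fun i _ => h0 i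
  have h2 (n : ℕ) : ∏ i ∈ Finset.range n, min (δ i) (1 / 2) ≤ (1 / 2) ^ n := by
    calc _ ≤ ∏ i ∈ Finset.range n, (1 / 2 : ℝ) :=
          Finset.prod_le_prod (fun i _ => (h0 i).le) fun i _ => min_le_right _ _
      _ = _ := by simp
  refine ⟨fun n => ∏ i ∈ Finset.range (n + 1), min (δ i) (1 / 2), ?_, fun n => h1 _,
    fun n => ⟨?_, h2 _⟩⟩
  · refine antitone_nat_of_succ_le fun n => ?_
    rw [Finset.prod_range_succ _ (n + 1)]
    exact mul_le_of_le_one_right (h1 _).le ((min_le_right _ _).trans (by norm_num))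
  · change ∏ i ∈ Finset.range (n + 1), min (δ i) (1 / 2) ≤ δ n
    rw [Finset.prod_range_succ]
    refine (mul_le_of_le_one_left (h0 n).le ((h2 n).trans ?_)).trans (min_le_left _ _)
    exact pow_le_one₀ (by norm_num) (by norm_num)

/-- In a C⋆-algebra with a sequence `L` of orthogonal isometric module maps, the Cuntz classes of an
increasing sequence of positive elements have an upper bound that is a limit of elements below members
of the sequence. -/
theorem exists_limit_of_cuntzLE {L : ℕ → D →L[ℂ] D} (hLm : ∀ n a b, L n (a * b) = L n a * b)
    (hLL : ∀ n a b, star (L n a) * L n b = star a * b)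
    (hLO : ∀ m n, m ≠ n → ∀ a b, star (L m a) * L n b = 0)
    {c : ℕ → D} (hc : ∀ n, IsPositive (c n)) (hcc : ∀ n, CuntzLE (c n) (c (n + 1)))
    {δ : ℕ → ℝ} (hδ : ∀ n, 0 < δ n) :
    ∃ a : D, IsPositive a ∧ (∀ ε : ℝ, 0 < ε → ∃ n b, ‖a - b‖ < ε ∧ CuntzLE b (c n)) ∧
      ∀ n, ∃ b, ‖c n - b‖ < δ n ∧ CuntzLE b a := by
  have hLn (n : ℕ) (a : D) : ‖L n a‖ = ‖a‖ := by
    have h : ‖L n a‖ * ‖L n a‖ = ‖a‖ * ‖a‖ := by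
      rw [← CStarRing.norm_star_mul_self, ← CStarRing.norm_star_mul_self, hLL]
    exact (mul_self_inj (norm_nonneg _) (norm_nonneg _)).1 h
  obtain ⟨h, hh⟩ : ∃ h : ℕ → D, ∀ n, c n = h n * star (h n) := by
    choose y hy using hc
    exact ⟨fun n => star (y n), fun n => by rw [star_star, hy]⟩
  choose X hX using hcc
  -- Weights that make the newly added terms `R n` summable.
  set l : ℕ → ℝ := fun n => (1 / 2) ^ n / (1 + ‖h n‖) with hl
  have hl0 (n : ℕ) : 0 < l n := by positivity
  have hlh (n : ℕ) : l n * ‖h n‖ ≤ (1 / 2) ^ n := by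
    simp only [hl]
    rw [div_mul_eq_mul_div, div_le_iff₀ (by positivity)]
    gcongr
    linarith
  -- `κ n` bounds the total error made after step `n`. The factor `l n ^ 2` compensates for the
  -- later division by it, and half of `δ n` is kept for the approximate unit.
  obtain ⟨κ, hκa, hκ0, hκ⟩ := exists_antitone_pos_le (fun n => l n ^ 2 * (δ n / 2))
    (fun n => mul_pos (pow_pos (hl0 n) 2) (half_pos (hδ n)))
  set μ : ℕ → ℝ := fun n => κ n * (1 / 2) ^ (n + 1) with hμ
  have hμ0 (n : ℕ) : 0 < μ n := mul_pos (hκ0 n) (by positivity)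
  have hη (n : ℕ) (T : D →L[ℂ] D) : 0 < μ n / (‖T‖ ^ 2 + 1) := div_pos (hμ0 n) (by positivity)
  -- `x n` conjugates `c (n + 1)` close to `c n`, with a tolerance that depends on the norm of the
  -- multiplier built so far. So it is chosen as a function of that multiplier, and the recursion is
  -- `T (n + 1) = T n * x n + l (n + 1) * L (n + 1)`.
  let x : ℕ → (D →L[ℂ] D) → D := fun n T => X n _ (hη n T)
  let T : ℕ → D →L[ℂ] D := fun n => Nat.rec ((l 0 : ℂ) • L 0)
    (fun n T => T ∘L (ContinuousLinearMap.mul ℂ D (x n T)) + (l (n + 1) : ℂ) • L (n + 1)) n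
  have hT0 (u : D) : T 0 u = (l 0 : ℂ) • L 0 u := rfl
  have hTs (n : ℕ) (u : D) : T (n + 1) u = T n (x n (T n) * u) + (l (n + 1) : ℂ) • L (n + 1) u := rfl
  have hTm (n : ℕ) : ∀ a b, T n (a * b) = T n a * b := by
    induction n with
    | zero => intro a b; rw [hT0, hT0, hLm, smul_mul_assoc]
    | succ n ih => intro a b; rw [hTs, hTs, hLm, ← mul_assoc, ih, add_mul, smul_mul_assoc]
  have hTO (n : ℕ) : ∀ m, n < m → ∀ a b, star (L m a) * T n b = 0 := by
    induction n with
    | zero => intro m hm a b; rw [hT0, mul_smul_comm, hLO m 0 (by omega), smul_zero]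
    | succ n ih =>
      intro m hm a b
      rw [hTs, mul_add, ih m (by omega), mul_smul_comm, hLO m (n + 1) (by omega), smul_zero, add_zero]
  set P : ℕ → D := fun n => T n (x n (T n) * h (n + 1)) with hP
  set R : ℕ → D := fun n => (l n : ℂ) • L n (h n) with hR
  set q : ℕ → D := fun n => T n (h n) with hq
  have hqs (n : ℕ) : q (n + 1) = P n + R (n + 1) := hTs n _
  have hRn (n : ℕ) : ‖R n‖ ≤ (1 / 2) ^ n := by
    simp only [hR]
    rw [norm_smul, hLn, Complex.norm_of_nonneg (hl0 n).le]
    exact hlh n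
  -- Passing from `h n` to `x n * h (n + 1)` hardly changes the square `h h⋆`, hence hardly changes
  -- its conjugate by `T n`. No closeness of `P n` to `q n` is claimed.
  have hPq (n : ℕ) : ‖P n * star (P n) - q n * star (q n)‖ ≤ μ n := by
    refine (norm_moduleMap_sub_le (hTm n) _ _).trans ?_
    have h1 := hX n _ (hη n (T n))
    have h2 : x n (T n) * h (n + 1) * star (x n (T n) * h (n + 1)) - h n * star (h n)
        = -(c n - x n (T n) * c (n + 1) * star (x n (T n))) := by
      rw [hh, hh, star_mul]
      noncomm_ring
    rw [h2, norm_neg]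
    calc _ ≤ ‖T n‖ ^ 2 * (μ n / (‖T n‖ ^ 2 + 1)) := by gcongr
      _ = μ n * (‖T n‖ ^ 2 / (‖T n‖ ^ 2 + 1)) := by ring
      _ ≤ μ n * 1 := by
        gcongr
        · exact (hμ0 n).le
        · rw [div_le_one (by positivity)]
          linarith
      _ = μ n := mul_one _
  have hPn (n : ℕ) : ‖P n‖ ≤ ‖q n‖ + (1 / 2) ^ (n + 1) := by
    have h1 : ‖P n‖ * ‖P n‖ ≤ ‖q n‖ * ‖q n‖ + μ n := by
      rw [← CStarRing.norm_self_mul_star, ← CStarRing.norm_self_mul_star]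
      linarith [norm_sub_norm_le (P n * star (P n)) (q n * star (q n)), hPq n]
    have h2 : μ n ≤ (1 / 2) ^ (n + 1) * (1 / 2) ^ (n + 1) := by
      simp only [hμ]
      gcongr
      exact (hκ n).2
    have h3 : (0 : ℝ) < (1 / 2) ^ (n + 1) := by positivity
    have h4 := mul_nonneg (norm_nonneg (q n)) h3.le
    refine abs_le_of_sq_le_sq' (by nlinarith) (by positivity) |>.2
  -- Each step adds at most `(1 / 2) ^ (n + 1)` from `P n` and as much from `R (n + 1)`; the bound
  -- starts at `1`.
  have hqn (n : ℕ) : ‖q n‖ ≤ 3 - 2 * (1 / 2) ^ n := by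
    induction n with
    | zero =>
      have := hRn 0
      have h1 : q 0 = R 0 := rfl
      rw [h1]
      norm_num at this ⊢
      exact this
    | succ n ih =>
      rw [hqs]
      have h1 := hRn (n + 1)
      have h2 := hPn n
      have h3 := norm_add_le (P n) (R (n + 1))
      have h4 : (1 / 2 : ℝ) ^ (n + 1) = (1 / 2) ^ n / 2 := by ring
      rw [h4] at h1 h2 ⊢
      linarith
  set b : ℕ → D := fun n => q n * star (q n) with hb
  have hbb (n : ℕ) : dist (b n) (b (n + 1)) ≤ 10 * (1 / 2) ^ n := by
    rw [dist_comm, dist_eq_norm]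
    have h1 : b (n + 1) - b n = (P n * star (P n) - q n * star (q n))
        + (P n * star (R (n + 1)) + R (n + 1) * star (P n) + R (n + 1) * star (R (n + 1))) := by
      simp only [hb]
      rw [hqs, star_add]
      noncomm_ring
    have h2 := hRn (n + 1)
    have h4 : (1 / 2 : ℝ) ^ (n + 1) = (1 / 2) ^ n / 2 := by ring
    have h5 : (1 / 2 : ℝ) ^ n ≤ 1 := pow_le_one₀ (by norm_num) (by norm_num)
    have h6 : (0 : ℝ) < (1 / 2) ^ n := by positivity
    have h3 : ‖P n‖ ≤ 4 := by linarith [hPn n, hqn n]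
    have h7 : μ n ≤ (1 / 2) ^ n := by
      have := (hκ n).2
      simp only [hμ]
      rw [h4] at this ⊢
      nlinarith
    rw [h1]
    calc _ ≤ μ n + (‖P n‖ * ‖R (n + 1)‖ + ‖R (n + 1)‖ * ‖P n‖ + ‖R (n + 1)‖ * ‖R (n + 1)‖) := by
          refine (norm_add_le _ _).trans (add_le_add (hPq n) ((norm_add₃_le).trans ?_))
          gcongr <;> refine (norm_mul_le _ _).trans_eq (by rw [norm_star])
      _ ≤ (1 / 2) ^ n + (4 * (1 / 2) ^ (n + 1) + (1 / 2) ^ (n + 1) * 4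
          + (1 / 2) ^ (n + 1) * (1 / 2) ^ (n + 1)) := by gcongr
      _ ≤ 10 * (1 / 2) ^ n := by
        rw [h4]
        nlinarith
  have hcau : CauchySeq b := cauchySeq_of_le_geometric (1 / 2) 10 (by norm_num) hbb
  obtain ⟨a, ha⟩ := cauchySeq_tendsto_of_complete hcau
  -- Compression by `L i` recovers `l i ^ 2 • c i` exactly from `b i`. Later summands are orthogonal
  -- to `L i`, so each later step only contributes its conjugation error `μ N`, and these errors sum
  -- to less than `κ i`.
  have hlow (i : ℕ) (e : D) (he : ‖e‖ ≤ 1) (k : ℕ) :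
      ‖(l i : ℂ) ^ 2 • (star e * c i * e) - star (L i e) * b (i + k) * L i e‖
        ≤ κ i * (1 - (1 / 2) ^ (i + k)) := by
    have hconj (u : D) : star (L i e) * (u * star u) * L i e
        = (star (L i e) * u) * star (star (L i e) * u) := by
      rw [star_mul, star_star]
      noncomm_ring
    have hRi : star (L i e) * R i = (l i : ℂ) • (star e * h i) := by
      simp only [hR]
      rw [mul_smul_comm, hLL]
    induction k with
    | zero =>
      -- All of `T i` except its last summand is orthogonal to `L i`.
      have h1 : star (L i e) * q i = (l i : ℂ) • (star e * h i) := by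
        rcases i with _ | i
        · exact hRi
        · rw [hqs, mul_add, hTO i (i + 1) (by omega), zero_add, hRi]
      have h2 : star (L i e) * b i * L i e = (l i : ℂ) ^ 2 • (star e * c i * e) := by
        simp only [hb]
        rw [hconj, h1, hh, star_smul, smul_mul_smul_comm, star_mul, star_star]
        simp only [Complex.star_def, Complex.conj_ofReal]
        rw [sq]
        congr 1
        noncomm_ring
      rw [add_zero, h2, sub_self, norm_zero]
      refine mul_nonneg (hκ0 i).le (sub_nonneg.2 (pow_le_one₀ (by norm_num) (by norm_num)))
    | succ k ih =>
      set N := i + k with hN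
      have h1 : star (L i e) * q (N + 1) = star (L i e) * P N := by
        rw [hqs, mul_add]
        simp only [hR]
        rw [mul_smul_comm, hLO i (N + 1) (by omega), smul_zero, add_zero]
      have h2 : star (L i e) * b (N + 1) * L i e = star (L i e) * (P N * star (P N)) * L i e := by
        simp only [hb]
        rw [hconj, h1, ← hconj]
      have h3 : ‖star (L i e) * (P N * star (P N) - b N) * L i e‖ ≤ μ N := by
        have := Stab.norm_conj_le (v := star (L i e)) (a := P N * star (P N) - b N)
          (by rwa [norm_star, hLn])
        rw [star_star] at this
        exact this.trans (hPq N)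
      have h4 : (l i : ℂ) ^ 2 • (star e * c i * e) - star (L i e) * b (N + 1) * L i e
          = ((l i : ℂ) ^ 2 • (star e * c i * e) - star (L i e) * b N * L i e)
            - star (L i e) * (P N * star (P N) - b N) * L i e := by
        rw [h2, mul_sub, sub_mul]
        abel
      have h5 : μ N ≤ κ i * (1 / 2) ^ (N + 1) := by
        simp only [hμ]
        gcongr
        exact hκa (by omega)
      have h6 : (1 / 2 : ℝ) ^ (N + 1) = (1 / 2) ^ N / 2 := by ring
      rw [show i + (k + 1) = N + 1 by omega, h4]
      refine (norm_sub_le _ _).trans ?_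
      rw [h6] at h5 ⊢
      linarith
  refine ⟨a, ?_, ?_, ?_⟩
  · exact isClosed_isPositive.mem_of_tendsto ha (Eventually.of_forall fun n =>
      isPositive_mul_star_self _)
  · intro ε hε
    have h1 := (tendsto_const_nhds (x := a)).sub ha |>.norm
    rw [sub_self, norm_zero] at h1
    obtain ⟨n, hn⟩ := (h1.eventually_lt_const hε).exists
    refine ⟨n, b n, hn, ?_⟩
    have := moduleMap_mul_star_cuntzLE (hTm n) (h n)
    rwa [← hh] at this
  · intro i
    obtain ⟨e, hes, he, he', -⟩ := exists_conj_near (c i) (c i) (half_pos (hδ i))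
    rw [hes] at he'
    have h1 : ‖(l i : ℂ) ^ 2 • (star e * c i * e) - star (L i e) * a * L i e‖ ≤ κ i := by
      have h2 : Tendsto (fun k => ‖(l i : ℂ) ^ 2 • (star e * c i * e)
          - star (L i e) * b (i + k) * L i e‖) atTop
          (𝓝 ‖(l i : ℂ) ^ 2 • (star e * c i * e) - star (L i e) * a * L i e‖) := by
        have h3 : Tendsto (fun k => b (i + k)) atTop (𝓝 a) :=
          ha.comp (tendsto_add_atTop_nat i |>.congr fun k => add_comm k i)
        exact (tendsto_const_nhds.sub ((h3.const_mul _).mul_const _)).norm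
      refine le_of_tendsto h2 (Eventually.of_forall fun k => (hlow i e he k).trans ?_)
      refine mul_le_of_le_one_right (hκ0 i).le ?_
      have : (0 : ℝ) < (1 / 2) ^ (i + k) := by positivity
      linarith
    have hli : (l i : ℂ) ≠ 0 := by exact_mod_cast (hl0 i).ne'
    -- The compression by `L i e`, rescaled to undo the weight `l i`.
    set z := ((l i : ℂ)⁻¹) • star (L i e) with hz
    refine ⟨z * a * star z, ?_, cuntzLE_conj _ _⟩
    have h2 : star e * c i * e - z * a * star z
        = ((l i : ℂ) ^ 2)⁻¹ • ((l i : ℂ) ^ 2 • (star e * c i * e) - star (L i e) * a * L i e) := by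
      rw [smul_sub, inv_smul_smul₀ (pow_ne_zero 2 hli), hz, star_smul, star_star, smul_mul_assoc,
        smul_mul_smul_comm]
      simp only [star_inv₀, Complex.star_def, Complex.conj_ofReal]
      rw [sq, mul_inv]
    have h3 : ‖star e * c i * e - z * a * star z‖ ≤ δ i / 2 := by
      rw [h2, norm_smul, norm_inv, norm_pow, Complex.norm_of_nonneg (hl0 i).le,
        inv_mul_le_iff₀ (pow_pos (hl0 i) 2)]
      exact h1.trans (hκ i).1
    have h4 : c i - z * a * star z
        = (c i - e * c i * e) + (star e * c i * e - z * a * star z) := by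
      rw [hes]
      abel
    rw [h4]
    exact (norm_add_le _ _).trans_lt (by linarith)

end Suprema

/-! ### Suprema and compact containment in `Cu(A)`; the axioms (O1)–(O4) -/

section CuSemigroup

variable {A B : Type*} [NonUnitalCStarAlgebra A] [NonUnitalCStarAlgebra B]

/-- `a` is a norm limit of elements of the form `x cₙ x⋆`. -/
def CuntzLESeq {D : Type*} [NonUnitalCStarAlgebra D] (a : D) (c : ℕ → D) : Prop :=
  ∀ ε : ℝ, 0 < ε → ∃ n, ∃ x : D, ‖a - x * c n * star x‖ < ε

theorem CuntzLE.trans_seq {D : Type*} [NonUnitalCStarAlgebra D] {a b : D} {c : ℕ → D}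
    (hab : CuntzLE a b) (hbc : CuntzLESeq b c) : CuntzLESeq a c := by
  intro ε hε
  obtain ⟨x, hx⟩ := hab (ε / 2) (by positivity)
  obtain ⟨n, y, hy⟩ := hbc (ε / (2 * (‖x‖ ^ 2 + 1))) (by positivity)
  refine ⟨n, x * y, ?_⟩
  have h1 : a - x * y * c n * star (x * y)
      = (a - x * b * star x) + x * (b - y * c n * star y) * star x := by
    rw [star_mul]
    noncomm_ring
  have h3 : ‖x‖ ^ 2 * ‖b - y * c n * star y‖ ≤ ε / 2 := by
    calc _ ≤ (‖x‖ ^ 2 + 1) * (ε / (2 * (‖x‖ ^ 2 + 1))) := by gcongr; linarith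
      _ = ε / 2 := by field_simp
  rw [h1]
  exact (norm_add_le _ _).trans_lt (by linarith [norm_conj_le' x (b - y * c n * star y)])

theorem CuntzLESeq.cuntzLE {D : Type*} [NonUnitalCStarAlgebra D] {a b : D} {c : ℕ → D}
    (h : CuntzLESeq a c) (hc : ∀ n, CuntzLE (c n) b) : CuntzLE a b := by
  refine cuntzLE_of_forall_near fun ε hε => ?_
  obtain ⟨n, x, hx⟩ := h ε hε
  exact ⟨_, hx, (cuntzLE_conj _ _).trans (hc n)⟩

theorem CuntzLESeq.map {D E : Type*} [NonUnitalCStarAlgebra D] [NonUnitalCStarAlgebra E]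
    (f : D →⋆ₙₐ[ℂ] E) {a : D} {c : ℕ → D} (h : CuntzLESeq a c) :
    CuntzLESeq (f a) fun n => f (c n) := by
  intro ε hε
  obtain ⟨n, x, hx⟩ := h ε hε
  refine ⟨n, f x, ?_⟩
  rw [← map_star, ← map_mul, ← map_mul, ← map_sub]
  exact (NonUnitalStarAlgHom.norm_apply_le f _).trans_lt hx

/-- The embedding of the index set as the `n`-th part of a partition into infinite sets. -/
def pairEmb (n : ℕ) : ℕ ↪ ℕ := ⟨Nat.pair n, fun _ _ h => (Nat.pair_eq_pair.1 h).2⟩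

theorem pairEmb_ne {m n : ℕ} (h : m ≠ n) (i j : ℕ) : pairEmb m i ≠ pairEmb n j :=
  fun h' => h (Nat.pair_eq_pair.1 h').1

/-- The preceding construction puts below `a` only approximations of `c i`, with error `δ i`. Any
fixed `c k` is approximated by conjugates of `c i` for large `i`, so it lies below `a` if the
conjugators do not inflate `δ i` too much. -/
theorem exists_limit_of_monotone {c : ℕ → PosStab A} (hc : Monotone c) :
    ∃ a : PosStab A, (∀ n, c n ≤ a) ∧ CuntzLESeq a.1 fun n => (c n).1 := by
  have hY : ∀ i k : ℕ, ∃ y : Stab A, k ≤ i →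
      ‖(c k).1 - y * (c i).1 * star y‖ < 1 / ((i : ℝ) + 1) := by
    intro i k
    by_cases h : k ≤ i
    · obtain ⟨y, hy⟩ := hc h (1 / ((i : ℝ) + 1)) (by positivity)
      exact ⟨y, fun _ => hy⟩
    · exact ⟨0, fun h' => absurd h' h⟩
  choose y hy using hY
  -- `M i` bounds `‖y i k‖ ^ 2` for all `k ≤ i`. With `δ i = 1 / ((i + 1) M i)` the conjugated
  -- errors still tend to zero.
  set M : ℕ → ℝ := fun i => 1 + ∑ k ∈ Finset.range (i + 1), ‖y i k‖ ^ 2 with hM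
  have hM1 (i : ℕ) : 1 ≤ M i := le_add_of_nonneg_right (Finset.sum_nonneg fun _ _ => by positivity)
  have hM0 (i : ℕ) : 0 < M i := one_pos.trans_le (hM1 i)
  have hyM (i k : ℕ) (h : k ≤ i) : ‖y i k‖ ^ 2 ≤ M i := by
    have := Finset.single_le_sum (f := fun k => ‖y i k‖ ^ 2) (fun _ _ => by positivity)
      (Finset.mem_range.2 (Nat.lt_succ_of_le h))
    simp only [hM]
    linarith
  obtain ⟨a, ha, h1, h2⟩ := exists_limit_of_cuntzLE (L := fun n => Stab.rowShift (pairEmb n))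
    (fun n => Stab.rowShift_mul _) (fun n => Stab.star_rowShift_mul_rowShift _)
    (fun m n h => Stab.star_rowShift_mul_rowShift_of_ne (pairEmb_ne h))
    (c := fun n => (c n).1) (fun n => (c n).2) (fun n => hc n.le_succ)
    (δ := fun i => 1 / ((i : ℝ) + 1) / M i) (fun i => div_pos (by positivity) (hM0 i))
  refine ⟨⟨a, ha⟩, fun k => cuntzLE_of_forall_near fun ε hε => ?_, fun ε hε => ?_⟩
  · obtain ⟨i, hi⟩ := exists_nat_one_div_lt (half_pos hε)
    set i' := max i k with hi'
    have hi'' : 1 / ((i' : ℝ) + 1) < ε / 2 := by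
      refine lt_of_le_of_lt ?_ hi
      gcongr
      exact le_max_left _ _
    obtain ⟨b, hb, hba⟩ := h2 i'
    refine ⟨y i' k * b * star (y i' k), ?_, (cuntzLE_conj _ _).trans hba⟩
    have h3 : (c k).1 - y i' k * b * star (y i' k)
        = ((c k).1 - y i' k * (c i').1 * star (y i' k))
          + y i' k * ((c i').1 - b) * star (y i' k) := by noncomm_ring
    have h4 := hy i' k (le_max_right _ _)
    have h5 : ‖y i' k * ((c i').1 - b) * star (y i' k)‖ ≤ 1 / ((i' : ℝ) + 1) := by
      refine (norm_conj_le' _ _).trans ?_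
      calc _ ≤ M i' * (1 / ((i' : ℝ) + 1) / M i') :=
            mul_le_mul (hyM i' k (le_max_right _ _)) hb.le (norm_nonneg _) (hM0 i').le
        _ = _ := mul_div_cancel₀ _ (hM0 i').ne'
    rw [h3]
    exact (norm_add_le _ _).trans_lt (by linarith)
  · obtain ⟨n, b, hab, hb⟩ := h1 (ε / 2) (half_pos hε)
    obtain ⟨x, hx⟩ := hb (ε / 2) (half_pos hε)
    exact ⟨n, x, by linarith [norm_sub_le_norm_sub_add_norm_sub a b (x * (c n).1 * star x)]⟩

namespace Cu

theorem exists_rep (u : ℕ → Cu A) : ∃ c : ℕ → PosStab A, u = fun n => mk (c n) := by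
  choose c hc using fun n => (ind (p := fun s => ∃ a, s = mk a) (u n) fun a => ⟨a, rfl⟩)
  exact ⟨c, funext hc⟩

/-- A supremum lies below the limit constructed above and inherits its approximability. Conversely,
an approximable element lies below every upper bound. The right side survives ⋆-homomorphisms and
orthogonal sums, unlike the order-theoretic left side. -/
theorem isLUB_iff {c : ℕ → PosStab A} (hc : Monotone c) {s : PosStab A} :
    IsLUB (Set.range fun n => mk (c n)) (mk s) ↔
      (∀ n, c n ≤ s) ∧ CuntzLESeq s.1 fun n => (c n).1 := by
  constructor
  · intro h
    obtain ⟨a, h1, h2⟩ := exists_limit_of_monotone hc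
    refine ⟨fun n => h.1 ⟨n, rfl⟩, CuntzLE.trans_seq ?_ h2⟩
    refine (mk_le_mk (a := s) (b := a)).1 (h.2 ?_)
    rintro _ ⟨n, rfl⟩
    exact h1 n
  · rintro ⟨h1, h2⟩
    refine ⟨?_, fun b => ind b fun b hb => ?_⟩
    · rintro _ ⟨n, rfl⟩
      exact h1 n
    · exact h2.cuntzLE fun n => mk_le_mk.1 (hb ⟨n, rfl⟩)

/-- If `b'` lies below a supremum, some `x (c n) x⋆` is so near `b'` that it is within `δ` of `b`,
and the cut-down of `b` lies below it. -/
theorem wayBelow_of_isCutDown {δ : ℝ} {b b' d : PosStab A} (hd : IsCutDown δ d.1 b.1)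
    (hbb : ‖b.1 - b'.1‖ < δ) : WayBelow (mk d) (mk b') := by
  intro u s hu hs hbs
  obtain ⟨c, rfl⟩ := exists_rep u
  revert hs hbs
  refine ind s fun s hbs hs => ?_
  have hc : Monotone c := fun i j hij => hu hij
  obtain ⟨n, x, hx⟩ := (mk_le_mk.1 hbs).trans_seq ((isLUB_iff hc).1 hs).2 _ (sub_pos.2 hbb)
  refine ⟨n, mk_le_mk.2 (CuntzLE.trans ?_ (cuntzLE_conj x (c n).1))⟩
  refine hd.cuntzLE_of_near b.2 ((c n).2.conj x) ?_
  linarith [norm_sub_le_norm_sub_add_norm_sub b.1 b'.1 (x * (c n).1 * star x)]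

/-- The ratio `1 / 3` makes `2 (1 / 3) ^ (n + 1) < (1 / 3) ^ n`: each cut-down is so near `b` that
the preceding one is compactly contained in it. -/
theorem exists_cutDown_seq (b : PosStab A) : ∃ d : ℕ → PosStab A,
    (∀ n, IsCutDown ((1 / 3) ^ n) (d n).1 b.1) ∧ (∀ n, ‖b.1 - (d n).1‖ ≤ 2 * (1 / 3) ^ n) := by
  choose d h1 h2 using fun n : ℕ => exists_isCutDown b.2 (δ := (1 / 3) ^ n) (by positivity)
  exact ⟨fun n => ⟨d n, (h1 n).1⟩, h1, h2⟩

theorem isLUB_cutDown_seq {b : PosStab A} {d : ℕ → PosStab A}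
    (h1 : ∀ n, IsCutDown ((1 / 3) ^ n) (d n).1 b.1) (h2 : ∀ n, ‖b.1 - (d n).1‖ ≤ 2 * (1 / 3) ^ n) :
    Monotone d ∧ IsLUB (Set.range fun n => mk (d n)) (mk b) := by
  have h3 (n : ℕ) : (1 / 3 : ℝ) ^ (n + 1) = (1 / 3) ^ n / 3 := by ring
  have h4 (n : ℕ) : (0 : ℝ) < (1 / 3) ^ n := by positivity
  have hd : Monotone d := monotone_nat_of_le_succ fun n =>
    (h1 n).cuntzLE_of_near b.2 (d (n + 1)).2 (by linarith [h2 (n + 1), h3 n, h4 n])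
  refine ⟨hd, (isLUB_iff hd).2 ⟨fun n => (h1 n).cuntzLE_of_near b.2 b.2 ?_, fun ε hε => ?_⟩⟩
  · rw [sub_self, norm_zero]
    exact (h4 n).le
  · have h5 : Tendsto (fun n : ℕ => 2 * (1 / 3 : ℝ) ^ n) atTop (𝓝 (2 * 0)) :=
      (tendsto_pow_atTop_nhds_zero_of_lt_one (by norm_num) (by norm_num)).const_mul 2
    rw [mul_zero] at h5
    obtain ⟨n, hn⟩ := (h5.eventually_lt_const (half_pos hε)).exists
    obtain ⟨x, hx⟩ := CuntzLE.refl (d n).1 (ε / 2) (half_pos hε)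
    exact ⟨n, x, by
      linarith [norm_sub_le_norm_sub_add_norm_sub b.1 (d n).1 (x * (d n).1 * star x), h2 n]⟩

/-- The sequence of cut-downs of `b` has supremum `b`, so whatever is compactly contained in `b`
lies below one of them. Additivity and functoriality of `≪` are read off from this. -/
theorem wayBelow_iff {a b : PosStab A} : WayBelow (mk a) (mk b) ↔
    ∃ δ : ℝ, 0 < δ ∧ ∃ d : PosStab A, IsCutDown δ d.1 b.1 ∧ a ≤ d := by
  constructor
  · intro h
    obtain ⟨d, h1, h2⟩ := exists_cutDown_seq b
    obtain ⟨h3, h4⟩ := isLUB_cutDown_seq h1 h2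
    obtain ⟨n, hn⟩ := h _ _ (fun i j hij => h3 hij) h4 le_rfl
    exact ⟨_, by positivity, d n, h1 n, hn⟩
  · rintro ⟨δ, hδ, d, hd, had⟩ u s hu hs hbs
    obtain ⟨n, hn⟩ := wayBelow_of_isCutDown hd (b' := b) (by rwa [sub_self, norm_zero]) u s hu hs hbs
    exact ⟨n, le_trans had hn⟩

end Cu

theorem IsCutDown.oplus {δ δ' : ℝ} {d a d' a' : Stab A} (h : IsCutDown δ d a)
    (h' : IsCutDown δ' d' a') : IsCutDown (min δ δ') (Stab.oplus d d') (Stab.oplus a a') := by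
  obtain ⟨hd, w, hw⟩ := h.mono (min_le_left δ δ')
  obtain ⟨hd', w', hw'⟩ := h'.mono (min_le_right δ δ')
  refine ⟨Stab.isPositive_oplus hd hd', Stab.oplus w w', ?_⟩
  convert Stab.isPositive_oplus hw hw' using 1
  have h1 := Stab.shift_mul_shift_eq_zero (A := A) _ _ evenEmb_ne_oddEmb
  have h2 := Stab.shift_mul_shift_eq_zero (A := A) oddEmb evenEmb
    fun i j h => evenEmb_ne_oddEmb j i h.symm
  simp only [Stab.oplus]
  rw [star_add, ← map_star, ← map_star]
  simp only [add_mul, mul_add, h1, h2, add_zero, zero_add, mul_assoc]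
  simp only [← mul_assoc, mul_zero, add_zero, zero_add, map_sub, map_mul, map_smul, smul_add]
  abel

/-- The two approximations use different indices. Monotonicity moves both to the larger one at the
cost of a further small error. -/
theorem CuntzLESeq.oplus {a b : Stab A} {c d : ℕ → PosStab A} (hc : Monotone c) (hd : Monotone d)
    (ha : CuntzLESeq a fun n => (c n).1) (hb : CuntzLESeq b fun n => (d n).1) :
    CuntzLESeq (Stab.oplus a b) fun n => ((c n).oplus (d n)).1 := by
  intro ε hε
  obtain ⟨n, x, hx⟩ := ha (ε / 3) (by positivity)
  obtain ⟨m, y, hy⟩ := hb (ε / 3) (by positivity)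
  set N := max n m
  obtain ⟨z, hz⟩ := Stab.cuntzLE_oplus ((cuntzLE_conj x (c n).1).trans (hc (le_max_left n m)))
    ((cuntzLE_conj y (d m).1).trans (hd (le_max_right n m))) (ε / 3) (by positivity)
  refine ⟨N, z, ?_⟩
  have h1 : Stab.oplus a b - Stab.oplus (x * (c n).1 * star x) (y * (d m).1 * star y)
      = Stab.shift evenEmb (a - x * (c n).1 * star x)
        + Stab.shift oddEmb (b - y * (d m).1 * star y) := by
    simp only [Stab.oplus, map_sub]
    abel
  have h2 := norm_add_le (Stab.shift evenEmb (a - x * (c n).1 * star x))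
    (Stab.shift oddEmb (b - y * (d m).1 * star y))
  rw [← h1] at h2
  have h3 := NonUnitalStarAlgHom.norm_apply_le (Stab.shift evenEmb) (a - x * (c n).1 * star x)
  have h4 := NonUnitalStarAlgHom.norm_apply_le (Stab.shift oddEmb) (b - y * (d m).1 * star y)
  have h5 := norm_sub_le_norm_sub_add_norm_sub (Stab.oplus a b)
    (Stab.oplus (x * (c n).1 * star x) (y * (d m).1 * star y)) (z * ((c N).oplus (d N)).1 * star z)
  have h6 : ‖Stab.oplus (x * (c n).1 * star x) (y * (d m).1 * star y)
      - z * ((c N).oplus (d N)).1 * star z‖ < ε / 3 := hz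
  linarith

theorem Cu.isCuSemigroup : IsCuSemigroup (Cu A) where
  zero_le s := ind s fun a => zero_cuntzLE a.1
  add_le_add s s' t t' := by
    refine ind s fun a => ind s' fun a' => ind t fun b => ind t' fun b' h h' => ?_
    exact Stab.cuntzLE_oplus h h'
  exists_sup u hu := by
    obtain ⟨c, rfl⟩ := exists_rep u
    have hc : Monotone c := fun i j hij => hu hij
    obtain ⟨a, ha⟩ := exists_limit_of_monotone hc
    exact ⟨mk a, (isLUB_iff hc).2 ha⟩
  exists_wayBelow_seq s := by
    refine ind s fun b => ?_
    obtain ⟨d, h1, h2⟩ := exists_cutDown_seq b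
    refine ⟨fun n => mk (d n), fun n => wayBelow_of_isCutDown (h1 n) ?_, (isLUB_cutDown_seq h1 h2).2⟩
    have h3 : (1 / 3 : ℝ) ^ (n + 1) = (1 / 3) ^ n / 3 := by ring
    have h4 : (0 : ℝ) < (1 / 3) ^ n := by positivity
    linarith [h2 (n + 1)]
  add_wayBelow_add s s' t t' := by
    refine ind s fun a => ind s' fun a' => ind t fun b => ind t' fun b' h h' => ?_
    obtain ⟨δ, hδ, d, hd, had⟩ := wayBelow_iff.1 h
    obtain ⟨δ', hδ', d', hd', had'⟩ := wayBelow_iff.1 h'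
    exact wayBelow_iff.2 ⟨min δ δ', lt_min hδ hδ', d.oplus d', hd.oplus hd',
      Stab.cuntzLE_oplus had had'⟩
  sup_add_sup u v s t hu hv := by
    obtain ⟨c, rfl⟩ := exists_rep u
    obtain ⟨d, rfl⟩ := exists_rep v
    have hc : Monotone c := fun i j hij => hu hij
    have hd : Monotone d := fun i j hij => hv hij
    refine ind s fun a => ind t fun b ha hb => ?_
    obtain ⟨h1, h2⟩ := (isLUB_iff hc).1 ha
    obtain ⟨h3, h4⟩ := (isLUB_iff hd).1 hb
    exact (isLUB_iff (c := fun n => (c n).oplus (d n)) (s := a.oplus b)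
      fun i j hij => Stab.cuntzLE_oplus (hc hij) (hd hij)).2
      ⟨fun n => Stab.cuntzLE_oplus (h1 n) (h3 n), h2.oplus hc hd h4⟩

theorem Cu.isCuMorphism_map (φ : A →⋆ₙₐ[ℂ] B) : IsCuMorphism (Cu.map φ) where
  monotone s t := ind s fun a => ind t fun b h => PosStab.monotone_map φ h
  map_wayBelow s t := by
    refine ind s fun a => ind t fun b h => ?_
    obtain ⟨δ, hδ, d, hd, had⟩ := wayBelow_iff.1 h
    exact wayBelow_iff.2 ⟨δ, hδ, d.map φ, hd.map _, PosStab.monotone_map φ had⟩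
  map_sup u s hu := by
    obtain ⟨c, rfl⟩ := exists_rep u
    have hc : Monotone c := fun i j hij => hu hij
    refine ind s fun a ha => ?_
    obtain ⟨h1, h2⟩ := (isLUB_iff hc).1 ha
    exact (isLUB_iff (c := fun n => (c n).map φ) (s := a.map φ)
      fun i j hij => PosStab.monotone_map φ (hc hij)).2
      ⟨fun n => PosStab.monotone_map φ (h1 n), h2.map _⟩

end CuSemigroup

/-! ### Elementary properties of compact containment -/

section WayBelow

variable {X Y : Type*} [PartialOrder X] [PartialOrder Y]

theorem WayBelow.le {a b : X} (h : WayBelow a b) : a ≤ b := by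
  obtain ⟨_, hn⟩ := h (fun _ => b) b monotone_const (by simp) le_rfl
  exact hn

theorem WayBelow.trans_le {a b c : X} (h : WayBelow a b) (hbc : b ≤ c) : WayBelow a c :=
  fun u s hu hs hcs => h u s hu hs (hbc.trans hcs)

theorem wayBelow_of_le_of_wayBelow {a b c : X} (hab : a ≤ b) (h : WayBelow b c) : WayBelow a c :=
  fun u s hu hs hcs => (h u s hu hs hcs).imp fun _ hn => hab.trans hn

theorem WayBelow.trans {a b c : X} (h : WayBelow a b) (h' : WayBelow b c) : WayBelow a c :=
  h.trans_le h'.le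

theorem isLUB_range_orderIso (e : X ≃o Y) (u : ℕ → X) (s : X) :
    IsLUB (Set.range fun n => e (u n)) (e s) ↔ IsLUB (Set.range u) s := by
  rw [show (Set.range fun n => e (u n)) = e '' Set.range u from Set.range_comp e u, e.isLUB_image,
    e.symm_apply_apply]

theorem wayBelow_of_orderIso (e : X ≃o Y) {a b : X} (h : WayBelow (e a) (e b)) : WayBelow a b := by
  intro u s hu hs hbs
  obtain ⟨n, hn⟩ := h (fun n => e (u n)) (e s) (e.monotone.comp hu)
    ((isLUB_range_orderIso e u s).2 hs) (e.monotone hbs)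
  exact ⟨n, e.le_iff_le.1 hn⟩

theorem wayBelow_orderIso_iff (e : X ≃o Y) {a b : X} : WayBelow (e a) (e b) ↔ WayBelow a b :=
  ⟨wayBelow_of_orderIso e, fun h => wayBelow_of_orderIso e.symm (by simpa using h)⟩

end WayBelow

/-! ### Maps out of quotients by normal pairs -/

section Lift

variable {S X : Type*} [AddCommMonoid S] [AddCommMonoid X]

namespace RelPair.Quo

variable {α : RelPair S} {h : α.IsNormal}

/-- The map on the quotient induced by a map that is constant on classes. -/
def lift (g : S →+ X) (hg : ∀ a b, α.le a b → α.le b a → g a = g b) : α.Quo h →+ X :=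
  (α.con h).lift g fun {a b} hab => hg a b hab.1 hab.2

theorem lift_mk (g : S →+ X) (hg : ∀ a b, α.le a b → α.le b a → g a = g b) (a : S) :
    lift (h := h) g hg (mk α h a) = g a := rfl

end RelPair.Quo

end Lift

/-! ### Normal pairs, quotients and `W`-structures pulled back along `Cu`-morphisms -/

section Semigroups

variable {S T X X' : Type*} [AddCommMonoid S] [AddCommMonoid T] [AddCommMonoid X] [AddCommMonoid X']
  [PartialOrder S] [PartialOrder T]

theorem IsCuSemigroup.zero_wayBelow (hS : IsCuSemigroup S) (a : S) : WayBelow 0 a :=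
  fun u _ _ _ _ => ⟨0, hS.zero_le (u 0)⟩

theorem IsCuSemigroup.exists_seq (hS : IsCuSemigroup S) (a : S) : ∃ u : ℕ → S, Monotone u ∧
    (∀ n, WayBelow (u n) (u (n + 1))) ∧ (∀ n, WayBelow (u n) a) ∧ IsLUB (Set.range u) a := by
  obtain ⟨u, hu, ha⟩ := hS.exists_wayBelow_seq a
  exact ⟨u, monotone_nat_of_le_succ fun n => (hu n).le, hu,
    fun n => (hu n).trans_le (ha.1 ⟨n + 1, rfl⟩), ha⟩

theorem IsCuSemigroup.le_of_forall_wayBelow (hS : IsCuSemigroup S) {a b : S}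
    (h : ∀ x, WayBelow x a → x ≤ b) : a ≤ b := by
  obtain ⟨u, -, -, hu, ha⟩ := hS.exists_seq a
  refine ha.2 ?_
  rintro _ ⟨n, rfl⟩
  exact h _ (hu n)

theorem IsCuSemigroup.exists_between (hS : IsCuSemigroup S) {a b : S} (h : WayBelow a b) :
    ∃ c, WayBelow a c ∧ WayBelow c b := by
  obtain ⟨u, hm, hu, hub, hb⟩ := hS.exists_seq b
  obtain ⟨n, hn⟩ := h u b hm hb le_rfl
  -- The supremum argument only gives `a ≤ u n`; one more index turns this into `a ≪ u (n + 1)`. The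
  -- same shift recurs below.
  exact ⟨u (n + 1), wayBelow_of_le_of_wayBelow hn (hu n), hub _⟩

theorem IsCuSemigroup.of_orderAddMonoidIso [PartialOrder X] (e : X ≃+o T) (hT : IsCuSemigroup T) :
    IsCuSemigroup X := by
  have hl (u : ℕ → X) (s : X) : IsLUB (Set.range fun n => e (u n)) (e s) ↔ IsLUB (Set.range u) s :=
    isLUB_range_orderIso (e : X ≃o T) u s
  have hw {a b : X} : WayBelow (e a) (e b) ↔ WayBelow a b := wayBelow_orderIso_iff (e : X ≃o T)
  have hle {a b : X} : e a ≤ e b ↔ a ≤ b := map_le_map_iff e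
  have hmono {u : ℕ → X} (hu : Monotone u) : Monotone fun n => e (u n) := fun i j h => hle.2 (hu h)
  constructor
  · intro a
    rw [← hle, map_zero]
    exact hT.zero_le _
  · intro a a' b b' h h'
    rw [← hle, map_add, map_add]
    exact hT.add_le_add _ _ _ _ (hle.2 h) (hle.2 h')
  · intro u hu
    obtain ⟨s, hs⟩ := hT.exists_sup _ (hmono hu)
    obtain ⟨s, rfl⟩ := e.surjective s
    exact ⟨s, (hl u s).1 hs⟩
  · intro a
    obtain ⟨u, hu, ha⟩ := hT.exists_wayBelow_seq (e a)
    choose v hv using fun n => e.surjective (u n)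
    obtain rfl : (fun n => e (v n)) = u := funext hv
    exact ⟨v, fun n => hw.1 (hu n), (hl v a).1 ha⟩
  · intro a a' b b' h h'
    rw [← hw, map_add, map_add]
    exact hT.add_wayBelow_add _ _ _ _ (hw.2 h) (hw.2 h')
  · intro u v s t hu hv hs ht
    rw [← hl, map_add]
    simp only [map_add]
    exact hT.sup_add_sup _ _ _ _ (hmono hu) (hmono hv) ((hl u s).2 hs) ((hl v t).2 ht)

/-- Every element of a `Cu`-semigroup is the supremum of elements compactly contained in it, so `≪`
determines the order. -/
theorem kernelPair_le_iff {S T : Type*} [AddCommMonoid S] [AddCommMonoid T] [PartialOrder T]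
    {precS : S → S → Prop} (hT : IsCuSemigroup T) {f : S →+ T} {a b : S} :
    (kernelPair precS WayBelow f).le a b ↔ f a ≤ f b :=
  ⟨fun h => hT.le_of_forall_wayBelow fun x hx => (h x hx).le, fun h _ hx => hx.trans_le h⟩

theorem IsCuMorphism.le_of_forall_wayBelow {f : S →+ T} (hf : IsCuMorphism f)
    (hS : IsCuSemigroup S) {a : S} {t : T} (h : ∀ x, WayBelow x a → f x ≤ t) : f a ≤ t := by
  obtain ⟨u, hm, -, hu, ha⟩ := hS.exists_seq a
  refine (hf.map_sup u a hm ha).2 ?_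
  rintro _ ⟨n, rfl⟩
  exact h _ (hu n)

/-- Preservation of suprema supplies the continuity half of the definition of a `W`-morphism. -/
theorem IsCuMorphism.exists_of_wayBelow {f : S →+ T} (hf : IsCuMorphism f) (hS : IsCuSemigroup S)
    {t : T} {a : S} (h : WayBelow t (f a)) : ∃ b, WayBelow b a ∧ WayBelow t (f b) := by
  obtain ⟨u, hm, hu, hua, ha⟩ := hS.exists_seq a
  obtain ⟨n, hn⟩ := h _ _ (fun i j hij => hf.monotone (hm hij)) (hf.map_sup u a hm ha) le_rfl
  exact ⟨u (n + 1), hua _, wayBelow_of_le_of_wayBelow hn (hf.map_wayBelow _ _ (hu n))⟩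

/-- An additive surjection `g` onto a monoid with a relation that corresponds to compact containment
under a `Cu`-morphism `f` exhibits that monoid as a `W`-semigroup. -/
theorem IsWSemigroup.of_surjective {f : S →+ T} (hf : IsCuMorphism f) (hS : IsCuSemigroup S)
    (hT : IsCuSemigroup T) {g : S →+ X} (hg : Function.Surjective g) {prec : X → X → Prop}
    (hprec : ∀ a b, prec (g a) (g b) ↔ WayBelow (f a) (f b)) : IsWSemigroup X prec where
  trans := by
    intro a b c
    obtain ⟨a, rfl⟩ := hg a
    obtain ⟨b, rfl⟩ := hg b
    obtain ⟨c, rfl⟩ := hg c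
    simp only [hprec]
    exact WayBelow.trans
  zero_prec a := by
    obtain ⟨a, rfl⟩ := hg a
    rw [← map_zero g, hprec, map_zero]
    exact hT.zero_wayBelow _
  add_prec_add a a' b b' := by
    obtain ⟨a, rfl⟩ := hg a
    obtain ⟨b, rfl⟩ := hg b
    obtain ⟨a', rfl⟩ := hg a'
    obtain ⟨b', rfl⟩ := hg b'
    rw [← map_add, ← map_add, hprec, hprec, hprec, map_add, map_add]
    exact hT.add_wayBelow_add _ _ _ _
  exists_seq a := by
    obtain ⟨a, rfl⟩ := hg a
    obtain ⟨u, hm, hu, hua, ha⟩ := hS.exists_seq a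
    refine ⟨fun n => g (u n), fun k => (hprec _ _).2 (hf.map_wayBelow _ _ (hua k)),
      fun k => (hprec _ _).2 (hf.map_wayBelow _ _ (hu k)), fun b hb => ?_⟩
    obtain ⟨b, rfl⟩ := hg b
    rw [hprec] at hb
    obtain ⟨n, hn⟩ := hb _ _ (fun i j hij => hf.monotone (hm hij)) (hf.map_sup u a hm ha) le_rfl
    exact ⟨n + 1, (hprec _ _).2 (wayBelow_of_le_of_wayBelow hn (hf.map_wayBelow _ _ (hu n)))⟩
  exists_of_prec_add a b c h := by
    obtain ⟨a, rfl⟩ := hg a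
    obtain ⟨b, rfl⟩ := hg b
    obtain ⟨c, rfl⟩ := hg c
    rw [← map_add, hprec, map_add] at h
    obtain ⟨u, hm, hu, hub, hb⟩ := hS.exists_seq b
    obtain ⟨v, hm', hv, hvc, hc⟩ := hS.exists_seq c
    have hfu : Monotone fun n => f (u n) := fun i j hij => hf.monotone (hm hij)
    have hfv : Monotone fun n => f (v n) := fun i j hij => hf.monotone (hm' hij)
    -- Axiom (O4) in the target: `f b + f c` is the supremum of `f (u n) + f (v n)`.
    obtain ⟨n, hn⟩ := h _ _ (fun i j hij => hT.add_le_add _ _ _ _ (hfu hij) (hfv hij))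
      (hT.sup_add_sup _ _ _ _ hfu hfv (hf.map_sup u b hm hb) (hf.map_sup v c hm' hc)) le_rfl
    refine ⟨g (u (n + 1)), g (v (n + 1)), (hprec _ _).2 (hf.map_wayBelow _ _ (hub _)),
      (hprec _ _).2 (hf.map_wayBelow _ _ (hvc _)), ?_⟩
    rw [← map_add, hprec, map_add]
    exact wayBelow_of_le_of_wayBelow hn (hT.add_wayBelow_add _ _ _ _
      (hf.map_wayBelow _ _ (hu n)) (hf.map_wayBelow _ _ (hv n)))

/-- Both relations are read off from `S` through `f` and `f'`. Continuity is that of `f'`, and the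
witness found in `S` is pushed down by `g`. -/
theorem IsWMorphism.of_surjective {T' : Type*} [AddCommMonoid T'] [PartialOrder T']
    {f : S →+ T} (hf : IsCuMorphism f) {f' : S →+ T'} (hf' : IsCuMorphism f')
    (hS : IsCuSemigroup S) {g : S →+ X} (hg : Function.Surjective g) {g' : S →+ X'}
    (hg' : Function.Surjective g') {prec : X → X → Prop} {prec' : X' → X' → Prop}
    (hprec : ∀ a b, prec (g a) (g b) ↔ WayBelow (f a) (f b))
    (hprec' : ∀ a b, prec' (g' a) (g' b) ↔ WayBelow (f' a) (f' b))
    (hff' : ∀ a b, WayBelow (f a) (f b) → WayBelow (f' a) (f' b))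
    {θ : X →+ X'} (hθ : ∀ s, θ (g s) = g' s) : IsWMorphism prec prec' θ where
  map_prec a b := by
    obtain ⟨a, rfl⟩ := hg a
    obtain ⟨b, rfl⟩ := hg b
    rw [hθ, hθ, hprec, hprec']
    exact hff' a b
  continuous a b h := by
    obtain ⟨a, rfl⟩ := hg a
    obtain ⟨b, rfl⟩ := hg' b
    rw [hθ, hprec'] at h
    obtain ⟨a', ha, hb⟩ := hf'.exists_of_wayBelow hS h
    exact ⟨g a', (hprec _ _).2 (hf.map_wayBelow _ _ ha), by rwa [hθ, hprec']⟩

theorem isCuMorphism_id : IsCuMorphism (AddMonoidHom.id S) where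
  monotone := monotone_id
  map_wayBelow _ _ h := h
  map_sup _ _ _ h := h

theorem IsWMorphism.of_comp_eq {f : S →+ T} (hf : IsCuMorphism f) (hS : IsCuSemigroup S)
    {g : S →+ X} (hg : Function.Surjective g) {prec : X → X → Prop}
    (hprec : ∀ a b, prec (g a) (g b) ↔ WayBelow (f a) (f b)) {ι : X →+ T} (hι : ∀ s, ι (g s) = f s) :
    IsWMorphism prec WayBelow ι where
  map_prec a b := by
    obtain ⟨a, rfl⟩ := hg a
    obtain ⟨b, rfl⟩ := hg b
    rw [hι, hι, hprec]
    exact id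
  continuous a b h := by
    obtain ⟨a, rfl⟩ := hg a
    rw [hι] at h
    obtain ⟨a', ha, hb⟩ := hf.exists_of_wayBelow hS h
    exact ⟨g a', (hprec _ _).2 (hf.map_wayBelow _ _ ha), by rwa [hι]⟩

namespace RelPair

variable {α : RelPair S} {f : S →+ T}

/-- An intermediate element for `f a ≪ f b` exists because `f b` is the supremum of images of
elements `c ≪ b`. -/
theorem comp_iff_wayBelow (hf : IsCuMorphism f) (hS : IsCuSemigroup S)
    (hprec : ∀ a b, α.prec a b ↔ WayBelow a b) (hle : ∀ a b, α.le a b ↔ f a ≤ f b) {a b : S} :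
    α.comp a b ↔ WayBelow (f a) (f b) := by
  constructor
  · rintro ⟨c, hac, hcb⟩
    exact wayBelow_of_le_of_wayBelow ((hle _ _).1 hac) (hf.map_wayBelow _ _ ((hprec _ _).1 hcb))
  · intro h
    obtain ⟨c, hc, hac⟩ := hf.exists_of_wayBelow hS h
    exact ⟨c, (hle _ _).2 hac.le, (hprec _ _).2 hc⟩

/-- In terms of `f`, admissibility says that `f a` is the supremum of `f x` over `x ≪ a`, and left
continuity is interpolation for `≪`. -/
theorem isNormal_of_isCuMorphism (hf : IsCuMorphism f) (hS : IsCuSemigroup S)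
    (hT : IsCuSemigroup T) (hprec : ∀ a b, α.prec a b ↔ WayBelow a b)
    (hle : ∀ a b, α.le a b ↔ f a ≤ f b) : α.IsNormal where
  refl a := (hle _ _).2 le_rfl
  trans a b c h h' := (hle _ _).2 (((hle _ _).1 h).trans ((hle _ _).1 h'))
  admissible a b h := by
    refine (hle _ _).2 (hf.le_of_forall_wayBelow hS fun x hx => ?_)
    have := h x ((comp_iff_wayBelow hf hS hprec hle).2 (hf.map_wayBelow _ _ hx))
    exact ((comp_iff_wayBelow hf hS hprec hle).1 this).le
  prec_add a a' b b' := by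
    rw [hprec, hprec, hprec]
    exact hS.add_wayBelow_add _ _ _ _
  le_add a a' b b' := by
    rw [hle, hle, hle, map_add, map_add]
    exact hT.add_le_add _ _ _ _
  continuous a b c h h' := by
    obtain ⟨d, had, hdb⟩ := hS.exists_between ((hprec _ _).1 h)
    exact ⟨d, (hprec _ _).2 had, (comp_iff_wayBelow hf hS hprec hle).2
      ((hf.map_wayBelow _ _ hdb).trans_le ((hle _ _).1 h'))⟩

namespace Quo

variable {h : α.IsNormal}

theorem prec_mk_iff (hf : IsCuMorphism f) (hS : IsCuSemigroup S)
    (hprec : ∀ a b, α.prec a b ↔ WayBelow a b) (hle : ∀ a b, α.le a b ↔ f a ≤ f b) (a b : S) :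
    prec (mk α h a) (mk α h b) ↔ WayBelow (f a) (f b) := by
  constructor
  · rintro ⟨a', b', ha, hb, hab⟩
    have ha' := (hle _ _).1 (mk_eq_mk.1 ha).2
    have hb' := (hle _ _).1 (mk_eq_mk.1 hb).1
    exact wayBelow_of_le_of_wayBelow ha' (((comp_iff_wayBelow hf hS hprec hle).1 hab).trans_le hb')
  · exact fun hab => ⟨a, b, rfl, rfl, (comp_iff_wayBelow hf hS hprec hle).2 hab⟩

/-- The isomorphism from the quotient to the image of a map that induces the preorder. -/
def equiv [PartialOrder X] (g : S →+ X) (hsurj : Function.Surjective g)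
    (hle : ∀ a b, α.le a b ↔ g a ≤ g b) : α.Quo h ≃+o X where
  __ := AddEquiv.ofBijective
    (lift (h := h) g fun a b hab hba => le_antisymm ((hle a b).1 hab) ((hle b a).1 hba)) (by
    constructor
    · intro x y hxy
      obtain ⟨a, rfl⟩ := mk_surjective x
      obtain ⟨b, rfl⟩ := mk_surjective y
      rw [lift_mk, lift_mk] at hxy
      exact mk_eq_mk.2 ⟨(hle a b).2 hxy.le, (hle b a).2 hxy.ge⟩
    · intro x
      obtain ⟨a, rfl⟩ := hsurj x
      exact ⟨mk α h a, rfl⟩)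
  map_le_map_iff' {x y} := by
    obtain ⟨a, rfl⟩ := mk_surjective x
    obtain ⟨b, rfl⟩ := mk_surjective y
    exact (hle a b).symm.trans mk_le_mk.symm

/-- Surjectivity matters: it makes the quotient order isomorphic to all of `T`, so that its
intrinsic `≪` is that of `T`. -/
theorem prec_iff_wayBelow (hf : IsCuMorphism f) (hS : IsCuSemigroup S)
    (hprec : ∀ a b, α.prec a b ↔ WayBelow a b) (hle : ∀ a b, α.le a b ↔ f a ≤ f b)
    (hsurj : Function.Surjective f) (x y : α.Quo h) : prec x y ↔ WayBelow x y := by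
  obtain ⟨a, rfl⟩ := mk_surjective x
  obtain ⟨b, rfl⟩ := mk_surjective y
  rw [prec_mk_iff hf hS hprec hle]
  exact wayBelow_orderIso_iff (a := mk α h a) (b := mk α h b)
    (equiv (h := h) f hsurj hle : α.Quo h ≃o T)

theorem isCuMorphism_mk (hf : IsCuMorphism f) (hle : ∀ a b, α.le a b ↔ f a ≤ f b)
    (hsurj : Function.Surjective f) : IsCuMorphism (mk α h) where
  monotone a b hab := mk_le_mk.2 ((hle a b).2 (hf.monotone hab))
  map_wayBelow a b hab :=
    (wayBelow_orderIso_iff (equiv (h := h) f hsurj hle : α.Quo h ≃o T)).1 (hf.map_wayBelow a b hab)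
  map_sup u s hu hs :=
    (isLUB_range_orderIso (equiv (h := h) f hsurj hle : α.Quo h ≃o T) (fun n => mk α h (u n))
      (mk α h s)).1 (hf.map_sup u s hu hs)

end Quo

end RelPair

theorem IsCuMorphism.isClosedIdeal {f : S →+ T} (hf : IsCuMorphism f) (hS : IsCuSemigroup S)
    (hT : IsCuSemigroup T) : IsClosedIdeal WayBelow {a | f a = 0} where
  zero_mem := map_zero f
  add_mem a b (ha : f a = 0) (hb : f b = 0) := by
    change f (a + b) = 0
    rw [map_add, ha, hb, add_zero]
  mem_of_prec a b h (hb : f b = 0) :=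
    le_antisymm ((hf.monotone h.le).trans_eq hb) (hT.zero_le _)
  mem_of_forall_prec a h :=
    le_antisymm (hf.le_of_forall_wayBelow hS fun x hx => (h x hx).le) (hT.zero_le _)

end Semigroups

/-! ### Exactness of the stabilisation and lifting of elements -/

section Exactness

attribute [local instance] CStarAlgebra.spectralOrder CStarAlgebra.spectralOrderedRing

variable {A B C : Type*} [NonUnitalCStarAlgebra A] [NonUnitalCStarAlgebra B]
  [NonUnitalCStarAlgebra C]

/-- The absolute value of `a` serves as `p`. It is formed inside the given algebra, later the
stabilised kernel. -/
theorem exists_isPositive_sub {D : Type*} [NonUnitalCStarAlgebra D] {a : D} (ha : IsSelfAdjoint a) :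
    ∃ p, IsPositive p ∧ IsPositive (p - a) := by
  have hc : ContinuousOn (fun t : ℝ => |t|) (quasispectrum ℝ a) := by fun_prop
  refine ⟨cfcₙ (fun t : ℝ => |t|) a, isPositive_iff_nonneg.2 (cfcₙ_nonneg fun t _ => abs_nonneg t), ?_⟩
  rw [isPositive_iff_nonneg]
  have h : cfcₙ (fun t : ℝ => |t|) a - a = cfcₙ (fun t : ℝ => |t| - t) a := by
    rw [cfcₙ_sub (fun t : ℝ => |t|) (fun t => t) a hc (by simp) continuousOn_id rfl, cfcₙ_id' ℝ a]
  rw [h]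
  exact cfcₙ_nonneg fun t _ => sub_nonneg.2 (le_abs_self t)

/-- The range of a ⋆-homomorphism is closed. -/
theorem mem_range_of_forall_near {D E : Type*} [NonUnitalCStarAlgebra D] [NonUnitalCStarAlgebra E]
    (f : D →⋆ₙₐ[ℂ] E) {b : E} (h : ∀ ε : ℝ, 0 < ε → ∃ a, ‖b - f a‖ < ε) : ∃ a, f a = b := by
  let F : NormedAddGroupHom D E :=
    { toFun := f
      map_add' := map_add f
      bound' := ⟨1, fun a => by
        rw [one_mul]
        exact NonUnitalStarAlgHom.norm_apply_le f a⟩ }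
  have hF : F.SurjectiveOnWith F.range 1 := by
    rintro _ ⟨a, rfl⟩
    obtain ⟨a', h1, h2⟩ := exists_norm_le_of_starHom f a
    exact ⟨a', h1, by rwa [one_mul]⟩
  obtain ⟨a, ha, -⟩ := controlled_closure_of_complete one_pos one_pos hF b (by
    refine Metric.mem_closure_iff.2 fun ε hε => ?_
    obtain ⟨a, ha⟩ := h ε hε
    exact ⟨f a, ⟨a, rfl⟩, by rwa [dist_eq_norm]⟩)
  exact ⟨a, ha⟩

namespace MInf

/-- The matrix in `M_∞(A)` with upper left corner `m` and zeros elsewhere. -/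
def ofCorner {n : ℕ} (m : CStarMatrix (Fin n) (Fin n) A) : MInf A :=
  ofFun (fun i j => if h : i < n ∧ j < n then m ⟨i, h.1⟩ ⟨j, h.2⟩ else 0)
    ⟨n, fun i j h => dif_neg (by omega)⟩

theorem ofCorner_apply {n : ℕ} (m : CStarMatrix (Fin n) (Fin n) A) (i j : Fin n) :
    ofCorner m i j = m i j :=
  dif_pos ⟨i.2, j.2⟩

theorem bd_ofCorner {n : ℕ} (m : CStarMatrix (Fin n) (Fin n) A) : Bd (ofCorner m) n :=
  fun i j h => dif_neg (by omega)

theorem corner_ofCorner {n : ℕ} (m : CStarMatrix (Fin n) (Fin n) A) :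
    corner n (ofCorner m) = m := by
  ext i j
  exact ofCorner_apply m i j

theorem ext_of_bd {x y : MInf A} {n : ℕ} (hx : Bd x n) (hy : Bd y n) (h : corner n x = corner n y) :
    x = y := by
  refine ext fun i j => ?_
  by_cases hij : i < n ∧ j < n
  · exact congrFun (congrFun h ⟨i, hij.1⟩) ⟨j, hij.2⟩
  · rw [hx i j (by omega), hy i j (by omega)]

theorem Bd.map {x : MInf A} {n : ℕ} (hx : Bd x n) (φ : A →⋆ₙₐ[ℂ] B) : Bd (map φ x) n :=
  fun i j h => by rw [map_apply, hx i j h, map_zero]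

/-- A norm-decreasing lift is available in each C⋆-algebra of finite matrices, and one corner
contains all nonzero entries. -/
theorem exists_map_eq_norm_le (φ : A →⋆ₙₐ[ℂ] B) (x : MInf A) :
    ∃ x' : MInf A, map φ x' = map φ x ∧ ‖x'‖ ≤ ‖map φ x‖ := by
  obtain ⟨n, hn⟩ := (eventually_bd x).exists
  obtain ⟨m, h1, h2⟩ := exists_norm_le_of_starHom (CStarMatrix.mapₙₐ φ) (corner n x)
  refine ⟨ofCorner m, ext_of_bd ((bd_ofCorner m).map φ) (hn.map φ) ?_, ?_⟩
  · calc corner n (map φ (ofCorner m)) = CStarMatrix.mapₙₐ φ (corner n (ofCorner m)) := rfl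
      _ = CStarMatrix.mapₙₐ φ (corner n x) := by rw [corner_ofCorner, h1]
  · rw [norm_eq (bd_ofCorner m), norm_eq (hn.map φ), corner_ofCorner]
    exact h2

theorem norm_map_of_injective (φ : A →⋆ₙₐ[ℂ] B) (hφ : Function.Injective φ) (x : MInf A) :
    ‖map φ x‖ = ‖x‖ := by
  obtain ⟨n, hn⟩ := (eventually_bd x).exists
  rw [norm_eq hn, norm_eq (hn.map φ)]
  refine NonUnitalStarAlgHom.norm_map (CStarMatrix.mapₙₐ φ) (fun a b hab => ?_) (corner n x)
  ext i j
  exact hφ (congrFun (congrFun hab i) j)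

theorem map_surjective {φ : A →⋆ₙₐ[ℂ] B} (hφ : Function.Surjective φ) :
    Function.Surjective (map φ) := by
  intro y
  obtain ⟨n, hn⟩ := (eventually_bd y).exists
  choose g hg using hφ
  refine ⟨ofFun (fun i j => if i < n ∧ j < n then g (y i j) else 0)
    ⟨n, fun i j h => if_neg (by omega)⟩, ext fun i j => ?_⟩
  rw [map_apply, ofFun_apply]
  split_ifs with h
  · exact hg _
  · rw [map_zero, hn i j (by omega)]

end MInf

namespace Stab

theorem map_surjective {φ : A →⋆ₙₐ[ℂ] B} (hφ : Function.Surjective φ) :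
    Function.Surjective (map φ) := by
  refine fun b => mem_range_of_forall_near _ fun ε hε => ?_
  obtain ⟨y, hy⟩ := exists_of_near b ε hε
  obtain ⟨x, rfl⟩ := MInf.map_surjective hφ y
  exact ⟨of x, by rwa [map_of]⟩

theorem norm_map_of_injective {φ : A →⋆ₙₐ[ℂ] B} (hφ : Function.Injective φ) (a : Stab A) :
    ‖map φ a‖ = ‖a‖ := by
  refine induction a (isClosed_eq (continuous_norm.comp (continuous_starHom _)) continuous_norm)
    fun x => ?_
  rw [map_of, LinearIsometry.norm_map, LinearIsometry.norm_map, MInf.norm_map_of_injective φ hφ]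

theorem map_injective {φ : A →⋆ₙₐ[ℂ] B} (hφ : Function.Injective φ) :
    Function.Injective (map φ) := by
  refine (injective_iff_map_eq_zero _).2 fun a ha => ?_
  rw [← norm_eq_zero, ← norm_map_of_injective hφ, ha, norm_zero]

theorem map_map {φ : A →⋆ₙₐ[ℂ] B} {ψ : B →⋆ₙₐ[ℂ] C} {χ : A →⋆ₙₐ[ℂ] C} (h : ∀ a, ψ (φ a) = χ a)
    (a : Stab A) : map ψ (map φ a) = map χ a := by
  refine induction a (isClosed_eq ((continuous_starHom _).comp (continuous_starHom _))
    (continuous_starHom _)) fun x => ?_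
  rw [map_of, map_of, map_of]
  congr 1
  exact MInf.ext fun i j => h (x i j)

theorem map_map_eq_zero {φ : A →⋆ₙₐ[ℂ] B} {ψ : B →⋆ₙₐ[ℂ] C} (h : ∀ a, ψ (φ a) = 0)
    (a : Stab A) : map ψ (map φ a) = 0 := by
  refine induction a (isClosed_eq ((continuous_starHom _).comp (continuous_starHom _))
    continuous_const) fun x => ?_
  rw [map_of, map_of, ← map_zero of]
  congr 1
  exact MInf.ext fun i j => h (x i j)

/-- Exactness of the stabilisation. -/
theorem exists_map_kernelIncl_eq {φ : A →⋆ₙₐ[ℂ] B} {a : Stab A} (ha : map φ a = 0) :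
    ∃ j, map (kernelIncl φ) j = a := by
  refine mem_range_of_forall_near _ fun ε hε => ?_
  obtain ⟨x, hx⟩ := exists_of_near a (ε / 2) (half_pos hε)
  -- The image of `x` is small because `x` is near the kernel, so it has a small lift `x'`.
  -- Subtracting `x'` puts all entries of `x` into `ker φ` without moving far from `a`.
  obtain ⟨x', h1, h2⟩ := MInf.exists_map_eq_norm_le φ x
  have h3 : ‖MInf.map φ x‖ ≤ ‖a - of x‖ := by
    have := NonUnitalStarAlgHom.norm_apply_le (map φ) (a - of x)
    rwa [map_sub, ha, zero_sub, norm_neg, map_of, LinearIsometry.norm_map] at this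
  have hk (i j : ℕ) : φ ((x - x') i j) = 0 := by
    have h4 : MInf.map φ (x - x') = 0 := by rw [map_sub, h1, sub_self]
    exact congrArg (fun y : MInf B => y i j) h4
  refine ⟨of (MInf.ofFun (fun i j => (⟨(x - x') i j, hk i j⟩ : kernel φ)) ?_), ?_⟩
  · obtain ⟨n, hn⟩ := (x - x').bounded
    exact ⟨n, fun i j h => Subtype.ext (hn i j h)⟩
  · rw [map_of, show MInf.map (kernelIncl φ) (MInf.ofFun
        (fun i j => (⟨(x - x') i j, hk i j⟩ : kernel φ)) _) = x - x' from MInf.ext fun i j => rfl,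
      map_sub]
    calc _ = ‖(a - of x) + of x'‖ := by congr 1; abel
      _ < ε := (norm_add_le _ _).trans_lt (by rw [LinearIsometry.norm_map]; linarith)

end Stab

/-! ### The ideal `Cu(ker φ)` and comparison modulo it -/

variable (φ : A →⋆ₙₐ[ℂ] B)

theorem kernelIncl_injective : Function.Injective (kernelIncl φ) := Subtype.val_injective

theorem map_map_kernelIncl (j : Stab (kernel φ)) : Stab.map φ (Stab.map (kernelIncl φ) j) = 0 :=
  Stab.map_map_eq_zero (fun a => a.2) j

theorem map_proj_eq_zero_iff {a : Stab A} : Stab.map (QuotKer.proj φ) a = 0 ↔ Stab.map φ a = 0 := by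
  constructor
  · intro h
    rw [← Stab.map_map (QuotKer.lift_proj φ), h, map_zero]
  · intro h
    obtain ⟨j, rfl⟩ := Stab.exists_map_kernelIncl_eq h
    exact Stab.map_map_eq_zero (fun a => QuotKer.mk_eq_mk.2 (a.2.trans (map_zero φ).symm)) j

variable {φ}

/-- If `φ` kills `y⋆ y`, it kills `y` by the C⋆-identity. Lifting `y` rather than `a` gives a
positive lift. -/
theorem exists_isPositive_map_kernelIncl_eq {a : Stab A} (ha : IsPositive a)
    (h : Stab.map φ a = 0) : ∃ j, IsPositive j ∧ Stab.map (kernelIncl φ) j = a := by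
  obtain ⟨y, rfl⟩ := ha
  have hy : Stab.map φ y = 0 := by
    rwa [map_mul, map_star, CStarRing.star_mul_self_eq_zero_iff] at h
  obtain ⟨j, rfl⟩ := Stab.exists_map_kernelIncl_eq hy
  exact ⟨star j * j, ⟨j, rfl⟩, by rw [map_mul, map_star]⟩

/-- The conjugator `x` need not lie in the ideal, but `e x f` does for approximate units `e`, `f` of
the ideal, and it works almost as well. -/
theorem cuntzLE_of_map_kernelIncl {s t : Stab (kernel φ)}
    (h : CuntzLE (Stab.map (kernelIncl φ) s) (Stab.map (kernelIncl φ) t)) : CuntzLE s t := by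
  intro ε hε
  obtain ⟨x, hx⟩ := h (ε / 3) (by positivity)
  obtain ⟨e, -, he, he', -⟩ := exists_conj_near s s (ε := ε / 3) (by positivity)
  -- The error at `t` is conjugated by `x`, so its tolerance is divided by `‖x‖ ^ 2 + 1`.
  obtain ⟨f, -, hf, hf', -⟩ := exists_conj_near t t (ε := ε / (3 * (‖x‖ ^ 2 + 1))) (by positivity)
  set ι := Stab.map (kernelIncl φ) with hι
  obtain ⟨y, hy⟩ := Stab.exists_map_kernelIncl_eq (φ := φ) (a := ι e * x * ι f) (by
    rw [map_mul, map_mul, map_map_kernelIncl, zero_mul, zero_mul])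
  refine ⟨y, ?_⟩
  rw [← Stab.norm_map_of_injective (kernelIncl_injective φ), map_sub, map_mul, map_mul, map_star, hy,
    ← hι]
  have h1 : ι s - ι e * x * ι f * ι t * star (ι e * x * ι f)
      = ι (s - e * s * star e) + (ι e * (ι s - x * ι t * star x) * star (ι e)
        + ι e * (x * ι (t - f * t * star f) * star x) * star (ι e)) := by
    simp only [map_sub, map_mul, map_star, star_mul]
    noncomm_ring
  have hιn (a : Stab (kernel φ)) : ‖ι a‖ ≤ ‖a‖ := NonUnitalStarAlgHom.norm_apply_le ι a
  have h2 : ‖ι e‖ ≤ 1 := (hιn e).trans he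
  have h3 := hιn (s - e * s * star e)
  have h4 := Stab.norm_conj_le (a := ι s - x * ι t * star x) h2
  have h5 := Stab.norm_conj_le (a := x * ι (t - f * t * star f) * star x) h2
  have h6 : ‖x * ι (t - f * t * star f) * star x‖ ≤ ε / 3 := by
    refine (norm_conj_le' _ _).trans ?_
    calc _ ≤ (‖x‖ ^ 2 + 1) * (ε / (3 * (‖x‖ ^ 2 + 1))) := by
          gcongr
          · linarith
          · exact (hιn _).trans hf'.le
      _ = ε / 3 := by field_simp
  rw [h1]
  exact (norm_add_le _ _).trans_lt (by
    linarith [norm_add_le (ι e * (ι s - x * ι t * star x) * star (ι e))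
      (ι e * (x * ι (t - f * t * star f) * star x) * star (ι e))])

theorem Cu.map_kernelIncl_le_iff (s t : Cu (kernel φ)) :
    Cu.map (kernelIncl φ) s ≤ Cu.map (kernelIncl φ) t ↔ s ≤ t := by
  refine ind s fun a => ind t fun b => ?_
  exact ⟨cuntzLE_of_map_kernelIncl, fun h => CuntzLE.map _ h⟩

theorem Cu.map_mk_eq_zero_iff (φ : A →⋆ₙₐ[ℂ] B) {a : PosStab A} :
    Cu.map φ (mk a) = 0 ↔ Stab.map φ a.1 = 0 := by
  rw [zero_def, map_mk, mk_eq_mk]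
  exact ⟨fun h => cuntzLE_zero_iff.1 h.1, fun h => ⟨cuntzLE_zero_iff.2 h, zero_cuntzLE _⟩⟩

theorem Cu.map_surjective {φ : A →⋆ₙₐ[ℂ] B} (hφ : Function.Surjective φ) :
    Function.Surjective (Cu.map φ) := by
  refine fun t => ind t ?_
  rintro ⟨_, ⟨y, rfl⟩⟩
  obtain ⟨x, rfl⟩ := Stab.map_surjective hφ y
  have hx : IsPositive (star x * x) := ⟨x, rfl⟩
  exact ⟨mk ⟨_, hx⟩, congrArg mk (Subtype.ext (by
    change Stab.map φ (star x * x) = _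
    rw [map_mul, map_star]))⟩

theorem Cu.map_map {φ : A →⋆ₙₐ[ℂ] B} {ψ : B →⋆ₙₐ[ℂ] C} {χ : A →⋆ₙₐ[ℂ] C}
    (h : ∀ a, ψ (φ a) = χ a) (s : Cu A) : Cu.map ψ (Cu.map φ s) = Cu.map χ s := by
  refine ind s fun a => ?_
  rw [map_mk, map_mk, map_mk]
  congr 1
  exact Subtype.ext (Stab.map_map h a.1)

theorem proj_surjective (φ : A →⋆ₙₐ[ℂ] B) : Function.Surjective (QuotKer.proj φ) :=
  fun x => QuotKer.ind x fun a => ⟨a, rfl⟩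

theorem lift_injective (φ : A →⋆ₙₐ[ℂ] B) : Function.Injective (QuotKer.lift φ) :=
  fun x y => QuotKer.ind x fun _ => QuotKer.ind y fun _ h => QuotKer.mk_eq_mk.2 h

/-- A class vanishes only if its representative does, so this is exactness on positive elements. -/
theorem kerIdeal_eq : kerIdeal φ = {s | Cu.map φ s = 0} := by
  ext s
  constructor
  · rintro ⟨j, rfl⟩
    exact Cu.ind j fun j => (Cu.map_mk_eq_zero_iff φ).2 (map_map_kernelIncl φ j.1)
  · refine Cu.ind s fun a ha => ?_
    obtain ⟨j, hj, hja⟩ :=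
      exists_isPositive_map_kernelIncl_eq a.2 ((Cu.map_mk_eq_zero_iff φ).1 ha)
    exact ⟨Cu.mk ⟨j, hj⟩, congrArg Cu.mk (Subtype.ext hja)⟩

theorem map_proj_eq_zero_of_mem_kerIdeal {s : Cu A} (hs : s ∈ kerIdeal φ) :
    Cu.map (QuotKer.proj φ) s = 0 := by
  rw [kerIdeal_eq] at hs
  revert hs
  refine Cu.ind s fun a ha => ?_
  exact (Cu.map_mk_eq_zero_iff _).2 ((map_proj_eq_zero_iff φ).2 ((Cu.map_mk_eq_zero_iff φ).1 ha))

/-- The analytic core. Modulo a positive element of the kernel, comparison in `A / ker φ` lifts to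
comparison of cut-downs in `A`; the kernel element may depend on the cut-down, as `≤_I` permits. -/
theorem exists_wayBelow_add_of_map_proj_le {x s t : Cu A}
    (hst : Cu.map (QuotKer.proj φ) s ≤ Cu.map (QuotKer.proj φ) t) (hx : WayBelow x s) :
    ∃ y ∈ kerIdeal φ, WayBelow x (t + y) := by
  -- Interpolation reduces the required `≪` to an inequality.
  obtain ⟨x', hxx', hx's⟩ := Cu.isCuSemigroup.exists_between hx
  suffices ∃ y ∈ kerIdeal φ, x' ≤ t + y by
    obtain ⟨y, hy, h⟩ := this
    exact ⟨y, hy, hxx'.trans_le h⟩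
  revert hst hx's
  clear hxx' hx
  refine Cu.ind x' fun c => Cu.ind s fun a => Cu.ind t fun b hab hca => ?_
  obtain ⟨δ, hδ, d, hd, hcd⟩ := Cu.wayBelow_iff.1 hca
  set π := Stab.map (QuotKer.proj φ) with hπ
  have hab' : CuntzLE (π a.1) (π b.1) := hab
  obtain ⟨w, hw⟩ := hab' δ hδ
  obtain ⟨x, rfl⟩ := Stab.map_surjective (proj_surjective φ) w
  have hsa {D : Type _} [NonUnitalCStarAlgebra D] {z : D} (hz : IsPositive z) : star z = z := by
    obtain ⟨y, rfl⟩ := hz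
    exact IsSelfAdjoint.star_mul_self y
  set h := a.1 - x * b.1 * star x with hh
  have hs : star h = h := by rw [hh, star_sub, hsa a.2, hsa (b.2.conj x)]
  have hπh : ‖π h‖ < δ := by rwa [hh, map_sub, map_mul, map_mul, map_star]
  obtain ⟨r, hr, hrn⟩ := exists_norm_le_of_starHom π h
  -- `π h` is self-adjoint, so the self-adjoint part of `r` is still a lift of it, of norm at most
  -- `δ`.
  set r' := (1 / 2 : ℂ) • (r + star r) with hr'
  have hrs : star r' = r' := by
    rw [hr', star_smul, star_add, star_star, add_comm]
    simp
  have hrn' : ‖r'‖ ≤ δ := by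
    have h1 := norm_add_le r (star r)
    rw [norm_star] at h1
    rw [hr', norm_smul]
    norm_num
    linarith
  have hrπ : π (h - r') = 0 := by
    rw [map_sub, hr', map_smul, map_add, map_star, hr, ← map_star, hs, ← two_smul ℂ, smul_smul]
    norm_num
  -- Now `a = x b x⋆ + r' + j` with `j` in the kernel. Replacing `j` by a positive `p ≥ j` leaves an
  -- inequality whose only non-positive error `r'` is absorbed by the cut-down.
  obtain ⟨j, hj⟩ := Stab.exists_map_kernelIncl_eq ((map_proj_eq_zero_iff φ).1 hrπ)
  have hjs : IsSelfAdjoint j := Stab.map_injective (kernelIncl_injective φ) (by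
    rw [map_star, hj, star_sub, hs, hrs])
  obtain ⟨p, hp, hpj⟩ := exists_isPositive_sub hjs
  set p' : PosStab (kernel φ) := ⟨p, hp⟩
  refine ⟨Cu.mk (p'.map (kernelIncl φ)), ⟨Cu.mk p', rfl⟩, ?_⟩
  refine (Cu.mk_le_mk (a := c) (b := b.oplus (p'.map (kernelIncl φ)))).2 (hcd.trans ?_)
  have h1 : CuntzLE d.1 (x * b.1 * star x + Stab.map (kernelIncl φ) p) := by
    refine hd.cuntzLE hrs hrn' ?_
    have h2 : x * b.1 * star x + Stab.map (kernelIncl φ) p + r' - a.1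
        = Stab.map (kernelIncl φ) (p - j) := by
      rw [map_sub, hj, hh]
      abel
    rw [h2]
    exact hpj.map _
  exact h1.trans ((Stab.add_cuntzLE_oplus (b.2.conj x) (hp.map _)).trans
    (Stab.cuntzLE_oplus (cuntzLE_conj x b.1) (CuntzLE.refl _)))

/-- The forward direction applies `Cu(π)`, which kills the ideal; the converse is the lifting result
above. -/
theorem cuIdealPair_le_iff {s t : Cu A} :
    (cuIdealPair φ).le s t ↔ Cu.map (QuotKer.proj φ) s ≤ Cu.map (QuotKer.proj φ) t := by
  refine ⟨fun h => (Cu.isCuMorphism_map _).le_of_forall_wayBelow Cu.isCuSemigroup fun x hx => ?_,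
    fun h x hx => exists_wayBelow_add_of_map_proj_le h hx⟩
  obtain ⟨y, hy, hxy⟩ := h x hx
  have := (Cu.isCuMorphism_map (QuotKer.proj φ)).monotone hxy.le
  rwa [map_add, map_proj_eq_zero_of_mem_kerIdeal hy, add_zero] at this

theorem cuKernelPair_le_iff {s t : Cu A} :
    (cuKernelPair φ).le s t ↔ Cu.map φ s ≤ Cu.map φ t :=
  kernelPair_le_iff Cu.isCuSemigroup

theorem kerIdeal_eq_ideal : kerIdeal φ = (cuKernelPair φ).ideal := by
  rw [kerIdeal_eq]
  ext s
  refine Iff.trans ?_ cuKernelPair_le_iff.symm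
  rw [map_zero]
  exact ⟨fun h => le_of_eq h, fun h => le_antisymm h (Cu.isCuSemigroup.zero_le _)⟩

theorem mem_cuImage (s : Cu A) : Cu.map φ s ∈ cuImage φ := Cu.ind s fun a => ⟨a, rfl⟩

variable (φ) in
/-- `Cu(φ)` as a map onto its image. -/
def toCuImage : Cu A →+ cuImage φ := (Cu.map φ).codRestrict (cuImage φ) mem_cuImage

theorem toCuImage_surjective : Function.Surjective (toCuImage φ) := by
  rintro ⟨_, a, rfl⟩
  exact ⟨Cu.mk a, rfl⟩

end Exactness

end CuntzSemigroup

end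

/-! ### Assembly of the diagram -/

theorem mainTheorem5 {A B : Type*} [NonUnitalCStarAlgebra A] [NonUnitalCStarAlgebra B]
    (φ : A →⋆ₙₐ[ℂ] B) (hσ : IsSigmaUnital (kernel φ)) :
    -- the factorisation `φ = φbar ∘ π` through `A / ker φ`
    (Function.Surjective (QuotKer.proj φ) ∧ Function.Injective (QuotKer.lift φ) ∧
      ∀ a, QuotKer.lift φ (QuotKer.proj φ a) = φ a) ∧
    -- the upper triangle of `Cu`-semigroups and `Cu`-morphisms
    (IsCuSemigroup (Cu A) ∧ IsCuSemigroup (Cu B) ∧ IsCuSemigroup (Cu (QuotKer φ)) ∧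
      IsCuMorphism (Cu.map φ) ∧ IsCuMorphism (Cu.map (QuotKer.proj φ)) ∧
      IsCuMorphism (Cu.map (QuotKer.lift φ)) ∧
      Function.Surjective (Cu.map (QuotKer.proj φ)) ∧
      ∀ s, Cu.map (QuotKer.lift φ) (Cu.map (QuotKer.proj φ) s) = Cu.map φ s) ∧
    -- `Cu(ker φ)` is a closed ideal of `Cu(A)`, and equals the ideal of the kernel pair
    ((∀ s t, Cu.map (kernelIncl φ) s ≤ Cu.map (kernelIncl φ) t ↔ s ≤ t) ∧
      IsClosedIdeal WayBelow (kerIdeal φ) ∧ kerIdeal φ = (cuKernelPair φ).ideal) ∧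
    ∃ (hI : (cuIdealPair φ).IsNormal) (hK : (cuKernelPair φ).IsNormal),
      -- the quotient `Cu(A)/Cu(ker φ)`
      (IsCuSemigroup ((cuIdealPair φ).Quo hI) ∧
        (∀ x y : (cuIdealPair φ).Quo hI, RelPair.Quo.prec x y ↔ WayBelow x y) ∧
        IsCuMorphism (RelPair.Quo.mk (cuIdealPair φ) hI) ∧
        Function.Surjective (RelPair.Quo.mk (cuIdealPair φ) hI)) ∧
      -- the quotient `Cu(A)/ker(Cu(φ))`
      (IsWSemigroup ((cuKernelPair φ).Quo hK) RelPair.Quo.prec ∧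
        IsWMorphism WayBelow RelPair.Quo.prec (RelPair.Quo.mk (cuKernelPair φ) hK) ∧
        Function.Surjective (RelPair.Quo.mk (cuKernelPair φ) hK)) ∧
      -- the image `{[φ(a)]}` and its inclusion into `Cu(B)`
      (IsWSemigroup (cuImage φ) (imagePrec φ) ∧
        IsWMorphism (imagePrec φ) WayBelow (cuImage φ).subtype) ∧
      -- the remaining arrows
      ∃ (Ψ : (cuIdealPair φ).Quo hI ≃+o Cu (QuotKer φ))
        (Θ : (cuIdealPair φ).Quo hI →+ (cuKernelPair φ).Quo hK)
        (Φ : (cuKernelPair φ).Quo hK ≃+o cuImage φ),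
        (Monotone Θ ∧ IsWMorphism RelPair.Quo.prec RelPair.Quo.prec Θ ∧ Function.Surjective Θ) ∧
        (∀ x y, RelPair.Quo.prec x y ↔ imagePrec φ (Φ x) (Φ y)) ∧
        (∃ j : (cuKernelPair φ).Quo hK →+ Cu B, (∀ x, j x = (Φ x : Cu B)) ∧
          Function.Injective j ∧ IsWMorphism RelPair.Quo.prec WayBelow j) ∧
        -- commutativity
        (∀ s, Ψ (RelPair.Quo.mk (cuIdealPair φ) hI s) = Cu.map (QuotKer.proj φ) s) ∧
        (∀ s, Θ (RelPair.Quo.mk (cuIdealPair φ) hI s) = RelPair.Quo.mk (cuKernelPair φ) hK s) ∧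
        (∀ s, (Φ (RelPair.Quo.mk (cuKernelPair φ) hK s) : Cu B) = Cu.map φ s) ∧
        (∀ x, (Φ (Θ x) : Cu B) = Cu.map (QuotKer.lift φ) (Ψ x)) := by
  have hA : IsCuSemigroup (Cu A) := Cu.isCuSemigroup
  have hB : IsCuSemigroup (Cu B) := Cu.isCuSemigroup
  have hQ : IsCuSemigroup (Cu (QuotKer φ)) := Cu.isCuSemigroup
  have hφ := Cu.isCuMorphism_map φ
  have hπ := Cu.isCuMorphism_map (QuotKer.proj φ)
  have hι := Cu.isCuMorphism_map (QuotKer.lift φ)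
  have hπs : Function.Surjective (Cu.map (QuotKer.proj φ)) := Cu.map_surjective (proj_surjective φ)
  have hcomp : ∀ s, Cu.map (QuotKer.lift φ) (Cu.map (QuotKer.proj φ) s) = Cu.map φ s :=
    Cu.map_map (QuotKer.lift_proj φ)
  have hIp : ∀ a b, (cuIdealPair φ).prec a b ↔ WayBelow a b := fun _ _ => Iff.rfl
  have hKp : ∀ a b, (cuKernelPair φ).prec a b ↔ WayBelow a b := fun _ _ => Iff.rfl
  have hIl := fun a b => cuIdealPair_le_iff (φ := φ) (s := a) (t := b)
  have hKl := fun a b => cuKernelPair_le_iff (φ := φ) (s := a) (t := b)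
  have hI := RelPair.isNormal_of_isCuMorphism hπ hA hQ hIp hIl
  have hK := RelPair.isNormal_of_isCuMorphism hφ hA hB hKp hKl
  have hIq := RelPair.Quo.prec_mk_iff (h := hI) hπ hA hIp hIl
  have hKq := RelPair.Quo.prec_mk_iff (h := hK) hφ hA hKp hKl
  -- The relation on the image is `≪` of `Cu B` restricted, not compact containment computed inside
  -- the image, so this holds by definition.
  have hMq : ∀ a b, imagePrec φ (toCuImage φ a) (toCuImage φ b) ↔
      WayBelow (Cu.map φ a) (Cu.map φ b) := fun _ _ => Iff.rfl
  have hπφ : ∀ a b, WayBelow (Cu.map (QuotKer.proj φ) a) (Cu.map (QuotKer.proj φ) b) →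
      WayBelow (Cu.map φ a) (Cu.map φ b) := fun a b h => by
    rw [← hcomp, ← hcomp]
    exact hι.map_wayBelow _ _ h
  have hlφ : ∀ a b, (cuIdealPair φ).le a b → Cu.map φ a ≤ Cu.map φ b := fun a b h => by
    rw [← hcomp, ← hcomp]
    exact hι.monotone ((hIl a b).1 h)
  have hIs := RelPair.Quo.mk_surjective (α := cuIdealPair φ) (h := hI)
  have hKs := RelPair.Quo.mk_surjective (α := cuKernelPair φ) (h := hK)
  -- Both isomorphisms are first isomorphism theorems, for `Cu(π)` and for `Cu(φ)` onto its image.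
  let Ψ := RelPair.Quo.equiv (h := hI) (Cu.map (QuotKer.proj φ)) hπs hIl
  let Φ := RelPair.Quo.equiv (h := hK) (toCuImage φ) toCuImage_surjective hKl
  let Θ := RelPair.Quo.lift (h := hI) (RelPair.Quo.mk (cuKernelPair φ) hK) fun a b hab hba =>
    RelPair.Quo.mk_eq_mk.2 ⟨(hKl a b).2 (hlφ a b hab), (hKl b a).2 (hlφ b a hba)⟩
  refine ⟨⟨proj_surjective φ, lift_injective φ, QuotKer.lift_proj φ⟩,
    ⟨hA, hB, hQ, hφ, hπ, hι, hπs, hcomp⟩,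
    ⟨Cu.map_kernelIncl_le_iff, ?_, kerIdeal_eq_ideal⟩, hI, hK,
    ⟨IsCuSemigroup.of_orderAddMonoidIso Ψ hQ, RelPair.Quo.prec_iff_wayBelow hπ hA hIp hIl hπs,
      RelPair.Quo.isCuMorphism_mk hπ hIl hπs, hIs⟩,
    ⟨IsWSemigroup.of_surjective hφ hA hB hKs hKq,
      IsWMorphism.of_surjective isCuMorphism_id hφ hA (g := AddMonoidHom.id _)
        Function.surjective_id hKs (fun _ _ => Iff.rfl) hKq hφ.map_wayBelow fun _ => rfl, hKs⟩,
    ⟨IsWSemigroup.of_surjective hφ hA hB toCuImage_surjective hMq,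
      IsWMorphism.of_comp_eq hφ hA toCuImage_surjective hMq fun _ => rfl⟩,
    Ψ, Θ, Φ, ⟨?_, IsWMorphism.of_surjective hπ hφ hA hIs hKs hIq hKq hπφ fun _ => rfl, ?_⟩, ?_,
    ⟨(cuImage φ).subtype.comp (Φ : (cuKernelPair φ).Quo hK →+ cuImage φ), fun _ => rfl,
      Subtype.val_injective.comp Φ.injective,
      IsWMorphism.of_comp_eq hφ hA hKs hKq fun _ => rfl⟩,
    fun _ => rfl, fun _ => rfl, fun _ => rfl, ?_⟩
  · rw [kerIdeal_eq]
    exact hφ.isClosedIdeal hA hB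
  · intro x y
    obtain ⟨a, rfl⟩ := hIs x
    obtain ⟨b, rfl⟩ := hIs y
    exact fun h => RelPair.Quo.mk_le_mk.2 ((hKl a b).2 (hlφ a b (RelPair.Quo.mk_le_mk.1 h)))
  · intro y
    obtain ⟨a, rfl⟩ := hKs y
    exact ⟨RelPair.Quo.mk _ hI a, rfl⟩
  · intro x y
    obtain ⟨a, rfl⟩ := hKs x
    obtain ⟨b, rfl⟩ := hKs y
    exact hKq a b
  · intro x
    obtain ⟨a, rfl⟩ := hIs x
    exact (hcomp a).symm
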